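/- Let $G$ be a finite group, $G'\subseteq G$ a subgroup, $k$ a field of characteristic zero containing all roots of unity of order dividing $|G|$, and $n\ge 0$ an integer. **Conventions.** The group $\mathrm{Burn}_n(G)$ is the abelian group generated by symbols $(H, Z\circlearrowright K,\beta)$, where $H\subseteq G$ is an abelian subgroup, $Z=Z_G(H)/H$, $K$ is a $Z$-Galois algebra over a function field $K_0=K^Z$ of transcendence degree $d\le n$ over $k$ such that $\mathrm H^1(Z_G(H),K^\times)\to \mathrm H^1(H,K^\times)^Z\cong H^\vee=\mathrm{Hom}(H,k^\times)$ is surjective ($K$ is taken up to isomorphism), and $\beta=(b_1,\dots,b_{n-d})$ is a sequence of nonzero characters generating $H^\vee$. The relations are: symbols that differ by reordering $\beta$, or by conjugation in $G$, are equal; $(H,Z\circlearrowright K,\beta)=0$ if $b_1+b_2=0$; and $(H,Z\circlearrowright K,\beta)=\Theta_1+\Theta_2$. Here $\Theta_1=0$ if $b_1=b_2$, and otherwise $\Theta_1=(H,Z\circlearrowright K,(b_1,b_2-b_1,b_3,\dots))+(H,Z\circlearrowright K,(b_2,b_1-b_2,b_3,\dots))$; with $b=b_1-b_2$, $\Theta_2=0$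 if some $b_i\in\langle b\rangle$, and otherwise $\Theta_2=(\overline H,\ Z_G(\overline H)/\overline H\circlearrowright \mathrm{Ind}\,K(t),\ (b_2,b_3,\dots)|_{\overline H})$, where $\overline H=\ker b$, $Z_G(H)$ acts on $K(t)$ by $t\mapsto c_g t$ for a cocycle $c$ lifting $b$, and $\mathrm{Ind}$ is from $Z_G(H)/\overline H$ to $Z_G(\overline H)/\overline H$. The Burnside group of orbifolds $\overline{\mathrm{Burn}}_n$ is generated by triples $(K,A,(a_1,\dots,a_{n-d}))$ up to isomorphism, where $K$ is a function field of transcendence degree $d\le n$ over $k$ and $(a_i)$ is a sequence of nonzero elements generating the finite abelian group $A$, modulo reordering, vanishing when $a_1+a_2=0$, and the analogous relation $(K,A,a)=\Theta_1+\Theta_2$, where $\Theta_1$ is as above, $\Theta_2=0$ if some $a_i\in\langle a_1-a_2\rangle$, and otherwise $\Theta_2=(K(t),A/\langle a_1-a_2\rangle,(\bar a_2,\bar a_3,\dots))$. The homomorphism $\kappa^G\colon \mathrm{Burn}_n(G)\to\overline{\mathrm{Burn}}_n$ is $(H,Z\circlearrowright K,\beta)\mapsto (K^Z,H^\vee,\beta)$.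 A $G$-variety is a quasi-projective scheme over $k$ with a right $G$-action, transitive on irreducible components. A smooth $G$-variety $X$ is called *divisorial* if all stabilizers are abelian and, for each component of a fixed locus $X^H$ with generic stabilizer $H$, every character of $H$ is the character of $H$ on the generic fiber of some $G$-linearized line bundle on $X$. For a smooth projective divisorial $G$-variety $X$ of dimension $n$ with generically free action, $$[X\circlearrowleft G]=\sum_{F} (H,Z\circlearrowright k(F),\beta_F(X)),$$ the sum being over $G$-orbits of components of fixed loci $X^H$ with generic stabilizer $H$, where $F$ is the $Z_G(H)$-orbit of the component and $\beta_F(X)$ records the generic normal bundle representation; for quasi-projective $X$ the same sum is denoted $[X\circlearrowleft G]^{\mathrm{naive}}$. In general, for a smooth quasi-projective $G$-variety $X$ with generically free action one chooses an equivariant proper birational morphism to $X$ from $U=Y\setminus D$, with $Y$ a smooth projective divisorial $G$-variety with generically free action and $D=D_1\cup\dots\cup D_\ell$ a simple normal crossing divisor with all $D_j$ $G$-invariant, and $$[X\circlearrowleft G]=[Y\circlearrowleft G]+\sum_{\emptyset\ne J\subseteq\{1,\dots,\ell\}}(-1)^{|J|}[\mathcal N_{D_J/Y}\circlearrowleft G]^{\mathrm{naive}},\qquad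 D_J=\bigcap_{j\in J}D_j.$$ This is known not to depend on the choices. **Proposition.** There are unique homomorphisms $\kappa^G$, $\kappa^{G'}$ as above, and there is a unique homomorphism $$\mathrm{ind}_{G'}^G\colon \mathrm{Burn}_n(G')\to \mathrm{Burn}_n(G),\qquad (H',Z'\circlearrowright K,\beta)\mapsto \bigl(H',\ Z_G(H')/H'\circlearrowright \mathrm{Ind}_{Z'}^{Z_G(H')/H'}K,\ \beta\bigr),\quad Z'=Z_{G'}(H')/H'.$$ Let $X$ be a smooth quasi-projective $G'$-variety of dimension $n$ with generically free $G'$-action. Then the quotient $X\times^{G'}G$ of $X\times G$ by the diagonal action of $G'$ exists and is a smooth quasi-projective $G$-variety of dimension $n$ with generically free $G$-action, and $$\mathrm{ind}_{G'}^G([X\circlearrowleft G'])=[X\times^{G'}G\circlearrowleft G]\in\mathrm{Burn}_n(G).$$ More precisely, if $X$ is projective and divisorial then so is $X\times^{G'}G$, and $\mathrm{ind}_{G'}^G$ takes the sum defining $[X\circlearrowleft G']$ to the sum defining $[X\times^{G'}G\circlearrowleft G]$; in general, every value of the formula for $[X\circlearrowleft G']$ obtained from a choice of $(U,Y,D)$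 is mapped to a value of the formula for $[X\times^{G'}G\circlearrowleft G]$. Furthermore, $$\kappa^G\circ\mathrm{ind}_{G'}^G=\kappa^{G'}.$$ -/

import Mathlib

open CategoryTheory AlgebraicGeometry

universe u v

noncomputable section

namespace EqBurnside

/-! ## Galois algebras, induction of algebras, symbols -/

section Algebra

/-- The subalgebra of invariants of a group acting on a `k`-algebra. -/
def invariants {k : Type u} [Field k] {P : Type v} [Group P] {K : Type u} [CommRing K]
    [Algebra k K] (ρ : P →* (K ≃ₐ[k] K)) : Subalgebra k K where
  carrier := {a | ∀ z, ρ z a = a}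
  mul_mem' := fun ha hb z => by rw [map_mul, ha z, hb z]
  add_mem' := fun ha hb z => by rw [map_add, ha z, hb z]
  algebraMap_mem' := fun c z => (ρ z).commutes c

variable (k : Type u) [Field k] {G : Type v} [Group G]

/-- Multiplicative `1`-cocycles of a group `P` acting on `K`, with values in `Kˣ`. -/
def IsCocycle {k : Type u} [Field k] {P : Type v} [Group P] {K : Type u} [CommRing K]
    [Algebra k K] (ρ : P →* (K ≃ₐ[k] K)) (c : P → Kˣ) : Prop :=
  ∀ g h : P, (c (g * h) : K) = c g * ρ g (c h : K)

/-- For a subgroup `H` of `G`, with `Z = Z_G(H)/H`: a `Z`-Galois algebra `K/K₀`, where `K₀` is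
the function field of a `d`-dimensional variety over `k`, satisfying the condition that
`H¹(Z_G(H), Kˣ) → H¹(H, Kˣ)^Z = H^∨` is surjective. An action of `Z` is recorded as an action of
`Z_G(H)` for which the elements of `H` act trivially. -/
structure GaloisAlg (H : Subgroup G) (d : ℕ) where
  /-- the algebra -/
  K : Type u
  [ring : CommRing K]
  [algebra : Algebra k K]
  /-- the action -/
  ρ : Subgroup.centralizer (H : Set G) →* (K ≃ₐ[k] K)
  trivial_on : ∀ z : Subgroup.centralizer (H : Set G), (z : G) ∈ H → ρ z = 1
  isField : IsField (invariants ρ)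
  fg : Algebra.EssFiniteType k (invariants ρ)
  trdeg : Algebra.trdeg k (invariants ρ) = d
  etale : Algebra.Etale (invariants ρ) K
  rank : Module.finrank (invariants ρ) K * Nat.card H =
    Nat.card (Subgroup.centralizer (H : Set G))
  lift_char : ∀ χ : H →* kˣ, ∃ c : Subgroup.centralizer (H : Set G) → Kˣ, IsCocycle ρ c ∧
    ∀ (z : Subgroup.centralizer (H : Set G)) (hz : (z : G) ∈ H),
      (c z : K) = algebraMap k K (χ ⟨z, hz⟩)

attribute [instance] GaloisAlg.ring GaloisAlg.algebra

variable (G)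

/-- The symbols `(H, Z ↻ K, β)`: `H` an abelian subgroup of `G`, `K` a `Z_G(H)/H`-Galois algebra
over a function field `K₀` of transcendence degree `d ≤ n` over `k`, and `β` a sequence of `n - d`
nontrivial characters of `H`, which generate the character group of `H`. Character groups are
written multiplicatively. -/
structure Symb (n : ℕ) where
  /-- the abelian subgroup -/
  H : Subgroup G
  comm : ∀ a ∈ H, ∀ b ∈ H, a * b = b * a
  /-- the dimension of the symbol -/
  d : ℕ
  /-- the Galois algebra -/
  A : GaloisAlg k H d
  /-- the characters -/
  β : List (H →* kˣ)
  ne_one : ∀ b ∈ β, b ≠ 1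
  generate : Subgroup.closure {b | b ∈ β} = ⊤
  length_add : β.length + d = n

variable {k G}

/-- Let `ι : G₁ → G` be a homomorphism which maps the subgroup `P` of `G₁` to the subgroup `Q`
of `G`, let `P` act on `A` and `Q` on `B`. Then `B` is (equivariantly isomorphic to) the induced
algebra `Ind_P^Q A = {f : Q → A | f(pq) = p·f(q)}` on which `Q` acts by `(q·f)(x) = f(xq)`:
the isomorphism takes `b` to the function `q ↦ ev (q·b)`, where `ev` corresponds to
evaluation at `1`. -/
def IsInducedAlg {G₁ : Type v} [Group G₁] (ι : G₁ →* G) {P : Subgroup G₁} {Q : Subgroup G}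
    {A B : Type u} [CommRing A] [Algebra k A] [CommRing B] [Algebra k B]
    (ρA : P →* (A ≃ₐ[k] A)) (ρB : Q →* (B ≃ₐ[k] B)) : Prop :=
  ∃ ev : B →ₐ[k] A,
    (∀ (p : P) (q : Q) (b : B), (q : G) = ι p → ev (ρB q b) = ρA p (ev b)) ∧
    ∀ f : Q → A, (∀ (p : P) (q q' : Q), (q' : G) = ι p * q → f q' = ρA p (f q)) →
      ∃! b : B, ∀ q : Q, ev (ρB q b) = f q

/-- Sequences of characters of `s.H` and of a subgroup `H'` correspond to each other under
a partially defined map `r` from `s.H` to `H'`. -/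
def CharsMatch {G₁ : Type v} [Group G₁] {H : Subgroup G₁} {H' : Subgroup G} (r : G₁ → G)
    (β : List (H →* kˣ)) (β' : List (H' →* kˣ)) : Prop :=
  List.Forall₂ (fun b b' => ∀ (h : H) (h' : H'), (h' : G) = r h → b' h' = b h) β β'

variable {n : ℕ}

/-- `t` arises from `s` by conjugation by `g` (and by an isomorphism of the algebras). -/
def IsConjugate (g : G) (s t : Symb k G n) : Prop :=
  t.H = s.H.map (MulAut.conj g).toMonoidHom ∧
  (∃ e : s.A.K ≃ₐ[k] t.A.K,
    ∀ (z : Subgroup.centralizer (s.H : Set G)) (z' : Subgroup.centralizer (t.H : Set G)),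
      (z' : G) = g * z * g⁻¹ → ∀ a, e (s.A.ρ z a) = t.A.ρ z' (e a)) ∧
  CharsMatch (fun h => g * h * g⁻¹) s.β t.β

/-- `τ` is the action on `K(t)` (the total ring of fractions of `K[t]`) which
extends the given action on `K`, and `t ↦ c(g) t`, where `c` is a cocycle that lifts the
character `b` of `H`. -/
def IsLiftedAction {H : Subgroup G} {d : ℕ} (A : GaloisAlg k H d) (b : H →* kˣ)
    (τ : Subgroup.centralizer (H : Set G) →*
      (FractionRing (Polynomial A.K) ≃ₐ[k] FractionRing (Polynomial A.K))) : Prop :=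
  ∃ c : Subgroup.centralizer (H : Set G) → A.Kˣ, IsCocycle A.ρ c ∧
    (∀ (z : Subgroup.centralizer (H : Set G)) (hz : (z : G) ∈ H),
      (c z : A.K) = algebraMap k A.K (b ⟨z, hz⟩)) ∧
    (∀ z a, τ z (algebraMap (Polynomial A.K) _ (Polynomial.C a)) =
      algebraMap (Polynomial A.K) _ (Polynomial.C (A.ρ z a))) ∧
    ∀ z, τ z (algebraMap (Polynomial A.K) _ Polynomial.X) =
      algebraMap (Polynomial A.K) _ (Polynomial.C (c z : A.K) * Polynomial.X)

/-- For a symbol `s` with `β = (b₁, b₂, rest)`: the symbol `t = (H̄, Z̄ ↻ K(t), β̄)`, where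
`H̄ = ker (b₁ - b₂)`, `Z̄ = Z_G(H)/H̄`, and `β̄` is the restriction of `(b₂, rest)` to `H̄`. By the
convention on symbols with a subgroup `Z̄` of `Z_G(H̄)/H̄`, the algebra of `t` is induced from
`Z_G(H)` to `Z_G(H̄)`. -/
def IsThetaTwo (s : Symb k G n) (b₁ b₂ : s.H →* kˣ) (rest : List (s.H →* kˣ))
    (t : Symb k G n) : Prop :=
  t.H = (b₁ / b₂).ker.map s.H.subtype ∧
  (∃ τ, IsLiftedAction s.A (b₁ / b₂) τ ∧ IsInducedAlg (MonoidHom.id G) τ t.A.ρ) ∧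
  List.Forall₂ (fun (b : s.H →* kˣ) (b' : t.H →* kˣ) =>
    ∀ (h : s.H) (h' : t.H), (h' : G) = h → b' h' = b h) (b₂ :: rest) t.β

/-- Change of the sequence of characters in a symbol. -/
def Symb.withChars (s : Symb k G n) (β : List (s.H →* kˣ)) (h₁ : ∀ b ∈ β, b ≠ 1)
    (h₂ : Subgroup.closure {b | b ∈ β} = ⊤) (h₃ : β.length + s.d = n) : Symb k G n where
  H := s.H
  comm := s.comm
  d := s.d
  A := s.A
  β := β
  ne_one := h₁
  generate := h₂
  length_add := h₃

open FreeAbelianGroup in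
/-- The defining relations: reordering, conjugation, vanishing, and the blowup relation
`s = Θ₁ + Θ₂`, which is listed according to the cases in the definitions of `Θ₁` and `Θ₂`. -/
inductive IsRelator : FreeAbelianGroup (Symb k G n) → Prop
  | reorder (s : Symb k G n) (β : List (s.H →* kˣ)) (h₁ h₂ h₃) (hp : s.β.Perm β) :
      IsRelator (of s - of (s.withChars β h₁ h₂ h₃))
  | conj (g : G) (s t : Symb k G n) (h : IsConjugate g s t) : IsRelator (of s - of t)
  | vanish (s : Symb k G n) (b₁ b₂ : s.H →* kˣ) (rest : List (s.H →* kˣ))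
      (hβ : s.β = b₁ :: b₂ :: rest) (h : b₁ * b₂ = 1) : IsRelator (of s)
  | blowup (s : Symb k G n) (b₁ b₂ : s.H →* kˣ) (rest : List (s.H →* kˣ))
      (hβ : s.β = b₁ :: b₂ :: rest) (Θ₁ Θ₂ : FreeAbelianGroup (Symb k G n))
      (hΘ₁ : (b₁ = b₂ ∧ Θ₁ = 0) ∨
        (b₁ ≠ b₂ ∧ ∃ h₁ h₂ h₃ h₁' h₂' h₃',
          Θ₁ = of (s.withChars (b₁ :: (b₂ / b₁) :: rest) h₁ h₂ h₃) +
            of (s.withChars (b₂ :: (b₁ / b₂) :: rest) h₁' h₂' h₃')))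
      (hΘ₂ : ((∃ b ∈ s.β, b ∈ Subgroup.zpowers (b₁ / b₂)) ∧ Θ₂ = 0) ∨
        ((¬ ∃ b ∈ s.β, b ∈ Subgroup.zpowers (b₁ / b₂)) ∧
          ∃ t, IsThetaTwo s b₁ b₂ rest t ∧ Θ₂ = of t)) :
      IsRelator (of s - (Θ₁ + Θ₂))

variable (k G n)

/-- The equivariant Burnside group `Burn_n(G)`. -/
abbrev Burn : Type (max v (u + 1)) :=
  FreeAbelianGroup (Symb k G n) ⧸
    AddSubgroup.closure {x : FreeAbelianGroup (Symb k G n) | IsRelator x}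

variable {k G n}

/-- The class of a symbol in the equivariant Burnside group. -/
def Symb.cls (s : Symb k G n) : Burn k G n :=
  QuotientAddGroup.mk (FreeAbelianGroup.of s)

/-- For a symbol `s = (H', Z' ↻ K, β)` for the subgroup `G'`, the symbol `t` for `G` is
`(H', Z_G(H')/H' ↻ Ind K, β)`. -/
def IsInducedSymb {G' : Subgroup G} (s : Symb k G' n) (t : Symb k G n) : Prop :=
  t.H = s.H.map G'.subtype ∧ IsInducedAlg G'.subtype s.A.ρ t.A.ρ ∧
    CharsMatch (fun h : G' => (h : G)) s.β t.β

/-- `ind` is the induction homomorphism: given by `(H', Z' ↻ K, β) ↦ (H', Z' ↻ K, β)`, where the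
right-hand side stands for the symbol with the induced algebra. -/
def IsInductionHom {G' : Subgroup G} (ind : Burn k G' n →+ Burn k G n) : Prop :=
  ∀ s : Symb k G' n, (∃ t : Symb k G n, IsInducedSymb s t) ∧
    ∀ t : Symb k G n, IsInducedSymb s t → ind s.cls = t.cls

/-! ## The Burnside group of orbifolds -/

variable (k n)

/-- Generators of the Burnside group of orbifolds: `(K, (a₁, …, a_{n-d}))` with `K` a
function field of dimension `d ≤ n` over `k`, and a sequence of nonzero generators of
a finite abelian group `A`. -/
structure OrbSymb where
  /-- the field -/
  K : Type u
  [field : Field K]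
  [algebra : Algebra k K]
  /-- the dimension -/
  d : ℕ
  fg : Algebra.EssFiniteType k K
  trdeg : Algebra.trdeg k K = d
  /-- the finite abelian group -/
  A : Type u
  [addCommGroup : AddCommGroup A]
  finite : Finite A
  /-- the generators -/
  a : List A
  ne_zero : ∀ x ∈ a, x ≠ 0
  generate : AddSubgroup.closure {x | x ∈ a} = ⊤
  length_add : a.length + d = n

attribute [instance] OrbSymb.field OrbSymb.algebra OrbSymb.addCommGroup

variable {k n}

/-- Change of the sequence of generators. -/
def OrbSymb.withGens (s : OrbSymb k n) (a : List s.A) (h₁ : ∀ x ∈ a, x ≠ 0)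
    (h₂ : AddSubgroup.closure {x | x ∈ a} = ⊤) (h₃ : a.length + s.d = n) : OrbSymb k n where
  K := s.K
  d := s.d
  fg := s.fg
  trdeg := s.trdeg
  A := s.A
  finite := s.finite
  a := a
  ne_zero := h₁
  generate := h₂
  length_add := h₃

open FreeAbelianGroup in
/-- The defining relations: isomorphism (of fields over `k`, and of finite abelian groups with
sequence of generators), reordering, vanishing, and the blowup relation. -/
inductive IsOrbRelator : FreeAbelianGroup (OrbSymb k n) → Prop
  | iso (s t : OrbSymb k n) (e : s.K ≃ₐ[k] t.K) (f : s.A ≃+ t.A) (h : t.a = s.a.map f) :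
      IsOrbRelator (of s - of t)
  | reorder (s : OrbSymb k n) (a : List s.A) (h₁ h₂ h₃) (hp : s.a.Perm a) :
      IsOrbRelator (of s - of (s.withGens a h₁ h₂ h₃))
  | vanish (s : OrbSymb k n) (a₁ a₂ : s.A) (rest : List s.A) (ha : s.a = a₁ :: a₂ :: rest)
      (h : a₁ + a₂ = 0) : IsOrbRelator (of s)
  | blowup (s : OrbSymb k n) (a₁ a₂ : s.A) (rest : List s.A) (ha : s.a = a₁ :: a₂ :: rest)
      (Θ₁ Θ₂ : FreeAbelianGroup (OrbSymb k n))
      (hΘ₁ : (a₁ = a₂ ∧ Θ₁ = 0) ∨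
        (a₁ ≠ a₂ ∧ ∃ h₁ h₂ h₃ h₁' h₂' h₃',
          Θ₁ = of (s.withGens (a₁ :: (a₂ - a₁) :: rest) h₁ h₂ h₃) +
            of (s.withGens (a₂ :: (a₁ - a₂) :: rest) h₁' h₂' h₃')))
      (hΘ₂ : ((∃ x ∈ s.a, x ∈ AddSubgroup.zmultiples (a₁ - a₂)) ∧ Θ₂ = 0) ∨
        ((¬ ∃ x ∈ s.a, x ∈ AddSubgroup.zmultiples (a₁ - a₂)) ∧
          ∃ (t : OrbSymb k n) (_ : t.K ≃ₐ[k] FractionRing (Polynomial s.K))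
            (f : (s.A ⧸ AddSubgroup.zmultiples (a₁ - a₂)) ≃+ t.A),
            t.a = (a₂ :: rest).map (fun x => f (QuotientAddGroup.mk x)) ∧ Θ₂ = of t)) :
      IsOrbRelator (of s - (Θ₁ + Θ₂))

variable (k n)

/-- The Burnside group of orbifolds. -/
abbrev OrbBurn : Type (u + 1) :=
  FreeAbelianGroup (OrbSymb k n) ⧸
    AddSubgroup.closure {x : FreeAbelianGroup (OrbSymb k n) | IsOrbRelator x}

variable {k n}

/-- The class of a generator in the Burnside group of orbifolds. -/
def OrbSymb.cls (s : OrbSymb k n) : OrbBurn k n :=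
  QuotientAddGroup.mk (FreeAbelianGroup.of s)

/-- `t` is `(K^Z, β)`, with `β` viewed as a sequence of generators of `H^∨`, where
`s = (H, Z ↻ K, β)`. -/
def IsOrbSymbOf (s : Symb k G n) (t : OrbSymb k n) : Prop :=
  Nonempty (t.K ≃ₐ[k] invariants s.A.ρ) ∧
  ∃ f : Additive (s.H →* kˣ) ≃+ t.A, t.a = s.β.map (fun b => f (Additive.ofMul b))

/-- `κ` is the homomorphism `κ^G` to the Burnside group of orbifolds, `(H, Z ↻ K, β) ↦
(K^Z, β)`. -/
def IsKappa (κ : Burn k G n →+ OrbBurn k n) : Prop :=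
  ∀ s : Symb k G n, (∃ t : OrbSymb k n, IsOrbSymbOf s t) ∧
    ∀ t : OrbSymb k n, IsOrbSymbOf s t → κ s.cls = t.cls

end Algebra

/-! ## Schemes with an action of a group -/

section Geometry

/-- A scheme over `k` with a right action of `G`. -/
structure GScheme (k : Type u) [Field k] (G : Type v) [Group G] where
  /-- the scheme -/
  X : Scheme.{u}
  /-- the structure morphism -/
  str : X ⟶ Spec (.of k)
  /-- the action `x ↦ x·g` of an element `g` -/
  act : G → (X ⟶ X)
  act_one : act 1 = 𝟙 X
  act_mul : ∀ g h, act (g * h) = act g ≫ act h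
  act_str : ∀ g, act g ≫ str = str

variable {k : Type u} [Field k] {G : Type v} [Group G]

namespace GScheme

/-- Equivariant morphisms over `k`. -/
def IsEquivariant (X Y : GScheme k G) (f : X.X ⟶ Y.X) : Prop :=
  f ≫ Y.str = X.str ∧ ∀ g, X.act g ≫ f = f ≫ Y.act g

variable (X : GScheme k G)

/-- The stabilizer at a point `x`: the elements of `G` which map `x` to itself and act trivially
on the residue field. This is the stabilizer of any geometric point over `x`, and it contains `H`
exactly when `x` lies on the fixed point scheme `X^H`. -/
def stab (x : X.X) : Subgroup G where
  carrier := {g | X.X.fromSpecResidueField x ≫ X.act g = X.X.fromSpecResidueField x}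
  mul_mem' := fun {a b} (ha : _ = _) (hb : _ = _) => by
    change _ ≫ _ = _
    rw [X.act_mul, ← Category.assoc, ha, hb]
  one_mem' := by
    change _ ≫ _ = _
    rw [X.act_one, Category.comp_id]
  inv_mem' := fun {a} (ha : _ = _) => by
    change _ ≫ _ = _
    conv_lhs => rw [← ha]
    rw [Category.assoc, ← X.act_mul, mul_inv_cancel, X.act_one, Category.comp_id]

/-- Projective space of dimension `N` over `k`, as `Proj` of the polynomial ring. -/
def projSpace (k : Type u) [Field k] (N : ℕ) : Scheme.{u} :=
  letI := MvPolynomial.gradedAlgebra (σ := Fin (N + 1)) (R := k)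
  Proj (MvPolynomial.homogeneousSubmodule (Fin (N + 1)) k)

/-- The structure morphism of projective space. -/
def projSpaceStr (k : Type u) [Field k] (N : ℕ) : projSpace k N ⟶ Spec (.of k) :=
  letI := MvPolynomial.gradedAlgebra (σ := Fin (N + 1)) (R := k)
  Proj.toSpecZero (MvPolynomial.homogeneousSubmodule (Fin (N + 1)) k) ≫
    Spec.map (CommRingCat.ofHom
      (algebraMap k (MvPolynomial.homogeneousSubmodule (Fin (N + 1)) k 0)))

/-- Quasi-projective over `k`. -/
def IsQuasiProjective : Prop :=
  ∃ (N : ℕ) (i : X.X ⟶ projSpace k N), IsImmersion i ∧ i ≫ projSpaceStr k N = X.str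

/-- Projective over `k`. -/
def IsProjective : Prop :=
  ∃ (N : ℕ) (i : X.X ⟶ projSpace k N), IsClosedImmersion i ∧ i ≫ projSpaceStr k N = X.str

/-- A smooth quasi-projective `G`-variety of dimension `n`: the action is
transitive on the set of irreducible components. -/
def IsVariety (n : ℕ) : Prop :=
  SmoothOfRelativeDimension n X.str ∧ X.IsQuasiProjective ∧
  ∀ Z ∈ irreducibleComponents X.X, ∀ Z' ∈ irreducibleComponents X.X,
    ∃ g : G, (X.act g) '' Z = Z'

/-- `G` acts freely on some nonempty invariant open subscheme. -/
def IsGenericallyFree : Prop :=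
  ∃ U : X.X.Opens, (U : Set X.X).Nonempty ∧ (∀ g, X.act g ⁻¹ᵁ U = U) ∧ ∀ x ∈ U, X.stab x = ⊥

/-- `x` is the generic point of a component of `X^H` with generic stabilizer `H`, where
`H = X.stab x`. -/
def IsStratum (x : X.X) : Prop :=
  ∀ y : X.X, X.stab x ≤ X.stab y → y ⤳ x → y = x

/-- The structure of `k`-algebra on residue fields. -/
def toResidueField (x : X.X) : k →+* X.X.residueField x :=
  (Spec.preimage (X.X.fromSpecResidueField x ≫ X.str)).hom

/-- The structure of `k`-algebra on stalks. -/
def toStalk (x : X.X) : k →+* X.X.presheaf.stalk x :=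
  (Spec.preimage (X.X.fromSpecStalk x ≫ X.str)).hom

/-- A `G`-linearized line bundle, given by transition functions: for an open cover `(U i)` with
a generating section `e i` on each `U i`, the `G`-linearized line bundle is recorded by the
functions `a g i j` on `U i ∩ g⁻¹(U j)` with `g^*(e j) = (a g i j) (e i)`. For `g = 1` these are the
transition functions of the line bundle. -/
structure LineBundle where
  /-- index set of the cover -/
  ι : Type u
  /-- the cover -/
  U : ι → X.X.Opens
  cover : ∀ x : X.X, ∃ i, x ∈ U i
  /-- the transition functions -/
  a : ∀ (g : G) (i j : ι), Γ(X.X, U i ⊓ X.act g ⁻¹ᵁ U j)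
  a_one : ∀ i, a 1 i i = 1
  a_mul : ∀ (g h : G) (i j l : ι) (O : X.X.Opens) (h₁ : O ≤ U i ⊓ X.act (g * h) ⁻¹ᵁ U l)
    (h₂ : O ≤ U i ⊓ X.act g ⁻¹ᵁ U j) (h₃ : O ≤ X.act g ⁻¹ᵁ (U j ⊓ X.act h ⁻¹ᵁ U l)),
    X.X.presheaf.map (homOfLE h₁).op (a (g * h) i l) =
      X.X.presheaf.map (homOfLE h₂).op (a g i j) * (X.act g).appLE _ O h₃ (a h j l)

/-- The stabilizer at `x` acts on the fiber at `x` of the `G`-linearized line bundle by the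
character `χ`. -/
def LineBundle.HasCharacter {X : GScheme k G} (L : X.LineBundle) (x : X.X)
    (χ : X.stab x →* kˣ) : Prop :=
  ∃ i, ∀ h : X.stab x, ∃ hx : x ∈ L.U i ⊓ X.act h ⁻¹ᵁ L.U i,
    X.X.evaluation _ x hx (L.a h i i) = X.toResidueField x (χ h)

/-- The standing condition for the class formula: all stabilizers are abelian, and for every component of a fixed locus `X^H` with
generic stabilizer `H`, every character of `H` comes from a `G`-linearized line bundle on `X`. -/
def IsDivisorial : Prop :=
  (∀ x : X.X, ∀ a ∈ X.stab x, ∀ b ∈ X.stab x, a * b = b * a) ∧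
  ∀ x : X.X, X.IsStratum x → ∀ χ : X.stab x →* kˣ, ∃ L : X.LineBundle, L.HasCharacter x χ

/-- The set of translates of `x` under `Z_G(H)`. When `x` is the generic point of `F`, these
are the generic points of the members of the `Z_G(H)`-orbit of `F`. -/
def centralizerOrbit (H : Subgroup G) (x : X.X) : Set X.X :=
  {y | ∃ z ∈ Subgroup.centralizer (H : Set G), y = X.act z x}

/-- The characters by which `H` acts on the generic normal bundle along the closure of `x` are
`β`: the conormal space at `x`, with `H` acting by pullback of functions, has a basis of
eigenvectors with these characters. (The action on `X` being a right action, these are the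
characters of the dual normal space.) -/
def IsNormalChars (H : Subgroup G) (x : X.X) (β : List (H →* kˣ)) : Prop :=
  ∃ t : Fin β.length → IsLocalRing.maximalIdeal (X.X.presheaf.stalk x),
    LinearIndependent (IsLocalRing.ResidueField (X.X.presheaf.stalk x))
      (fun i => ((IsLocalRing.maximalIdeal (X.X.presheaf.stalk x)).toCotangent (t i) :
        IsLocalRing.CotangentSpace (X.X.presheaf.stalk x))) ∧
    Submodule.span (IsLocalRing.ResidueField (X.X.presheaf.stalk x))
      (Set.range (fun i => ((IsLocalRing.maximalIdeal (X.X.presheaf.stalk x)).toCotangent (t i) :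
        IsLocalRing.CotangentSpace (X.X.presheaf.stalk x)))) = ⊤ ∧
    ∀ h : H, ∃ α : X.X.presheaf.stalk x ⟶ X.X.presheaf.stalk x,
      Spec.map α ≫ X.X.fromSpecStalk x = X.X.fromSpecStalk x ≫ X.act h ∧
      ∀ i, α.hom (t i) - X.toStalk x (β.get i h) * (t i) ∈
        (IsLocalRing.maximalIdeal (X.X.presheaf.stalk x)) ^ 2

/-- `s` is the symbol `(H, Z ↻ k(F), β_F(X))` where `F` is the `Z_G(H)`-orbit of the closure of
`x`, with generic stabilizer `H`. Here `k(F)` is the product of the residue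
fields at the generic points of `F`, with its action of `Z_G(H)` by pullback of functions. -/
def IsSymbolAt {n : ℕ} (x : X.X) (s : Symb k G n) : Prop :=
  s.H = X.stab x ∧ X.IsNormalChars s.H x s.β ∧
  ∃ ev : ∀ y ∈ X.centralizerOrbit s.H x, s.A.K →+* X.X.residueField y,
    (∀ f : ∀ y ∈ X.centralizerOrbit s.H x, X.X.residueField y,
      ∃! a : s.A.K, ∀ y hy, ev y hy a = f y hy) ∧
    (∀ y hy (c : k), ev y hy (algebraMap k s.A.K c) = X.toResidueField y c) ∧
    ∀ (z : Subgroup.centralizer (s.H : Set G)) (a : s.A.K) (y : X.X)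
      (hy : y ∈ X.centralizerOrbit s.H x) (hy' : X.act z y ∈ X.centralizerOrbit s.H x),
      ev y hy (s.A.ρ z a) = (X.act z).residueFieldMap y (ev (X.act z y) hy' a)

/-- `c` is the sum of the symbols `(H, Z ↻ k(F), β_F(X))`, one for each `G`-orbit of components of
fixed loci `X^H` with generic stabilizer `H`. For projective `X` this is the class `[X ↻ G]`, for
quasi-projective `X` it is the class `[X ↻ G]^naive` (where `X` satisfies `IsDivisorial`).

The `G`-orbits are the same as first taking conjugacy class representatives of abelian `H`
with `Pic^G(X)`-pairing, and then `Z_G(H)`-orbits of components with the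
given `H` and pairing: an element of `G` which takes a component with generic
stabilizer `H` to a component with the same `H` and pairing fixes all characters of `H` (these
all come from `Pic^G(X)`), hence lies in `Z_G(H)`. -/
def IsStrataSum {n : ℕ} (c : Burn k G n) : Prop :=
  ∃ (m : ℕ) (x : Fin m → X.X) (s : Fin m → Symb k G n),
    (∀ i, X.IsStratum (x i)) ∧
    (∀ y, X.IsStratum y → ∃! i, ∃ g, X.act g y = x i) ∧
    (∀ i, X.IsSymbolAt (x i) (s i)) ∧
    c = ∑ i, (s i).cls

/-- A `G`-invariant ideal sheaf. -/
def IsInvariantIdeal (I : X.X.IdealSheafData) : Prop :=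
  ∀ (g : G) (U V : X.X.affineOpens) (h : V.1 ≤ X.act g ⁻¹ᵁ U.1), ∀ f ∈ I.ideal U,
    (X.act g).appLE U.1 V.1 h f ∈ I.ideal V

/-- The ideal sheaves `I j` define divisors `D j`, such that the union of these is
a simple normal crossing divisor: at every point, local equations of the `D j` through the
point are linearly independent in the cotangent space. -/
def IsSNC {ℓ : ℕ} (I : Fin ℓ → X.X.IdealSheafData) : Prop :=
  ∀ x : X.X, ∃ (U : X.X.affineOpens) (hx : x ∈ U.1) (f : Fin ℓ → Γ(X.X, U.1)),
    (∀ j, (I j).ideal U = Ideal.span {f j}) ∧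
    LinearIndependent (IsLocalRing.ResidueField (X.X.presheaf.stalk x))
      (fun j : {j // X.X.presheaf.germ U.1 x hx (f j) ∈
          IsLocalRing.maximalIdeal (X.X.presheaf.stalk x)} =>
        ((IsLocalRing.maximalIdeal (X.X.presheaf.stalk x)).toCotangent
          ⟨X.X.presheaf.germ U.1 x hx (f j.1), j.2⟩ :
            IsLocalRing.CotangentSpace (X.X.presheaf.stalk x)))

/-- For a `G`-invariant closed subscheme `D` of `X`, with ideal sheaf `I`: the `G`-scheme `E` is
the normal bundle `N_{D/X}`, i.e., the relative spectrum of the symmetric algebra of `I/I²` over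
`O_X/I`, with its natural action of `G`. The map `l` is the inclusion of `I/I²` in the
symmetric algebra; on the members of an affine open cover the universal property of the symmetric
algebra is required. -/
def IsNormalBundle (I : X.X.IdealSheafData) (E : GScheme k G) (π : E.X ⟶ X.X) : Prop :=
  E.IsEquivariant X π ∧ IsAffineHom π ∧
  ∃ l : ∀ U : X.X.affineOpens, I.ideal U →+ Γ(E.X, π ⁻¹ᵁ U.1),
    (∀ (U : X.X.affineOpens) (r : Γ(X.X, U.1)) (f : I.ideal U),
      l U (r • f) = π.app U.1 r * l U f) ∧
    (∀ (U : X.X.affineOpens) (f : I.ideal U), π.app U.1 f.1 = 0) ∧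
    (∀ (g : G) (U V : X.X.affineOpens) (h : V.1 ≤ X.act g ⁻¹ᵁ U.1)
      (h' : π ⁻¹ᵁ V.1 ≤ E.act g ⁻¹ᵁ (π ⁻¹ᵁ U.1)) (f : I.ideal U) (f' : I.ideal V),
      f'.1 = (X.act g).appLE U.1 V.1 h f.1 →
        l V f' = (E.act g).appLE (π ⁻¹ᵁ U.1) (π ⁻¹ᵁ V.1) h' (l U f)) ∧
    ∀ x : X.X, ∃ U : X.X.affineOpens, x ∈ U.1 ∧
      ∀ (R : Type u) [CommRing R] (p : Γ(X.X, U.1) →+* R) (m : I.ideal U →+ R),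
        (∀ f : I.ideal U, p f.1 = 0) →
        (∀ (r : Γ(X.X, U.1)) (f : I.ideal U), m (r • f) = p r * m f) →
        ∃! q : Γ(E.X, π ⁻¹ᵁ U.1) →+* R,
          (∀ r, q (π.app U.1 r) = p r) ∧ ∀ f, q (l U f) = m f

/-- `c` is the class in `Burn_n(G)` of the complement `U = Y ∖ D`, where `Y` is a smooth
projective `G`-variety with generically free action satisfying `IsDivisorial` and `D = ⋃ D_j` is a
simple normal crossing divisor with `G`-invariant `D_j`; here `q : U → Y` is the inclusion:
`[U ↻ G] = [Y ↻ G] + ∑_{∅ ≠ J} (-1)^|J| [N_{D_J/Y} ↻ G]^naive`. -/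
def IsClassOfComplement (U : GScheme k G) {n : ℕ} (c : Burn k G n) : Prop :=
  ∃ (Y : GScheme k G) (q : U.X ⟶ Y.X) (ℓ : ℕ) (I : Fin ℓ → Y.X.IdealSheafData)
    (E : Finset (Fin ℓ) → GScheme k G) (π : ∀ J, (E J).X ⟶ Y.X)
    (c₀ : Burn k G n) (cN : Finset (Fin ℓ) → Burn k G n),
    Y.IsVariety n ∧ Y.IsProjective ∧ Y.IsGenericallyFree ∧ Y.IsDivisorial ∧
    (∀ j, Y.IsInvariantIdeal (I j)) ∧ Y.IsSNC I ∧
    U.IsEquivariant Y q ∧ IsOpenImmersion q ∧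
    Set.range q = {y | ∀ j, y ∉ (I j).support} ∧
    Y.IsStrataSum c₀ ∧
    (∀ J, J.Nonempty → Y.IsNormalBundle (J.sup I) (E J) (π J) ∧ (E J).IsStrataSum (cN J)) ∧
    c = c₀ + ∑ J with J.Nonempty, (-1 : ℤ) ^ J.card • cN J

/-- `p : U' → U` is an equivariant proper birational morphism. -/
def IsModification (U' U : GScheme k G) (p : U'.X ⟶ U.X) : Prop :=
  U'.IsEquivariant U p ∧ IsProper p ∧
  ∃ V : U.X.Opens, Dense (V : Set U.X) ∧ Dense ((p ⁻¹ᵁ V : U'.X.Opens) : Set U'.X) ∧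
    IsIso (p ∣_ V)

/-- `c` is the class `[X ↻ G]` in `Burn_n(G)` of a smooth quasi-projective `G`-variety with
generically free action: the class of some (equivalently, any) equivariant modification
that can be presented as the complement of a simple normal crossing divisor
as in `IsClassOfComplement`. -/
def IsClass {n : ℕ} (c : Burn k G n) : Prop :=
  ∃ (U : GScheme k G) (p : U.X ⟶ X.X), IsModification U X p ∧ U.IsClassOfComplement c

/-- `W` is `X ×^{G'} G`, the quotient of `X × G` by the diagonal action
`(x, g) ↦ (x·h, h⁻¹ g)` of `h ∈ G'`, with the action of `G` by right multiplication on the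
factor `G`. Here `j g` is the restriction to `X × {g}` of the quotient morphism. -/
def IsInducedSpace {G' : Subgroup G} (X : GScheme k G') (W : GScheme k G) : Prop :=
  ∃ j : G → (X.X ⟶ W.X),
    (∀ (h : G') (g : G), X.act h ≫ j g = j (h * g)) ∧
    (∀ g γ : G, j g ≫ W.act γ = j (g * γ)) ∧
    (∀ g, j g ≫ W.str = X.str) ∧
    ∀ (T : Scheme.{u}) (t : G → (X.X ⟶ T)), (∀ (h : G') (g : G), X.act h ≫ t g = t (h * g)) →
      ∃! f : W.X ⟶ T, ∀ g, j g ≫ f = t g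

end GScheme

end Geometry

end EqBurnside

end

open EqBurnside

/-! Algebra. The algebra `Ind_P^Q A` consists of the equivariant functions `Q → A`, and `IsCoind`
captures it by this universal property. It follows that coinduction is unique
(`IsCoind.unique_equiv`) and transitive (`IsCoind.trans`). If `Q` is finite and `P → Q` is
injective, evaluation at coset representatives identifies `Ind A` with a finite power of `A`.
Étaleness and rank can be read off from this, the invariants do not change, and a cocycle of `P`
extends to one of `Q` by the construction behind Shapiro's lemma (`IsCoind.exists_cocycle`). So the
induced algebra again defines a symbol.

Induction respects the relations. Reordering, vanishing and `Θ₁` involve only characters, which are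
transported by an isomorphism, and conjugation follows from uniqueness. For `Θ₂`, coinduction
commutes with passage from `K` to `K(t)` with its twisted action. By transitivity, the routes from
`Z_{G'}(H)` to `Z_G(H̄)` through `Z_G(H)` and through `Z_{G'}(H̄)` give the same algebra
(`IsThetaTwo.induced`).

For `κ` the only issue is again `Θ₂`. Let `b = b₁ - b₂` have order `m` and let `c` be a cocycle
lifting `b`. The cocycle `c^m` is trivial on `H`, hence a coboundary by Hilbert 90 for Galois
algebras. This gives a unit `u` such that `u t^m` is invariant, and `K(t)^Z = K₀(u t^m)` is purely
transcendental of degree one over `K₀`. On the side of characters, restriction `H^∨ → H̄^∨` is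
surjective, since there are enough roots of unity, and has kernel `⟨b⟩`. Since induction changes
neither invariants nor characters, `κ^G ∘ ind = κ^{G'}`.

Geometry. The space `X ×^{G'} G` is a disjoint union of copies of `X`, one for each coset of `G'`.
By the universal property every induced space looks like this, which is recorded in `IsInd`: the
maps `j g` are open immersions, they cover, and copies for different cosets are disjoint.
Stabilizers, strata and normal characters on the copy `j 1` are those of `X`, every `G`-orbit meets
this copy, and the algebra `k(F)` of a stratum is the coinduced one (`IsInd.isSymbolAt`). Thus the
sums over strata correspond term by term. Projective embeddings come from placing the copies in
disjoint linear subspaces. Linearized line bundles, invariant ideals, normal bundles and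
modifications are extended from one copy to all, so a choice of `(U, Y, D)` for `X` induces one for
`X ×^{G'} G`. -/

noncomputable section

namespace EqBurnside

/-! ## Coinduced algebras -/

section Coinduced

variable {k : Type*} [Field k] {P Q R : Type*} [Group P] [Group Q] [Group R]
  {A B C : Type*} [CommRing A] [Algebra k A] [CommRing B] [Algebra k B] [CommRing C] [Algebra k C]

/-- A monoid homomorphism from a group to algebra endomorphisms has values in automorphisms. -/
def toAlgAut (f : Q →* (B →ₐ[k] B)) : Q →* (B ≃ₐ[k] B) :=
  (AlgEquiv.algHomUnitsEquiv k B).toMonoidHom.comp f.toHomUnits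

@[simp] lemma toAlgAut_apply (f : Q →* (B →ₐ[k] B)) (q : Q) (b : B) : toAlgAut f q b = f q b := rfl

/-- `B` is coinduced from `A` along `i : P → Q`, with evaluation map `ev`. -/
def IsCoind (i : P →* Q) (ρA : P →* (A ≃ₐ[k] A)) (ρB : Q →* (B ≃ₐ[k] B)) (ev : B →ₐ[k] A) :
    Prop :=
  (∀ p b, ev (ρB (i p) b) = ρA p (ev b)) ∧
    ∀ f : Q → A, (∀ p q, f (i p * q) = ρA p (f q)) → ∃! b, ∀ q, ev (ρB q b) = f q

variable {i : P →* Q} {j : Q →* R} {ρA : P →* (A ≃ₐ[k] A)} {ρB : Q →* (B ≃ₐ[k] B)}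
  {ρC : R →* (C ≃ₐ[k] C)} {ev : B →ₐ[k] A} {ev' : C →ₐ[k] B}

lemma IsCoind.equivariant (h : IsCoind i ρA ρB ev) (p : P) (q : Q) (b : B) :
    ev (ρB (i p * q) b) = ρA p (ev (ρB q b)) := by
  rw [map_mul, AlgEquiv.mul_apply, h.1]

lemma IsCoind.ext (h : IsCoind i ρA ρB ev) {b b' : B} (hb : ∀ q, ev (ρB q b) = ev (ρB q b')) :
    b = b' :=
  (h.2 (fun q => ev (ρB q b')) fun p q => h.equivariant p q b').unique hb fun _ => rfl

/-- The universal property speaks of functions only. Its uniqueness clause forces the pointwise lift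
to respect sums, products and scalars. -/
lemma IsCoind.exists_lift (h : IsCoind i ρA ρB ev) (θ : Q → C →ₐ[k] A)
    (hθ : ∀ p q c, θ (i p * q) c = ρA p (θ q c)) :
    ∃ F : C →ₐ[k] B, ∀ q c, ev (ρB q (F c)) = θ q c := by
  choose F hF using fun c => (h.2 (fun q => θ q c) fun p q => hθ p q c).exists
  refine ⟨⟨⟨⟨⟨F, ?_⟩, ?_⟩, ?_, ?_⟩, ?_⟩, fun q c => hF c q⟩
  · exact h.ext fun q => by simp [hF]
  · exact fun x y => h.ext fun q => by simp [hF]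
  · exact h.ext fun q => by simp [hF]
  · exact fun x y => h.ext fun q => by simp [hF]
  · exact fun x => h.ext fun q => by simp [hF]

/-- An equivariant function `f` on `R` is cut into the functions `q ↦ f (j q * r)` on `Q`. Each of
these defines an element of `B`, and these elements form an equivariant function of `r`. -/
lemma IsCoind.trans (h : IsCoind i ρA ρB ev) (h' : IsCoind j ρB ρC ev') :
    IsCoind (j.comp i) ρA ρC (ev.comp ev') := by
  refine ⟨fun p c => by simp [h'.1, h.1], fun f hf => ?_⟩
  have hf' : ∀ r p q, f (j (i p * q) * r) = ρA p (f (j q * r)) := fun r p q => by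
    rw [map_mul, mul_assoc]; exact hf p _
  choose F hF using fun r => (h.2 (fun q => f (j q * r)) (hf' r)).exists
  have hFj : ∀ q r, F (j q * r) = ρB q (F r) := fun q r => h.ext fun q' => by
    rw [hF, ← AlgEquiv.mul_apply, ← map_mul, hF, map_mul, mul_assoc]
  obtain ⟨c, hc, huc⟩ := h'.2 F hFj
  refine ⟨c, fun r => ?_, fun c' hc' => huc c' fun r => h.ext fun q => ?_⟩
  · have := hF r 1
    simp only [map_one, AlgEquiv.one_apply, one_mul] at this
    simp [hc, this]
  · rw [hF, ← h'.equivariant]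
    exact hc' _

lemma IsCoind.transport {P' Q' A' B' : Type*} [Group P'] [Group Q'] [CommRing A'] [Algebra k A']
    [CommRing B'] [Algebra k B'] (h : IsCoind i ρA ρB ev) {i' : P' →* Q'}
    {ρA' : P' →* (A' ≃ₐ[k] A')} {ρB' : Q' →* (B' ≃ₐ[k] B')} (φ : P ≃* P') (ψ : Q ≃* Q')
    (hi : ∀ p, ψ (i p) = i' (φ p)) (e : A ≃ₐ[k] A') (he : ∀ p a, e (ρA p a) = ρA' (φ p) (e a))
    (E : B ≃ₐ[k] B') (hE : ∀ q b, E (ρB q b) = ρB' (ψ q) (E b)) :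
    IsCoind i' ρA' ρB' ((e.toAlgHom.comp ev).comp E.symm.toAlgHom) := by
  have key : ∀ q b, E.symm (ρB' (ψ q) b) = ρB q (E.symm b) := fun q b => by
    rw [AlgEquiv.symm_apply_eq, hE, AlgEquiv.apply_symm_apply]
  refine ⟨fun p' b' => ?_, fun f hf => ?_⟩
  · obtain ⟨p, rfl⟩ := φ.surjective p'
    simp [← hi, key, h.1, he]
  · obtain ⟨b, hb, hu⟩ := h.2 (fun q => e.symm (f (ψ q))) fun p q => by
      rw [AlgEquiv.symm_apply_eq, he, map_mul, hi, hf, AlgEquiv.apply_symm_apply]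
    refine ⟨E b, fun q' => ?_, fun b' hb' => ?_⟩
    · obtain ⟨q, rfl⟩ := ψ.surjective q'
      simp [key, hb]
    · rw [← AlgEquiv.symm_apply_eq]
      refine hu _ fun q => ?_
      rw [AlgEquiv.eq_symm_apply, ← hb' (ψ q)]
      simp [key]

lemma IsCoind.unique {B' : Type*} [CommRing B'] [Algebra k B'] {ρB' : Q →* (B' ≃ₐ[k] B')}
    {ev₁ : B' →ₐ[k] A} (h : IsCoind i ρA ρB ev) (h' : IsCoind i ρA ρB' ev₁) :
    ∃ E : B ≃ₐ[k] B', (∀ q b, E (ρB q b) = ρB' q (E b)) ∧ ∀ b, ev₁ (E b) = ev b := by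
  obtain ⟨F, hF⟩ := h'.exists_lift (fun q => ev.comp (ρB q).toAlgHom) fun p q c => by
    simpa using h.equivariant p q c
  obtain ⟨F', hF'⟩ := h.exists_lift (fun q => ev₁.comp (ρB' q).toAlgHom) fun p q c => by
    simpa using h'.equivariant p q c
  refine ⟨AlgEquiv.ofAlgHom F F' ?_ ?_, fun q b => h'.ext fun q' => ?_, fun b => ?_⟩
  · ext b; exact h'.ext fun q => by simp [hF, hF']
  · ext b; exact h.ext fun q => by simp [hF, hF']
  · change ev₁ (ρB' q' (F _)) = ev₁ (ρB' q' (ρB' q (F b)))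
    rw [hF, ← AlgEquiv.mul_apply, ← map_mul, hF]
    simp
  · simpa using hF 1 b

/-- Coinduced algebras are unique, compatibly with isomorphisms of the groups and algebras. -/
lemma IsCoind.unique_equiv {P' Q' A' B' : Type*} [Group P'] [Group Q'] [CommRing A'] [Algebra k A']
    [CommRing B'] [Algebra k B'] (h : IsCoind i ρA ρB ev) {i' : P' →* Q'}
    {ρA' : P' →* (A' ≃ₐ[k] A')} {ρB' : Q' →* (B' ≃ₐ[k] B')} {ev₁ : B' →ₐ[k] A'}
    (h' : IsCoind i' ρA' ρB' ev₁) (φ : P ≃* P') (ψ : Q ≃* Q')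
    (hi : ∀ p, ψ (i p) = i' (φ p)) (e : A ≃ₐ[k] A') (he : ∀ p a, e (ρA p a) = ρA' (φ p) (e a)) :
    ∃ E : B ≃ₐ[k] B', ∀ q b, E (ρB q b) = ρB' (ψ q) (E b) := by
  have h₁ := h.transport (i' := i') (ρA' := ρA') (ρB' := ρB.comp ψ.symm.toMonoidHom) φ ψ hi e he
    AlgEquiv.refl (fun q b => by simp)
  obtain ⟨E, hE, -⟩ := h₁.unique h'
  exact ⟨E, fun q b => by simpa using hE (ψ q) b⟩

/-- The algebra of equivariant functions, realized in an ambient algebra in the universe of `A`. -/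
def coindSubalgebra [Finite Q] (i : P →* Q) (ρA : P →* (A ≃ₐ[k] A)) :
    Subalgebra k (Fin (Nat.card Q) → A) where
  carrier := {f | ∀ p q, f (Finite.equivFin Q (i p * q)) = ρA p (f (Finite.equivFin Q q))}
  mul_mem' := fun ha hb p q => by simp [ha p q, hb p q]
  add_mem' := fun ha hb p q => by simp [ha p q, hb p q]
  algebraMap_mem' := fun c p q => by simp

/-- Translation of equivariant functions. -/
def coindAction [Finite Q] (i : P →* Q) (ρA : P →* (A ≃ₐ[k] A)) :
    Q →* (coindSubalgebra i ρA ≃ₐ[k] coindSubalgebra i ρA) :=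
  toAlgAut
    { toFun := fun q =>
        { toFun := fun f => ⟨fun x => f.1 (Finite.equivFin Q ((Finite.equivFin Q).symm x * q)),
            fun p q' => by simpa [mul_assoc] using f.2 p (q' * q)⟩
          map_one' := rfl
          map_mul' := fun _ _ => rfl
          map_zero' := rfl
          map_add' := fun _ _ => rfl
          commutes' := fun _ => rfl }
      map_one' := by ext; simp
      map_mul' := fun q q' => by
        ext f x
        change f.1 _ = f.1 _
        simp [mul_assoc] }

/-- Evaluation at `1`. -/
def coindEval [Finite Q] (i : P →* Q) (ρA : P →* (A ≃ₐ[k] A)) : coindSubalgebra i ρA →ₐ[k] A :=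
  (Pi.evalAlgHom k (fun _ : Fin (Nat.card Q) => A) (Finite.equivFin Q 1)).comp
    (coindSubalgebra i ρA).val

lemma coindEval_coindAction [Finite Q] (i : P →* Q) (ρA : P →* (A ≃ₐ[k] A)) (q : Q)
    (f : coindSubalgebra i ρA) :
    coindEval i ρA (coindAction i ρA q f) = f.1 (Finite.equivFin Q q) := by
  change f.1 (Finite.equivFin Q ((Finite.equivFin Q).symm (Finite.equivFin Q 1) * q)) = _
  simp

lemma isCoind_coindSubalgebra [Finite Q] (i : P →* Q) (ρA : P →* (A ≃ₐ[k] A)) :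
    IsCoind i ρA (coindAction i ρA) (coindEval i ρA) := by
  refine ⟨fun p f => ?_, fun f hf => ⟨⟨fun x => f ((Finite.equivFin Q).symm x),
    fun p q => by simpa using hf p q⟩, fun q => ?_, fun g hg => ?_⟩⟩
  · rw [coindEval_coindAction]
    have := f.2 p 1
    rwa [mul_one] at this
  · rw [coindEval_coindAction]; simp
  · ext x
    obtain ⟨q, rfl⟩ := (Finite.equivFin Q).surjective x
    simp [← hg q, coindEval_coindAction]

/-- If `C` is coinduced from `A` in two steps, then it is coinduced from the first step. -/
lemma IsCoind.of_comp [Finite R] {evA : C →ₐ[k] A} (h : IsCoind i ρA ρB ev)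
    (h' : IsCoind (j.comp i) ρA ρC evA) : ∃ ev' : C →ₐ[k] B, IsCoind j ρB ρC ev' := by
  have h₁ := isCoind_coindSubalgebra j ρB
  -- By transitivity the model coinduced from `B` is also coinduced from `A`, so it is isomorphic to
  -- `C`. Its evaluation map is then transported.
  obtain ⟨E, hE, -⟩ := (h.trans h₁).unique h'
  exact ⟨_, h₁.transport (MulEquiv.refl _) (MulEquiv.refl _) (fun _ => rfl) AlgEquiv.refl
    (fun _ _ => rfl) E hE⟩

/-- Invariant elements correspond to constant functions on `Q`, and a constant function is
equivariant exactly when its value is invariant. -/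
lemma IsCoind.exists_invariants_equiv {k : Type u} [Field k] {P Q : Type v} [Group P] [Group Q]
    {A B : Type u} [CommRing A] [Algebra k A] [CommRing B] [Algebra k B] {i : P →* Q}
    {ρA : P →* (A ≃ₐ[k] A)} {ρB : Q →* (B ≃ₐ[k] B)} {ev : B →ₐ[k] A} (h : IsCoind i ρA ρB ev) :
    ∃ e : invariants ρB ≃ₐ[k] invariants ρA, ∀ b, (e b : A) = ev b := by
  let F : invariants ρB →ₐ[k] invariants ρA :=
    (ev.comp (invariants ρB).val).codRestrict _ fun b p => by
      simpa [b.2 (i p)] using (h.1 p b).symm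
  refine ⟨AlgEquiv.ofBijective F ⟨fun b b' hb => ?_, fun a => ?_⟩, fun b => rfl⟩
  · refine Subtype.ext (h.ext fun q => ?_)
    rw [b.2 q, b'.2 q]
    exact congrArg Subtype.val hb
  · obtain ⟨b, hb, -⟩ := h.2 (fun _ => a) fun p q => (a.2 p).symm
    refine ⟨⟨b, fun q => h.ext fun q' => ?_⟩, Subtype.ext ?_⟩
    · rw [← AlgEquiv.mul_apply, ← map_mul, hb, hb]
    · have := hb 1
      rwa [map_one, AlgEquiv.one_apply] at this

end Coinduced

/-! ## Coset representatives -/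

section Transversal

variable {P Q : Type*} [Group P] [Group Q]

/-- Right coset representatives `r` for an injective homomorphism `i : P → Q`, with the
decomposition `q = i (h q) * r (c q)`. -/
structure Transversal (i : P →* Q) (m : ℕ) where
  /-- the representatives -/
  r : Fin m → Q
  /-- the index of the coset -/
  c : Q → Fin m
  /-- the component in `P` -/
  h : Q → P
  h_mul_r : ∀ q, i (h q) * r (c q) = q
  c_mul : ∀ p q, c (i p * q) = c q
  h_mul : ∀ p q, h (i p * q) = p * h q
  c_r : ∀ x, c (r x) = x
  h_r : ∀ x, h (r x) = 1
  h_one : h 1 = 1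
  card : Nat.card Q = m * Nat.card P

lemma exists_transversal [Finite Q] {i : P →* Q} (hi : Function.Injective i) :
    ∃ m, Nonempty (Transversal i m) := by
  -- The system of representatives is chosen to contain `1`, which gives the field `h_one`.
  obtain ⟨T, hT, h1⟩ := Subgroup.exists_isComplement_right i.range 1
  have : Finite T := Subtype.finite
  let eP : P ≃ i.range := (MonoidHom.ofInjective hi).toEquiv
  let eT := Finite.equivFin T
  let D : P × Fin (Nat.card T) → Q := fun x => i x.1 * (eT.symm x.2 : Q)
  have hD : Function.Bijective D := by
    have : D = (fun x : Prod (i.range : Set Q) T => x.1.1 * x.2.1) ∘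
        (Equiv.prodCongr eP eT.symm : P × Fin (Nat.card T) → i.range × T) := by
      ext x; rfl
    rw [this]
    exact Function.Bijective.comp hT (Equiv.bijective _)
  let e := Equiv.ofBijective D hD
  have key : ∀ p q, e.symm (i p * q) = (p * (e.symm q).1, (e.symm q).2) := fun p q => by
    rw [Equiv.symm_apply_eq]
    conv_lhs => rw [← e.apply_symm_apply q]
    change i p * (i _ * _) = i _ * _
    rw [map_mul, mul_assoc]
  have key2 : ∀ x, e.symm (eT.symm x : Q) = (1, x) := fun x => by
    rw [Equiv.symm_apply_eq]
    change _ = i 1 * _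
    simp
  refine ⟨Nat.card T, ⟨⟨fun x => eT.symm x, fun q => (e.symm q).2, fun q => (e.symm q).1,
    fun q => e.apply_symm_apply q, fun p q => by rw [key], fun p q => by rw [key],
    fun x => by rw [key2], fun x => by rw [key2], ?_, ?_⟩⟩⟩
  · have := key2 (eT ⟨1, h1⟩)
    simp only [Equiv.symm_apply_apply] at this
    exact congrArg Prod.fst this
  · rw [← Nat.card_congr e, Nat.card_prod, mul_comm]
    simp

variable {k : Type*} [Field k]
  {A B C : Type*} [CommRing A] [Algebra k A] [CommRing B] [Algebra k B]
  {i : P →* Q} {ρA : P →* (A ≃ₐ[k] A)} {ρB : Q →* (B ≃ₐ[k] B)} {ev : B →ₐ[k] A}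

/-- An equivariant function is determined by its values at coset representatives, and these values
are arbitrary. -/
lemma IsCoind.piEval_bijective {m : ℕ} (h : IsCoind i ρA ρB ev) (t : Transversal i m) :
    Function.Bijective fun (b : B) (x : Fin m) => ev (ρB (t.r x) b) := by
  refine ⟨fun b b' hb => h.ext fun q => ?_, fun f => ?_⟩
  · rw [← t.h_mul_r q, h.equivariant, h.equivariant]
    exact congrArg _ (congrFun hb (t.c q))
  · obtain ⟨b, hb, -⟩ := h.2 (fun q => ρA (t.h q) (f (t.c q))) fun p q => by
      rw [t.c_mul, t.h_mul, map_mul, AlgEquiv.mul_apply]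
    exact ⟨b, funext fun x => by simp [hb, t.c_r, t.h_r]⟩

/-- The converse of the preceding lemma. It reduces coinduction for polynomial rings and rings of
fractions to a statement about finite products. -/
lemma isCoind_of_bijective {m : ℕ} (t : Transversal i m)
    (h₁ : ∀ p b, ev (ρB (i p) b) = ρA p (ev b))
    (h₂ : Function.Bijective fun (b : B) (x : Fin m) => ev (ρB (t.r x) b)) :
    IsCoind i ρA ρB ev := by
  refine ⟨h₁, fun f hf => ?_⟩
  obtain ⟨b, hb⟩ := h₂.2 fun x => f (t.r x)
  refine ⟨b, fun q => ?_, fun b' hb' => h₂.1 (funext fun x => ?_)⟩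
  · rw [← t.h_mul_r q, map_mul, AlgEquiv.mul_apply, h₁, hf]
    exact congrArg _ (congrFun hb _)
  · exact (hb' _).trans (congrFun hb x).symm

end Transversal

/-! ## Twisted actions on polynomials and total rings of fractions -/

section Twist

variable {k : Type u} [Field k] {P Q : Type v} [Group P] [Group Q]
  {A B : Type u} [CommRing A] [Algebra k A] [CommRing B] [Algebra k B]

lemma IsCocycle.map_one {ρ : P →* (A ≃ₐ[k] A)} {c : P → Aˣ} (hc : IsCocycle ρ c) : c 1 = 1 := by
  have := hc 1 1
  rw [mul_one, _root_.map_one, AlgEquiv.one_apply, ← Units.val_mul, ← Units.ext_iff] at this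
  exact mul_eq_left.mp this.symm

/-- The action on polynomials which extends `ρ` and maps `X` to `c(p) X`. -/
def twist (ρ : P →* (A ≃ₐ[k] A)) (c : P → Aˣ) (hc : IsCocycle ρ c) :
    P →* (Polynomial A ≃ₐ[k] Polynomial A) :=
  toAlgAut
    { toFun := fun p =>
        { Polynomial.eval₂RingHom ((Polynomial.C).comp (ρ p : A →+* A))
            (Polynomial.C (c p : A) * Polynomial.X) with
          commutes' := fun x => by
            rw [IsScalarTower.algebraMap_apply k A (Polynomial A), Polynomial.algebraMap_eq]
            exact (Polynomial.eval₂_C _ _).trans (congrArg Polynomial.C ((ρ p).commutes x)) }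
      map_one' := by
        apply AlgHom.coe_ringHom_injective
        ext
        · simp
        · simp [hc.map_one]
      map_mul' := fun p q => by
        apply AlgHom.coe_ringHom_injective
        ext
        · simp
        · have := hc p q
          simp only [AlgHom.coe_toRingHom, AlgHom.coe_mk, Polynomial.eval₂RingHom] at *
          simp [this, mul_assoc, Polynomial.coeff_C_mul, mul_left_comm] }

variable {ρ : P →* (A ≃ₐ[k] A)} {c : P → Aˣ} (hc : IsCocycle ρ c)

@[simp] lemma twist_C (p : P) (a : A) :
    twist ρ c hc p (Polynomial.C a) = Polynomial.C (ρ p a) :=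
  (Polynomial.eval₂_C _ _).trans rfl

@[simp] lemma twist_X (p : P) :
    twist ρ c hc p Polynomial.X = Polynomial.C (c p : A) * Polynomial.X :=
  Polynomial.eval₂_X _ _

/-- The twisted action preserves degrees, so coinduction and invariance can be checked one
coefficient at a time. -/
lemma coeff_twist (p : P) (f : Polynomial A) (n : ℕ) :
    (twist ρ c hc p f).coeff n = ρ p (f.coeff n) * (c p : A) ^ n := by
  induction f using Polynomial.induction_on' with
  | add f g hf hg => simp [hf, hg, add_mul]
  | monomial m a =>
    rw [← Polynomial.C_mul_X_pow_eq_monomial, map_mul, map_pow, twist_C, twist_X, mul_pow,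
      ← Polynomial.C_pow, ← mul_assoc, ← Polynomial.C_mul, Polynomial.coeff_C_mul_X_pow,
      Polynomial.coeff_C_mul_X_pow]
    split_ifs with h <;> simp [h]

lemma fractionRing_algHom_ext {C : Type*} [CommRing C] [Algebra k C]
    {f g : FractionRing A →ₐ[k] C}
    (h : ∀ a, f (algebraMap A (FractionRing A) a) = g (algebraMap A (FractionRing A) a)) : f = g :=
  AlgHom.coe_ringHom_injective <| IsLocalization.ringHom_ext (nonZeroDivisors A) <|
    RingHom.ext h

/-- The induced action on total rings of fractions. -/
def fracAction (ρ : P →* (A ≃ₐ[k] A)) : P →* (FractionRing A ≃ₐ[k] FractionRing A) :=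
  toAlgAut
    { toFun := fun p => (IsFractionRing.algEquivOfAlgEquiv (ρ p)).toAlgHom
      map_one' := fractionRing_algHom_ext fun a => by simp
      map_mul' := fun p q => fractionRing_algHom_ext fun a => by simp }

@[simp] lemma fracAction_algebraMap (ρ : P →* (A ≃ₐ[k] A)) (p : P) (a : A) :
    fracAction ρ p (algebraMap A (FractionRing A) a) = algebraMap A (FractionRing A) (ρ p a) := by
  simp [fracAction]

lemma eq_fracAction {ρ : P →* (A ≃ₐ[k] A)} {τ : P →* (FractionRing A ≃ₐ[k] FractionRing A)}
    (h : ∀ p a, τ p (algebraMap A (FractionRing A) a) = algebraMap A (FractionRing A) (ρ p a)) :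
    τ = fracAction ρ := by
  ext p x
  exact DFunLike.congr_fun (fractionRing_algHom_ext (f := (τ p).toAlgHom)
    (g := (fracAction ρ p).toAlgHom) fun a => by simp [h]) x

variable {i : P →* Q} {ρB : Q →* (B ≃ₐ[k] B)} {ev : B →ₐ[k] A}

/-- In degree `n` the twist multiplies by the `n`-th power of a unit. Hence bijectivity of
evaluation at representatives passes from `B` to each coefficient. -/
lemma IsCoind.polynomial {m : ℕ} (h : IsCoind i ρ ρB ev) (t : Transversal i m) {cB : Q → Bˣ}
    (hcB : IsCocycle ρB cB) (hev : ∀ p, ev (cB (i p)) = c p) :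
    IsCoind i (twist ρ c hc) (twist ρB cB hcB) (Polynomial.mapAlgHom ev) := by
  have hco : ∀ q f n, (Polynomial.mapAlgHom ev (twist ρB cB hcB q f)).coeff n =
      ev (ρB q (f.coeff n)) * (Units.map (ev : B →* A) (cB q) : A) ^ n := fun q f n => by
    simp [Polynomial.coeff_map, coeff_twist]
  refine isCoind_of_bijective t (fun p b => ?_) ⟨fun b b' hb => ?_, fun f => ?_⟩
  · ext n
    rw [hco, coeff_twist, h.1]
    simp [hev]
  · ext n
    refine (h.piEval_bijective t).1 (funext fun x => ?_)
    have := congrArg (fun f => Polynomial.coeff f n) (congrFun hb x)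
    simp only [hco] at this
    exact ((cB (t.r x)).map (ev : B →* A) ^ n).isUnit.mul_left_injective (by simpa using this)
  -- Division by the `n`-th power of the unit undoes the twist in degree `n`.
  · choose b hb using fun n => (h.piEval_bijective t).2 fun x =>
      (f x).coeff n * ((((cB (t.r x)).map (ev : B →* A))⁻¹ ^ n : Aˣ) : A)
    -- A common degree bound for the finitely many components makes the family of coefficients a
    -- polynomial.
    let N := Finset.univ.sup fun x => (f x).natDegree
    refine ⟨∑ n ∈ Finset.range (N + 1), Polynomial.monomial n (b n), funext fun x => ?_⟩
    ext n
    simp only [hco]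
    rw [Polynomial.finsetSum_coeff]
    simp only [Polynomial.coeff_monomial, Finset.sum_ite_eq', Finset.mem_range]
    split_ifs with hn
    · rw [show ev (ρB (t.r x) (b n)) = _ from congrFun (hb n) x, mul_assoc, ← Units.val_pow_eq_pow_val, ← Units.val_mul]
      simp
    · rw [map_zero, map_zero, zero_mul, Polynomial.coeff_eq_zero_of_natDegree_lt]
      have := Finset.le_sup (f := fun x => (f x).natDegree) (Finset.mem_univ x)
      change _ ≤ N at this
      omega

/-- If `a` annihilates `ev b`, then the element of `B` whose only nonzero component is `a`, at the
coset of `1`, annihilates `b`. -/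
lemma IsCoind.map_mem_nonZeroDivisors {m : ℕ} (h : IsCoind i ρ ρB ev) (t : Transversal i m)
    {b : B} (hb : b ∈ nonZeroDivisors B) : ev b ∈ nonZeroDivisors A := by
  classical
  rw [mem_nonZeroDivisors_iff_right] at hb ⊢
  intro a ha
  obtain ⟨b', hb'⟩ := (h.piEval_bijective t).2 (Pi.single (t.c 1) a)
  have hr : t.r (t.c 1) = 1 := by simpa [t.h_one] using t.h_mul_r 1
  have : b' = 0 := hb _ <| (h.piEval_bijective t).1 <| funext fun x => by
    have := congrFun hb' x
    simp only [map_mul, map_zero] at this ⊢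
    rw [this]
    by_cases hx : x = t.c 1
    · subst hx; simp [hr, ha]
    · simp [hx]
  have h1 := congrFun hb' (t.c 1)
  simpa [this] using h1.symm

/-- The map of total rings of fractions given by an evaluation map. -/
def IsCoind.fracMap {m : ℕ} (h : IsCoind i ρ ρB ev) (t : Transversal i m) :
    FractionRing B →ₐ[k] FractionRing A :=
  IsLocalization.liftAlgHom (M := nonZeroDivisors B)
    (f := (IsScalarTower.toAlgHom k A (FractionRing A)).comp ev)
    fun y => IsLocalization.map_units (M := nonZeroDivisors A) (FractionRing A)
      ⟨ev y, h.map_mem_nonZeroDivisors t y.2⟩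

lemma IsCoind.fracMap_algebraMap {m : ℕ} (h : IsCoind i ρ ρB ev) (t : Transversal i m) (b : B) :
    h.fracMap t (algebraMap B (FractionRing B) b) = algebraMap A (FractionRing A) (ev b) :=
  IsLocalization.lift_eq _ _

/-- Total rings of fractions commute with finite products: numerators and denominators chosen on
each component combine to a single fraction. -/
lemma IsCoind.fracAction {m : ℕ} (h : IsCoind i ρ ρB ev) (t : Transversal i m) :
    IsCoind i (fracAction ρ) (fracAction ρB) (h.fracMap t) := by
  have key : ∀ q b, h.fracMap t (EqBurnside.fracAction ρB q (algebraMap B _ b)) =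
      algebraMap A _ (ev (ρB q b)) := fun q b => by
    rw [fracAction_algebraMap, h.fracMap_algebraMap]
  refine isCoind_of_bijective t (fun p b => ?_) ⟨?_, fun f => ?_⟩
  · exact DFunLike.congr_fun (fractionRing_algHom_ext
      (f := (h.fracMap t).comp (EqBurnside.fracAction ρB (i p)).toAlgHom)
      (g := (EqBurnside.fracAction ρ p).toAlgHom.comp (h.fracMap t)) fun a => by
        simp [h.fracMap_algebraMap, h.1]) b
  · let F : FractionRing B →+* (Fin m → FractionRing A) :=
      RingHom.pi fun x => ((h.fracMap t).comp (EqBurnside.fracAction ρB (t.r x)).toAlgHom).toRingHom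
    refine (injective_iff_map_eq_zero F).mpr fun z hz => ?_
    obtain ⟨b, s, rfl⟩ := IsLocalization.exists_mk'_eq (nonZeroDivisors B) z
    have hb : F (algebraMap B _ b) = 0 := by
      rw [← IsLocalization.mk'_spec (FractionRing B) b s, map_mul, hz, zero_mul]
    have : b = 0 := (h.piEval_bijective t).1 <| funext fun x => by
      have := congrFun hb x
      change h.fracMap t (EqBurnside.fracAction ρB (t.r x) (algebraMap B _ b)) = 0 at this
      rw [key, map_eq_zero_iff _ (IsFractionRing.injective A (FractionRing A))] at this
      simp [this]
    rw [this, IsLocalization.mk'_zero]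
  · choose n d hnd using fun x => IsLocalization.exists_mk'_eq (nonZeroDivisors A) (f x)
    obtain ⟨b, hb⟩ := (h.piEval_bijective t).2 n
    obtain ⟨s, hs⟩ := (h.piEval_bijective t).2 fun x => d x
    have hs0 : s ∈ nonZeroDivisors B := by
      rw [mem_nonZeroDivisors_iff_right]
      refine fun b hb => (h.piEval_bijective t).1 (funext fun x => ?_)
      have h1 : ev (ρB (t.r x) b) * d x = 0 := by
        rw [← congrFun hs x, ← map_mul, ← map_mul, hb, map_zero, map_zero]
      simpa using (mem_nonZeroDivisors_iff_right.mp (d x).2) _ h1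
    refine ⟨IsLocalization.mk' (FractionRing B) b ⟨s, hs0⟩, funext fun x => ?_⟩
    rw [← hnd, IsLocalization.eq_mk'_iff_mul_eq, ← congrFun hb x, ← congrFun hs x]
    simp only
    rw [← key, ← key, ← map_mul, ← map_mul, IsLocalization.mk'_spec' (FractionRing B) b ⟨s, hs0⟩ |>.symm, mul_comm]

end Twist

/-! ## Galois algebras and coinduction -/

section Galois

variable {k : Type u} [Field k] {P Q : Type v} [Group P] [Group Q]
  {A B : Type u} [CommRing A] [Algebra k A] [CommRing B] [Algebra k B]
  {i : P →* Q} {ρA : P →* (A ≃ₐ[k] A)} {ρB : Q →* (B ≃ₐ[k] B)} {ev : B →ₐ[k] A}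

/-- A coinduced algebra is a finite product of copies of the given algebra. -/
def IsCoind.piEquiv {m : ℕ} (h : IsCoind i ρA ρB ev) (t : Transversal i m) : B ≃+* (Fin m → A) :=
  RingEquiv.ofBijective (RingHom.pi fun x => (ev.comp (ρB (t.r x)).toAlgHom).toRingHom)
    (h.piEval_bijective t)

/-- The invariants of a coinduced algebra. -/
def IsCoind.invariantsEquiv (h : IsCoind i ρA ρB ev) : invariants ρB ≃ₐ[k] invariants ρA :=
  h.exists_invariants_equiv.choose

lemma IsCoind.invariantsEquiv_apply (h : IsCoind i ρA ρB ev) (b : invariants ρB) :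
    (h.invariantsEquiv b : A) = ev b :=
  h.exists_invariants_equiv.choose_spec b

lemma IsCoind.piEquiv_algebraMap {m : ℕ} (h : IsCoind i ρA ρB ev) (t : Transversal i m)
    (b : invariants ρB) :
    h.piEquiv t (algebraMap (invariants ρB) B b) =
      algebraMap (invariants ρA) (Fin m → A) (h.invariantsEquiv b) := by
  funext x
  change ev (ρB (t.r x) b) = h.invariantsEquiv b
  rw [b.2, h.invariantsEquiv_apply]

lemma moduleFinite_of_etale {K₀ : Type*} [CommRing K₀] [Algebra K₀ A] (hf : IsField K₀)
    [Algebra.Etale K₀ A] : Module.Finite K₀ A := by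
  let := hf.toField
  exact Algebra.FormallyUnramified.finite_of_free K₀ A

lemma etale_pi {K₀ : Type u} [CommRing K₀] [Algebra K₀ A] (hf : IsField K₀)
    [Algebra.Etale K₀ A] (m : ℕ) : Algebra.Etale K₀ (Fin m → A) := by
  let := hf.toField
  have := moduleFinite_of_etale (A := A) hf
  have : Algebra.FormallyEtale K₀ (Fin m → A) :=
    (Algebra.FormallyEtale.pi_iff _).mpr fun _ => inferInstance
  have : Algebra.FinitePresentation K₀ (Fin m → A) :=
    Algebra.FinitePresentation.of_finiteType.mp inferInstance
  exact {}

lemma IsCoind.etale {m : ℕ} (h : IsCoind i ρA ρB ev) (t : Transversal i m)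
    (hf : IsField (invariants ρA)) [Algebra.Etale (invariants ρA) A] :
    Algebra.Etale (invariants ρB) B := by
  have h₁ := RingHom.etale_algebraMap.mpr (etale_pi (A := A) hf m)
  have h₂ := RingHom.Etale.respectsIso.2 _ h.invariantsEquiv.toRingEquiv h₁
  have h₃ := RingHom.Etale.respectsIso.1 _ (h.piEquiv t).symm h₂
  rw [← RingHom.etale_algebraMap]
  convert h₃ using 1
  ext b
  simp only [RingHom.comp_apply]
  refine ((RingEquiv.symm_apply_eq _).mpr ?_).symm
  exact (h.piEquiv_algebraMap t b).symm

lemma IsCoind.finrank {m : ℕ} (h : IsCoind i ρA ρB ev) (t : Transversal i m)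
    (hf : IsField (invariants ρA)) [Algebra.Etale (invariants ρA) A] :
    Module.finrank (invariants ρB) B = m * Module.finrank (invariants ρA) A := by
  rw [Algebra.finrank_eq_of_equiv_equiv h.invariantsEquiv.toRingEquiv (h.piEquiv t)
    (RingHom.ext fun b => (h.piEquiv_algebraMap t b).symm)]
  let := hf.toField
  have := moduleFinite_of_etale (A := A) hf
  simpa using Module.finrank_pi_fintype (R := invariants ρA) (M := fun _ : Fin m => A)

/-- Surjectivity in Shapiro's lemma, on the level of cocycles. The last clause serves to lift
characters: a central element that acts trivially on `A` keeps its scalar value. -/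
lemma IsCoind.exists_cocycle {m : ℕ} (h : IsCoind i ρA ρB ev) (t : Transversal i m) {c : P → Aˣ}
    (hc : IsCocycle ρA c) : ∃ C : Q → Bˣ, IsCocycle ρB C ∧ (∀ p, ev (C (i p)) = c p) ∧
      ∀ z x, (∀ q, q * i z = i z * q) → ρA z = 1 → (c z : A) = algebraMap k A x →
        (C (i z) : B) = algebraMap k B x := by
  let act : P → Aˣ →* Aˣ := fun p => Units.map (ρA p : A →* A)
  let φ : Q → Aˣ := fun q => c (t.h q)
  have hφ : ∀ p q, φ (i p * q) = c p * act p (φ q) := fun p q => by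
    ext
    change (c (t.h (i p * q)) : A) = _
    rw [t.h_mul, hc]
    rfl
  have hφ1 : φ 1 = 1 := by
    change c (t.h 1) = 1
    rw [t.h_one, hc.map_one]
  let D : Q → Q → Aˣ := fun q x => φ (x * q) / φ x
  have hD : ∀ q p x, D q (i p * x) = act p (D q x) := fun q p x => by
    change φ (_ * _) / _ = act p (_ / _)
    rw [mul_assoc, hφ, hφ, map_div, mul_div_mul_left_eq_div]
  choose b hb using fun q => (h.2 (fun x => (D q x : A)) fun p x => by rw [hD]; rfl).exists
  choose b' hb' using fun q => (h.2 (fun x => ((D q x)⁻¹ : Aˣ) : Q → A) fun p x => by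
    rw [hD, ← map_inv]; rfl).exists
  have hbb : ∀ q, b q * b' q = 1 := fun q => h.ext fun x => by
    simp [hb, hb']
  refine ⟨fun q => ⟨b q, b' q, hbb q, by rw [mul_comm, hbb]⟩, fun q q' => h.ext fun x => ?_,
    fun p => ?_, fun z x hz hρ hx => h.ext fun y => ?_⟩
  · change ev (ρB x (b _)) = ev (ρB x (b _ * ρB q (b _)))
    rw [map_mul, map_mul, ← AlgEquiv.mul_apply, ← map_mul ρB, hb, hb, hb, ← Units.val_mul]
    congr 1
    change φ _ / _ = φ _ / _ * (φ _ / φ _)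
    rw [mul_comm, div_mul_div_cancel, mul_assoc]
  · have := hb (i p) 1
    rw [map_one, AlgEquiv.one_apply] at this
    refine this.trans ?_
    change ((φ _ / φ 1 : Aˣ) : A) = _
    have h2 := hφ p 1
    rw [hφ1, map_one, mul_one, mul_one] at h2
    rw [one_mul, hφ1, h2, div_one]
  · refine (hb _ _).trans ?_
    have h2 : act z (φ y) = φ y := by
      ext
      change ρA z _ = _
      rw [hρ]; rfl
    change ((φ _ / φ _ : Aˣ) : A) = _
    rw [hz, hφ, h2, mul_div_cancel_right, hx]
    simp

end Galois

/-! ### Restriction to centralizers and the induced Galois algebra -/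

section Restrict

variable {k : Type u} [Field k] {G G₁ : Type v} [Group G] [Group G₁]

/-- The restriction of a homomorphism to subgroups. -/
def restrictHom (ι : G₁ →* G) (P : Subgroup G₁) (Q : Subgroup G) (h : ∀ p ∈ P, ι p ∈ Q) : P →* Q :=
  (ι.comp P.subtype).codRestrict Q fun p => h p p.2

lemma restrictHom_injective {ι : G₁ →* G} (hι : Function.Injective ι) {P : Subgroup G₁}
    {Q : Subgroup G} (h : ∀ p ∈ P, ι p ∈ Q) : Function.Injective (restrictHom ι P Q h) :=
  fun _ _ hab => Subtype.ext (hι (congrArg Subtype.val hab))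

lemma isInducedAlg_iff {ι : G₁ →* G} {P : Subgroup G₁} {Q : Subgroup G} (h : ∀ p ∈ P, ι p ∈ Q)
    {A B : Type u} [CommRing A] [Algebra k A] [CommRing B] [Algebra k B]
    {ρA : P →* (A ≃ₐ[k] A)} {ρB : Q →* (B ≃ₐ[k] B)} :
    IsInducedAlg ι ρA ρB ↔ ∃ ev, IsCoind (restrictHom ι P Q h) ρA ρB ev := by
  refine exists_congr fun ev => and_congr ⟨fun h₁ p b => h₁ p _ b rfl, fun h₁ p q b hq => ?_⟩
    (forall_congr' fun f => imp_congr_left ⟨fun h₁ p q => h₁ p q _ rfl, fun h₁ p q q' hq => ?_⟩)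
  · rw [← h₁, show q = restrictHom ι P Q h p from Subtype.ext hq]
  · rw [← h₁, show q' = restrictHom ι P Q h p * q from Subtype.ext hq]

lemma map_mem_centralizer {G' : Subgroup G} (H : Subgroup G') {H₁ : Subgroup G}
    (hH : H₁ = H.map G'.subtype) :
    ∀ p ∈ Subgroup.centralizer (H : Set G'), G'.subtype p ∈ Subgroup.centralizer (H₁ : Set G) := by
  rintro p hp _ hx
  rw [hH] at hx
  obtain ⟨y, hy, rfl⟩ := hx
  exact congrArg Subtype.val (hp y hy)

lemma centralizer_le {H H₁ : Subgroup G} (hH : H₁ ≤ H) :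
    ∀ p ∈ Subgroup.centralizer (H : Set G),
      MonoidHom.id G p ∈ Subgroup.centralizer (H₁ : Set G) :=
  fun _ hp x hx => hp x (hH hx)

/-- Elements of `H` are central in `Z_G(H)`, so they act on equivariant functions through their
action on values. Hence they act trivially, and lifted characters stay lifts after extension of
cocycles. The rank is multiplied by the index of `Z_{G'}(H)` in `Z_G(H)`. -/
lemma exists_induced_galoisAlg [Finite G] {G' : Subgroup G} (H : Subgroup G')
    (hH : ∀ a ∈ H, ∀ b ∈ H, a * b = b * a) {d : ℕ} (A : GaloisAlg k H d) :
    ∃ B : GaloisAlg k (H.map G'.subtype) d, ∃ ev,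
      IsCoind (restrictHom G'.subtype _ _ (map_mem_centralizer H rfl)) A.ρ B.ρ ev := by
  set i := restrictHom G'.subtype _ _ (map_mem_centralizer H rfl)
  obtain ⟨m, ⟨t⟩⟩ := exists_transversal (i := i) (restrictHom_injective G'.subtype_injective _)
  have h := isCoind_coindSubalgebra i A.ρ
  have := A.etale
  -- Commutativity of `H` puts it inside its own centralizer in `G'`.
  have hlift : ∀ z : Subgroup.centralizer ((H.map G'.subtype : Subgroup G) : Set G),
      (z : G) ∈ H.map G'.subtype → 
        ∃ p : Subgroup.centralizer (H : Set G'), (p : G') ∈ H ∧ z = i p := by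
    rintro z ⟨y, hy, hyz⟩
    exact ⟨⟨y, fun x hx => hH x hx y hy⟩, hy, Subtype.ext hyz.symm⟩
  have hcomm : ∀ (p : Subgroup.centralizer (H : Set G')) (_ : (p : G') ∈ H) q,
      q * i p = i p * q := fun p hp q =>
    Subtype.ext (q.2 _ ⟨p, hp, rfl⟩).symm
  exact
   ⟨{ K := coindSubalgebra i A.ρ
      ρ := coindAction i A.ρ
      trivial_on := fun z hz => by
        obtain ⟨p, hp, rfl⟩ := hlift z hz
        ext1 b
        refine h.ext fun q => ?_
        rw [← AlgEquiv.mul_apply, ← map_mul, hcomm p hp, h.equivariant, A.trivial_on p hp]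
        rfl
      isField := h.invariantsEquiv.toMulEquiv.isField A.isField
      fg := (Algebra.EssFiniteType.iff_of_algEquiv h.invariantsEquiv).mpr A.fg
      trdeg := h.invariantsEquiv.trdeg_eq.trans A.trdeg
      etale := h.etale t A.isField
      rank := by
        rw [h.finrank t A.isField, t.card, ← A.rank,
          Subgroup.card_map_of_injective G'.subtype_injective, mul_assoc]
      lift_char := fun χ => by
        let e := H.equivMapOfInjective G'.subtype G'.subtype_injective
        obtain ⟨c, hc, hcχ⟩ := A.lift_char (χ.comp e.toMonoidHom)
        obtain ⟨C, hC, -, hCz⟩ := h.exists_cocycle t hc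
        refine ⟨C, hC, fun z hz => ?_⟩
        obtain ⟨p, hp, rfl⟩ := hlift z hz
        exact hCz p _ (hcomm p hp) (A.trivial_on p hp) (hcχ p hp) }, _, h⟩

end Restrict

/-! ## Homomorphisms from Burnside groups -/

section BurnHom

variable {k : Type u} [Field k] {G : Type v} [Group G] {n : ℕ}

/-- A homomorphism from the equivariant Burnside group, from its values on symbols. -/
def burnLift {M : Type*} [AddCommGroup M] (f : Symb k G n → M)
    (hf : ∀ x, IsRelator x → FreeAbelianGroup.lift f x = 0) : Burn k G n →+ M :=
  QuotientAddGroup.lift _ (FreeAbelianGroup.lift f)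
    ((AddSubgroup.closure_le (FreeAbelianGroup.lift f).ker).mpr hf)

lemma burnLift_cls {M : Type*} [AddCommGroup M] (f : Symb k G n → M)
    (hf : ∀ x, IsRelator x → FreeAbelianGroup.lift f x = 0) (s : Symb k G n) :
    burnLift f hf s.cls = f s :=
  FreeAbelianGroup.lift_apply_of f s

lemma burn_hom_ext {M : Type*} [AddCommGroup M] {f g : Burn k G n →+ M}
    (h : ∀ s : Symb k G n, f s.cls = g s.cls) : f = g :=
  QuotientAddGroup.addMonoidHom_ext _ (FreeAbelianGroup.lift_ext _ _ h)

lemma IsRelator.mk_eq_zero {x : FreeAbelianGroup (Symb k G n)} (h : IsRelator x) :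
    (QuotientAddGroup.mk x : Burn k G n) = 0 :=
  (QuotientAddGroup.eq_zero_iff x).mpr (AddSubgroup.subset_closure h)

lemma IsOrbRelator.mk_eq_zero {x : FreeAbelianGroup (OrbSymb k n)} (h : IsOrbRelator x) :
    (QuotientAddGroup.mk x : OrbBurn k n) = 0 :=
  (QuotientAddGroup.eq_zero_iff x).mpr (AddSubgroup.subset_closure h)

lemma IsConjugate.cls_eq {g : G} {s t : Symb k G n} (h : IsConjugate g s t) : s.cls = t.cls :=
  sub_eq_zero.mp (IsRelator.conj g s t h).mk_eq_zero

end BurnHom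

/-! ### Lists of characters -/

section Lists

lemma forall₂_trans {α β γ : Type*} {R : α → β → Prop} {S : β → γ → Prop} {T : α → γ → Prop}
    (h : ∀ a b c, R a b → S b c → T a c) {l₁ : List α} {l₂ : List β} {l₃ : List γ}
    (h₁ : List.Forall₂ R l₁ l₂) (h₂ : List.Forall₂ S l₂ l₃) : List.Forall₂ T l₁ l₃ := by
  induction h₁ generalizing l₃ with
  | nil => cases h₂; exact .nil
  | cons hab _ ih =>
    cases h₂ with
    | cons hbc h₂ => exact .cons (h _ _ _ hab hbc) (ih h₂)

lemma forall₂_map_self {α β : Type*} {R : α → β → Prop} {f : α → β} (h : ∀ a, R a (f a))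
    (l : List α) : List.Forall₂ R l (l.map f) := by
  induction l with
  | nil => exact .nil
  | cons a l ih => exact .cons (h a) ih

lemma closure_map_eq_top {H H₁ M : Type*} [Group H] [Group H₁] [CommGroup M]
    (f : (H →* M) ≃* (H₁ →* M)) {l : List (H →* M)} (h : Subgroup.closure {b | b ∈ l} = ⊤) :
    Subgroup.closure {b | b ∈ l.map f} = ⊤ := by
  have : {b | b ∈ l.map f} = f '' {b | b ∈ l} := by ext; simp
  have h₁ := MonoidHom.map_closure f.toMonoidHom {b | b ∈ l}
  rw [h, ← MonoidHom.range_eq_map, MonoidHom.range_eq_top.mpr f.surjective] at h₁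
  rw [this, h₁]
  rfl

end Lists

/-! ## The induction homomorphism -/

section Induction

variable {k : Type u} [Field k] {G : Type v} [Group G] {n : ℕ} {G' : Subgroup G}

/-- Transport of characters of a subgroup `H` of `G'` to its image in `G`. -/
def charMap (k : Type u) [Field k] (H : Subgroup G') :
    (H →* kˣ) ≃* (H.map G'.subtype →* kˣ) :=
  (H.equivMapOfInjective G'.subtype G'.subtype_injective).monoidHomCongrLeft

lemma charMap_apply {H : Subgroup G'} (b : H →* kˣ) (h : H) (h' : H.map G'.subtype)
    (hh : (h' : G) = (h : G')) : charMap k H b h' = b h := by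
  change b ((H.equivMapOfInjective G'.subtype G'.subtype_injective).symm h') = _
  congr 1
  rw [MulEquiv.symm_apply_eq]
  exact Subtype.ext hh

/-- Conjugation as an isomorphism of centralizers. -/
def conjCentralizer {H H₁ : Subgroup G} (g : G) (h : H₁ = H.map (MulAut.conj g).toMonoidHom) :
    Subgroup.centralizer (H : Set G) ≃* Subgroup.centralizer (H₁ : Set G) where
  toFun z := ⟨g * z * g⁻¹, by
    rw [h]
    rintro _ ⟨y, hy, rfl⟩
    calc g * y * g⁻¹ * (g * z * g⁻¹) = g * (y * z) * g⁻¹ := by group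
      _ = g * (z * y) * g⁻¹ := by rw [z.2 y hy]
      _ = g * z * g⁻¹ * (g * y * g⁻¹) := by group⟩
  invFun z := ⟨g⁻¹ * z * g, fun y hy => by
    have := z.2 (g * y * g⁻¹) (by rw [h]; exact ⟨y, hy, rfl⟩)
    calc y * (g⁻¹ * z * g) = g⁻¹ * (g * y * g⁻¹ * z) * g := by group
      _ = g⁻¹ * (z * (g * y * g⁻¹)) * g := by rw [this]
      _ = _ := by group⟩
  left_inv z := Subtype.ext (by simp [mul_assoc])
  right_inv z := Subtype.ext (by simp [mul_assoc])
  map_mul' y z := Subtype.ext (by simp [mul_assoc])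

/-- Induced symbols of conjugate symbols are conjugate. -/
lemma IsConjugate.induced {s s' : Symb k G' n} {t t' : Symb k G n} {g : G'}
    (hc : IsConjugate g s s') (ht : IsInducedSymb s t) (ht' : IsInducedSymb s' t') :
    IsConjugate (g : G) t t' := by
  obtain ⟨hH, ⟨e, he⟩, hβ⟩ := hc
  obtain ⟨h₁, h₂, h₃⟩ := ht
  obtain ⟨h₁', h₂', h₃'⟩ := ht'
  have hH' : t'.H = t.H.map (MulAut.conj (g : G)).toMonoidHom := by
    rw [h₁', hH, h₁, Subgroup.map_map, Subgroup.map_map]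
    rfl
  obtain ⟨ev, hev⟩ := (isInducedAlg_iff (map_mem_centralizer s.H h₁)).mp h₂
  obtain ⟨ev', hev'⟩ := (isInducedAlg_iff (map_mem_centralizer s'.H h₁')).mp h₂'
  -- Conjugation by `g` is compatible with the inclusion of centralizers in `G'` into those in `G`,
  -- so the isomorphism `e` extends to the coinduced algebras.
  obtain ⟨E, hE⟩ := hev.unique_equiv hev' (conjCentralizer g hH) (conjCentralizer (g : G) hH')
    (fun p => rfl) e fun p a => he p _ rfl a
  refine ⟨hH', ⟨E, fun z z' hz a => ?_⟩, ?_⟩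
  · rw [hE]
    congr 2
    exact Subtype.ext hz.symm
  -- Three matchings are composed: from `t` back to `s`, the conjugation to `s'`, and on to `t'`.
  · refine forall₂_trans (fun B b B' hb hB h h' hh => ?_)
      (forall₂_trans (fun B b b' hb hb' h h' hh => ?_) h₃.flip hβ) h₃'
      (R := fun B b' => ∀ (h : t.H) (h' : s'.H), (h' : G) = g * h * g⁻¹ → b' h' = B h)
    · obtain ⟨y, hy, hyh⟩ := h₁'.le h'.2
      rw [hB ⟨y, hy⟩ h' hyh.symm]
      exact hb _ _ (hyh.trans hh)
    · obtain ⟨y, hy, hyh⟩ := h₁.le h.2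
      rw [hb ⟨y, hy⟩ h hyh.symm]
      refine hb' _ _ (Subtype.ext (hh.trans ?_))
      rw [← hyh]
      rfl

lemma isConjugate_one (s : Symb k G n) : IsConjugate 1 s s := by
  refine ⟨by simp [MulAut.one_def], ⟨AlgEquiv.refl, fun z z' hz a => ?_⟩, ?_⟩
  · rw [show z = z' from Subtype.ext (by simpa using hz.symm)]
    rfl
  · refine List.forall₂_same.mpr fun b _ h h' hh => ?_
    rw [show h = h' from Subtype.ext (by simpa using hh.symm)]

/-- The conjugation relation for `g = 1` absorbs isomorphisms of algebras, so the choice of the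
coinduced algebra does not matter. -/
lemma IsInducedSymb.cls_eq {s : Symb k G' n} {t t' : Symb k G n} (h : IsInducedSymb s t)
    (h' : IsInducedSymb s t') : t.cls = t'.cls :=
  ((isConjugate_one s).induced h h').cls_eq

/-- An action on `K(t)` is determined by its effect on constants and on `t`. This brings the
relational definition into the form to which the results on coinduction apply. -/
lemma exists_fracAction {H : Subgroup G} {d : ℕ} {A : GaloisAlg k H d} {b : H →* kˣ}
    {τ : Subgroup.centralizer (H : Set G) →*
      (FractionRing (Polynomial A.K) ≃ₐ[k] FractionRing (Polynomial A.K))}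
    (h : IsLiftedAction A b τ) : ∃ (c : Subgroup.centralizer (H : Set G) → A.Kˣ)
      (hc : IsCocycle A.ρ c), (∀ (z : Subgroup.centralizer (H : Set G)) (hz : (z : G) ∈ H),
        (c z : A.K) = algebraMap k A.K (b ⟨z, hz⟩)) ∧ τ = fracAction (twist A.ρ c hc) := by
  obtain ⟨c, hc, hb, h₁, h₂⟩ := h
  refine ⟨c, hc, hb, eq_fracAction fun p f => ?_⟩
  induction f using Polynomial.induction_on with
  | C a => rw [h₁, twist_C]
  | add f g hf hg => simp only [map_add, hf, hg]
  | monomial m a hm =>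
    rw [pow_succ, ← mul_assoc, map_mul (algebraMap _ _), map_mul (τ p), hm, h₂,
      map_mul (twist _ _ _ _) (_ * _), twist_X, ← map_mul (algebraMap _ _)]

lemma isLiftedAction_fracAction {H : Subgroup G} {d : ℕ} {A : GaloisAlg k H d} {b : H →* kˣ}
    {c : Subgroup.centralizer (H : Set G) → A.Kˣ} (hc : IsCocycle A.ρ c)
    (hb : ∀ (z : Subgroup.centralizer (H : Set G)) (hz : (z : G) ∈ H),
      (c z : A.K) = algebraMap k A.K (b ⟨z, hz⟩)) :
    IsLiftedAction A b (fracAction (twist A.ρ c hc)) :=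
  ⟨c, hc, hb, fun z a => by simp, fun z => by simp⟩

variable [Finite G]

/-- The induced symbol. -/
def indSymb (s : Symb k G' n) : Symb k G n where
  H := s.H.map G'.subtype
  comm := by
    rintro _ ⟨a, ha, rfl⟩ _ ⟨b, hb, rfl⟩
    exact congrArg Subtype.val (s.comm a ha b hb)
  d := s.d
  A := (exists_induced_galoisAlg s.H s.comm s.A).choose
  β := s.β.map (charMap k s.H)
  ne_one := fun b hb => by
    obtain ⟨a, ha, rfl⟩ := List.mem_map.mp hb
    exact (map_ne_one_iff _ (charMap k s.H).injective).mpr (s.ne_one a ha)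
  generate := closure_map_eq_top (charMap k s.H) s.generate
  length_add := by rw [List.length_map, s.length_add]

lemma isCoind_indSymb (s : Symb k G' n) :
    ∃ ev, IsCoind (restrictHom G'.subtype _ _ (map_mem_centralizer s.H rfl)) s.A.ρ
      (indSymb s).A.ρ ev :=
  (exists_induced_galoisAlg s.H s.comm s.A).choose_spec

lemma isInducedSymb_indSymb (s : Symb k G' n) : IsInducedSymb s (indSymb s) :=
  ⟨rfl, (isInducedAlg_iff _).mpr (isCoind_indSymb s),
    forall₂_map_self (R := fun (b : s.H →* kˣ) (b' : s.H.map G'.subtype →* kˣ) =>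
      ∀ (h : s.H) (h' : s.H.map G'.subtype), (h' : G) = (h : G') → b' h' = b h) (fun b h h' hh => charMap_apply b h h' hh) s.β⟩

/-- Transport of characters to the subgroup of the induced symbol. -/
def indChar (s : Symb k G' n) : (s.H →* kˣ) ≃* ((indSymb s : Symb k G n).H →* kˣ) :=
  charMap k s.H

lemma indChar_apply {s : Symb k G' n} (b : s.H →* kˣ) (h : s.H) (h' : (indSymb s : Symb k G n).H)
    (hh : (h' : G) = (h : G')) : indChar s b h' = b h :=
  charMap_apply b h h' hh

lemma indChar_div (s : Symb k G' n) (b b' : s.H →* kˣ) :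
    (indChar s (b / b') : (indSymb s : Symb k G n).H →* kˣ) = indChar s b / indChar s b' := rfl

lemma indChar_zpow (s : Symb k G' n) (b : s.H →* kˣ) (m : ℤ) :
    (indChar s (b ^ m) : (indSymb s : Symb k G n).H →* kˣ) = indChar s b ^ m := rfl

lemma indSymb_β (s : Symb k G' n) : (indSymb s : Symb k G n).β = s.β.map (indChar s) := rfl

/-- The essential point for the blowup relation: forming `Θ₂` commutes with induction, since both
orders produce the algebra coinduced from `K(t)` along `Z_{G'}(H) → Z_G(H̄)`. -/
lemma IsThetaTwo.induced {s t : Symb k G' n} {b₁ b₂ : s.H →* kˣ} {rest : List (s.H →* kˣ)}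
    (h : IsThetaTwo s b₁ b₂ rest t) :
    IsThetaTwo (indSymb s) (indChar s b₁) (indChar s b₂) (rest.map (indChar s))
      (indSymb t) := by
  obtain ⟨hH, ⟨τ, hτ, hind⟩, hβ⟩ := h
  have hle : t.H ≤ s.H := by
    rw [hH]
    exact Subgroup.map_subtype_le _
  have hle' : (indSymb t).H ≤ (indSymb s).H := Subgroup.map_mono hle
  refine ⟨?_, ?_, ?_⟩
  · ext x
    rw [← indChar_div]
    change x ∈ t.H.map G'.subtype ↔ _
    rw [hH]
    constructor
    · rintro ⟨_, ⟨y, hy, rfl⟩, rfl⟩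
      refine ⟨⟨_, y, y.2, rfl⟩, ?_, rfl⟩
      rw [SetLike.mem_coe, MonoidHom.mem_ker, indChar_apply _ y _ rfl]
      exact hy
    · rintro ⟨⟨_, y, hy, rfl⟩, hz, rfl⟩
      refine ⟨_, ⟨⟨y, hy⟩, ?_, rfl⟩, rfl⟩
      rw [SetLike.mem_coe, MonoidHom.mem_ker, indChar_apply _ ⟨y, hy⟩ _ rfl] at hz
      exact hz
  · obtain ⟨c, hc, hcb, rfl⟩ := exists_fracAction hτ
    obtain ⟨ev, hev⟩ := isCoind_indSymb s
    obtain ⟨m, ⟨T⟩⟩ := exists_transversal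
      (i := restrictHom G'.subtype _ _ (map_mem_centralizer s.H rfl))
      (restrictHom_injective G'.subtype_injective _)
    -- The extended cocycle lifts the transported character, since elements of `H` are central in
    -- the centralizer and act trivially.
    obtain ⟨C, hC, hCi, hCz⟩ := hev.exists_cocycle T hc
    refine ⟨fracAction (twist _ C hC), isLiftedAction_fracAction hC fun z hz => ?_, ?_⟩
    · obtain ⟨y, hy, hyz⟩ := id hz
      let p : Subgroup.centralizer (s.H : Set G') := ⟨y, fun x hx => s.comm x hx y hy⟩
      have hz' : z = restrictHom G'.subtype _ _ (map_mem_centralizer s.H rfl) p :=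
        Subtype.ext hyz.symm
      subst hz'
      rw [hCz p ((b₁ / b₂) ⟨y, hy⟩) (fun q => Subtype.ext (q.2 _ ⟨y, hy, rfl⟩).symm)
        (s.A.trivial_on p hy) (hcb p hy), ← indChar_div, indChar_apply _ ⟨y, hy⟩ _ rfl]
    · obtain ⟨e₁, h₁⟩ := (isInducedAlg_iff (centralizer_le hle)).mp hind
      obtain ⟨e₂, h₂⟩ := isCoind_indSymb t
      -- The ring `K(t)` of the induced symbol is coinduced from that of `s`. The coinduction in two
      -- steps through `t` therefore factors through it.
      have h₃ := (hev.polynomial hc T hC hCi).fracAction T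
      rw [isInducedAlg_iff (centralizer_le hle')]
      refine h₃.of_comp (evA := e₁.comp e₂) ?_
      exact h₁.trans h₂
  · refine List.Forall₂.imp ?_ (?_ : List.Forall₂
      (fun B B' => ∃ b b', B = indChar s b ∧ B' = indChar t b' ∧
        ∀ (h : s.H) (h' : t.H), (h' : G') = h → b' h' = b h) _ _)
    · rintro _ _ ⟨b, b', rfl, rfl, hb⟩ ⟨_, y, hy, rfl⟩ ⟨_, y', hy', rfl⟩ hh
      rw [indChar_apply _ ⟨y, hy⟩ _ rfl, indChar_apply _ ⟨y', hy'⟩ _ rfl]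
      exact hb _ _ (Subtype.ext hh)
    · change List.Forall₂ _ ((b₂ :: rest).map (indChar s)) (t.β.map (indChar t))
      rw [List.forall₂_map_left_iff, List.forall₂_map_right_iff]
      exact hβ.imp fun b b' hb => ⟨b, b', rfl, rfl, hb⟩

-- Each relation goes to a relation of the same type, as `indChar` is an isomorphism of groups and
-- thus preserves equalities, quotients and membership in cyclic subgroups.
open FreeAbelianGroup in
lemma lift_indSymb_eq_zero {x : FreeAbelianGroup (Symb k G' n)} (hx : IsRelator x) :
    FreeAbelianGroup.lift (fun s : Symb k G' n => (indSymb s : Symb k G n).cls) x = 0 := by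
  induction hx with
  | reorder s β h₁ h₂ h₃ hp =>
    rw [map_sub, lift_apply_of, lift_apply_of]
    exact (IsRelator.reorder (indSymb s) (β.map (indChar s))
      (indSymb (s.withChars β h₁ h₂ h₃)).ne_one (indSymb (s.withChars β h₁ h₂ h₃)).generate
      (indSymb (s.withChars β h₁ h₂ h₃)).length_add (hp.map _)).mk_eq_zero
  | conj g s t h =>
    rw [map_sub, lift_apply_of, lift_apply_of, sub_eq_zero]
    exact (h.induced (isInducedSymb_indSymb s) (isInducedSymb_indSymb t)).cls_eq
  | vanish s b₁ b₂ rest hβ h =>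
    rw [lift_apply_of]
    exact (IsRelator.vanish (indSymb s) (indChar s b₁) (indChar s b₂)
      (rest.map (indChar s)) (by rw [indSymb_β]; rw [hβ]; rfl)
      (by rw [← map_mul, h, map_one])).mk_eq_zero
  | blowup s b₁ b₂ rest hβ Θ₁ Θ₂ hΘ₁ hΘ₂ =>
    have hβ' : (indSymb s : Symb k G n).β = indChar s b₁ :: indChar s b₂ ::
        rest.map (indChar s) := by
      rw [indSymb_β]; rw [hβ]; rfl
    have h₁ : ∃ Θ₁' : FreeAbelianGroup (Symb k G n),
        lift (fun s : Symb k G' n => (indSymb s : Symb k G n).cls) Θ₁ = QuotientAddGroup.mk Θ₁' ∧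
        ((indChar s b₁ = indChar s b₂ ∧ Θ₁' = 0) ∨
        (indChar s b₁ ≠ indChar s b₂ ∧ ∃ h₁ h₂ h₃ h₁' h₂' h₃',
          Θ₁' = of ((indSymb s).withChars (indChar s b₁ ::
            (indChar s b₂ / indChar s b₁) :: rest.map (indChar s)) h₁ h₂ h₃) +
            of ((indSymb s).withChars (indChar s b₂ ::
              (indChar s b₁ / indChar s b₂) :: rest.map (indChar s)) h₁' h₂' h₃'))) := by
      rcases hΘ₁ with ⟨h, rfl⟩ | ⟨h, g₁, g₂, g₃, g₁', g₂', g₃', rfl⟩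
      · exact ⟨0, by simp, .inl ⟨by rw [h], rfl⟩⟩
      · refine ⟨of (indSymb (s.withChars _ g₁ g₂ g₃)) + of (indSymb (s.withChars _ g₁' g₂' g₃')),
          by rw [map_add, lift_apply_of, lift_apply_of]; rfl,
          .inr ⟨fun h' => h ((indChar s).injective h'), ?_⟩⟩
        rw [← indChar_div, ← indChar_div]
        exact ⟨_, _, _, _, _, _, rfl⟩
    have h₂ : ∃ Θ₂' : FreeAbelianGroup (Symb k G n),
        lift (fun s : Symb k G' n => (indSymb s : Symb k G n).cls) Θ₂ = QuotientAddGroup.mk Θ₂' ∧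
        (((∃ b ∈ (indSymb s).β, b ∈ Subgroup.zpowers (indChar s b₁ / indChar s b₂)) ∧
          Θ₂' = 0) ∨
        ((¬ ∃ b ∈ (indSymb s).β, b ∈ Subgroup.zpowers (indChar s b₁ / indChar s b₂)) ∧
          ∃ t, IsThetaTwo (indSymb s) (indChar s b₁) (indChar s b₂)
            (rest.map (indChar s)) t ∧ Θ₂' = of t)) := by
      have hiff : (∃ b ∈ (indSymb s : Symb k G n).β,
          b ∈ Subgroup.zpowers (indChar s b₁ / indChar s b₂)) ↔
          ∃ b ∈ s.β, b ∈ Subgroup.zpowers (b₁ / b₂) := by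
        rw [indSymb_β]
        simp only [List.mem_map, exists_exists_and_eq_and, ← indChar_div, Subgroup.mem_zpowers_iff,
          ← indChar_zpow, EmbeddingLike.apply_eq_iff_eq]
      rw [hiff]
      rcases hΘ₂ with ⟨h, rfl⟩ | ⟨h, t, ht, rfl⟩
      · exact ⟨0, by simp, .inl ⟨h, rfl⟩⟩
      · exact ⟨of (indSymb t), by rw [lift_apply_of]; rfl, .inr ⟨h, _, ht.induced, rfl⟩⟩
    obtain ⟨Θ₁', h₁, h₁'⟩ := h₁
    obtain ⟨Θ₂', h₂, h₂'⟩ := h₂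
    rw [map_sub, map_add, h₁, h₂, lift_apply_of]
    exact (IsRelator.blowup (indSymb s) _ _ _ hβ' Θ₁' Θ₂' h₁' h₂').mk_eq_zero

/-- The induction homomorphism. -/
def indHom (k : Type u) [Field k] (G' : Subgroup G) (n : ℕ) : Burn k G' n →+ Burn k G n :=
  burnLift (fun s => (indSymb s).cls) fun _ => lift_indSymb_eq_zero

lemma indHom_cls (s : Symb k G' n) : indHom k G' n s.cls = (indSymb s).cls :=
  burnLift_cls _ _ s

lemma isInductionHom_indHom : IsInductionHom (indHom k G' n) := fun s =>
  ⟨⟨_, isInducedSymb_indSymb s⟩, fun _ ht =>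
    (indHom_cls s).trans ((isInducedSymb_indSymb s).cls_eq ht)⟩

lemma IsInductionHom.eq_indHom {f : Burn k G' n →+ Burn k G n} (h : IsInductionHom f) :
    f = indHom k G' n :=
  burn_hom_ext fun s => by rw [(h s).2 _ (isInducedSymb_indSymb s), indHom_cls]

end Induction

/-! ## Hilbert's theorem 90 for Galois algebras -/

section Hilbert90

open TensorProduct

variable {k : Type u} [Field k] {P : Type v} [Group P] {A : Type u} [CommRing A] [Algebra k A]

/-- Linear independence of characters, for families with repetitions. -/
lemma sum_single_eq_zero {M Ω ι : Type*} [Monoid M] [Field Ω] [Fintype ι] (χ : ι → M →* Ω)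
    (a : ι → Ω) (h : ∀ x, ∑ i, a i * χ i x = 0) : ∑ i, Finsupp.single (χ i) (a i) = 0 := by
  refine linearIndependent_iff.mp (linearIndependent_monoidHom M Ω) _ (funext fun x => ?_)
  rw [map_sum, Finset.sum_apply]
  simpa using h x

variable (ρ : P →* (A ≃ₐ[k] A))

/-- The action on the homomorphisms from `A` to an algebra over the invariants. -/
def precomp {Ω : Type*} [CommRing Ω] [Algebra (invariants ρ) Ω] (f : A →ₐ[invariants ρ] Ω) (p : P) :
    A →ₐ[invariants ρ] Ω :=
  { f.toRingHom.comp (ρ p).toRingEquiv.toRingHom with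
    commutes' := fun x => by
      have : ρ p (x : A) = x := x.2 p
      exact (congrArg f this).trans (f.commutes x) }

@[simp] lemma precomp_apply {Ω : Type*} [CommRing Ω] [Algebra (invariants ρ) Ω]
    (f : A →ₐ[invariants ρ] Ω) (p : P) (a : A) : precomp ρ f p a = f (ρ p a) := rfl

variable {Ω : Type u} [Field Ω] [Algebra (invariants ρ) Ω]

/-- The trace `∑ ρ p x` is invariant, so `f` and `g` agree on it, and `∑ f ∘ ρ p = ∑ g ∘ ρ p`. If
`g` were not among the `f ∘ ρ p`, this would contradict independence of characters. -/
lemma exists_precomp_eq [Finite P] [CharZero Ω] (f g : A →ₐ[invariants ρ] Ω) :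
    ∃ p, precomp ρ f p = g := by
  classical
  have := Fintype.ofFinite P
  by_contra! hne
  let χ : P ⊕ P → A →* Ω := Sum.elim (fun p => precomp ρ f p) (fun p => precomp ρ g p)
  have htr : ∀ (h : A →ₐ[invariants ρ] Ω) (x : A), ∑ p, precomp ρ h p x =
      algebraMap (invariants ρ) Ω ⟨∑ p, ρ p x, fun q => by
        rw [map_sum, ← Equiv.sum_comp (Equiv.mulLeft q) (fun p => ρ p x)]
        simp⟩ := fun h x => by
    rw [← h.commutes]
    change _ = h (∑ p, ρ p x)
    simp
  have := sum_single_eq_zero χ (Sum.elim (fun _ => 1) fun _ => -1) fun x => by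
    rw [Fintype.sum_sum_type]
    have h₁ := htr f x
    have h₂ := htr g x
    simp only [Sum.elim_inl, Sum.elim_inr, one_mul, neg_mul, Finset.sum_neg_distrib, χ]
    rw [add_neg_eq_zero]
    exact h₁.trans h₂.symm
  have h₁ := DFunLike.congr_fun this (g : A →* Ω)
  rw [Finsupp.finsetSum_apply, Fintype.sum_sum_type, Finset.sum_eq_zero, zero_add] at h₁
  -- The coefficient of `g` is minus the number of `p` with `g ∘ ρ p = g`. This is nonzero in
  -- characteristic zero, because `p = 1` is counted.
  · simp only [Sum.elim_inr, χ, Finsupp.single_apply, Finsupp.coe_zero, Pi.zero_apply] at h₁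
    rw [Finset.sum_ite, Finset.sum_const_zero, add_zero, Finset.sum_const, nsmul_eq_mul, mul_neg,
      mul_one, neg_eq_zero, Nat.cast_eq_zero, Finset.card_eq_zero] at h₁
    have : (1 : P) ∈ (∅ : Finset P) := by
      rw [← h₁]
      simp only [Finset.mem_filter, Finset.mem_univ, true_and]
      ext x
      simp
    simp at this
  · intro p _
    simp only [Sum.elim_inl, χ]
    rw [Finsupp.single_apply, if_neg]
    intro h
    exact hne p (AlgHom.ext fun x => DFunLike.congr_fun h x)

/-- Over a separably closed field an étale algebra splits as a product of copies of the field. The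
projections of `Ω ⊗ A`, restricted to `A`, are the required homomorphisms. -/
lemma exists_injective_algHom {K₀ : Type u} [Field K₀] [Algebra K₀ A] [Algebra.Etale K₀ A]
    (Ω : Type u) [Field Ω] [Algebra K₀ Ω] [IsSepClosed Ω] :
    ∃ (ι : Type u) (_ : Finite ι) (φ : ι → A →ₐ[K₀] Ω), Function.Injective φ ∧
      Nat.card ι = Module.finrank K₀ A := by
  classical
  let B := Ω ⊗[K₀] A
  let e := Algebra.FormallyEtale.equivPiOfIsSepClosed Ω B
  have := moduleFinite_of_etale (A := A) (Field.toIsField K₀)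
  have hfin : Module.Finite Ω (PrimeSpectrum B → Ω) := Module.Finite.equiv e.toLinearEquiv
  have hι : Finite (PrimeSpectrum B) := by
    have := Algebra.FormallyUnramified.finite_of_free Ω B
    have : IsArtinianRing B := isArtinian_of_tower Ω inferInstance
    infer_instance
  refine ⟨PrimeSpectrum B, hι, fun x =>
    ((Pi.evalAlgHom Ω (fun _ => Ω) x).comp e.toAlgHom).restrictScalars K₀ |>.comp
      Algebra.TensorProduct.includeRight, fun x y hxy => ?_, ?_⟩
  · have h₁ : (Pi.evalAlgHom Ω (fun _ => Ω) x).comp e.toAlgHom =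
        (Pi.evalAlgHom Ω (fun _ => Ω) y).comp e.toAlgHom :=
      Algebra.TensorProduct.ext (by ext) (AlgHom.ext fun a => DFunLike.congr_fun hxy a)
    have h₂ := DFunLike.congr_fun h₁ (e.symm (Pi.single x 1))
    by_contra hne
    simp [Ne.symm hne] at h₂
  · have := Fintype.ofFinite (PrimeSpectrum B)
    have h₁ := e.toLinearEquiv.finrank_eq
    rw [Module.finrank_fintype_fun_eq_card, Module.finrank_baseChange] at h₁
    rw [Nat.card_eq_fintype_card, h₁]

variable {ρ}

/-- A count: by transitivity `P ⧸ N` maps onto the set of homomorphisms `A → Ω`, which has at least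
rank-many elements, and the rank is the order of `P ⧸ N`. So the map is bijective, and stabilizers
lie in `N`. -/
lemma mem_of_precomp_eq [Finite P] [CharZero Ω] [IsSepClosed Ω] (hf : IsField (invariants ρ))
    [Algebra.Etale (invariants ρ) A] {N : Subgroup P} (hN : ∀ z ∈ N, ρ z = 1)
    (hrank : Module.finrank (invariants ρ) A * Nat.card N = Nat.card P) (f : A →ₐ[invariants ρ] Ω)
    {p : P} (hp : precomp ρ f p = f) : p ∈ N := by
  let s : P ⧸ N → A →ₐ[invariants ρ] Ω := Quotient.lift (precomp ρ f) fun a b hab => by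
    obtain ⟨z, hz, rfl⟩ : ∃ z ∈ N, b = a * z :=
      ⟨a⁻¹ * b, QuotientGroup.leftRel_apply.mp hab, by group⟩
    ext x
    simp [hN z hz]
  have hs : Function.Surjective s := fun g => by
    obtain ⟨q, hq⟩ := exists_precomp_eq ρ f g
    exact ⟨(q : P ⧸ N), hq⟩
  have : Finite (A →ₐ[invariants ρ] Ω) := Finite.of_surjective s hs
  have hcard : Nat.card (P ⧸ N) ≤ Nat.card (A →ₐ[invariants ρ] Ω) := by
    let := hf.toField
    obtain ⟨ι, _, φ, hφ, hι⟩ := exists_injective_algHom (A := A) (K₀ := invariants ρ) Ω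
    refine le_trans (le_of_eq ?_) (Nat.card_le_card_of_injective φ hφ)
    rw [hι]
    have := N.card_eq_card_quotient_mul_card_subgroup
    rw [← hrank] at this
    exact (Nat.eq_of_mul_eq_mul_right Nat.card_pos this).symm
  have h₁ := (hs.bijective_of_nat_card_le hcard).1
    (a₁ := (p : P ⧸ N)) (a₂ := ((1 : P) : P ⧸ N)) (by
      change precomp ρ f p = precomp ρ f 1
      rw [hp]; ext; simp)
  simpa using QuotientGroup.eq.mp h₁.symm

/-- Hilbert's theorem 90 for Galois algebras. -/
lemma exists_unit_of_isCocycle [CharZero k] [Finite P] (hf : IsField (invariants ρ))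
    [Algebra.Etale (invariants ρ) A] {N : Subgroup P} (hN : ∀ z ∈ N, ρ z = 1)
    (hrank : Module.finrank (invariants ρ) A * Nat.card N = Nat.card P) {c : P → Aˣ}
    (hc : IsCocycle ρ c) (hcN : ∀ z ∈ N, c z = 1) : ∃ u : Aˣ, ∀ p, (c p : A) * ρ p u = u := by
  classical
  let := hf.toField
  have := Fintype.ofFinite P
  have : CharZero (invariants ρ) := charZero_of_injective_algebraMap (algebraMap k (invariants ρ)).injective
  let Ω := AlgebraicClosure (invariants ρ)
  have : CharZero Ω := charZero_of_injective_algebraMap (algebraMap (invariants ρ) Ω).injective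
  -- A nonunit lies in a maximal ideal, whose residue field is finite over the field of invariants
  -- and hence embeds in `Ω`.
  have hunit : ∀ y : A, (∀ g : A →ₐ[invariants ρ] Ω, g y ≠ 0) → IsUnit y := by
    intro y hy
    by_contra hu
    obtain ⟨M, hM, hyM⟩ := exists_max_ideal_of_mem_nonunits hu
    let := Ideal.Quotient.field M
    have := moduleFinite_of_etale (A := A) hf
    refine hy ((IsAlgClosed.lift : (A ⧸ M) →ₐ[invariants ρ] Ω).comp (Ideal.Quotient.mkₐ _ M)) ?_
    simp [Ideal.Quotient.eq_zero_iff_mem.mpr hyM]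
  -- If there are no homomorphisms to `Ω`, then `0` is a unit by `hunit`, and `A` is the zero ring.
  by_cases hne : Nonempty (A →ₐ[invariants ρ] Ω)
  swap
  · have := hunit 0 fun g => (hne ⟨g⟩).elim
    have := isUnit_zero_iff.mp this
    exact ⟨1, fun p => eq_of_zero_eq_one this _ _⟩
  obtain ⟨f⟩ := hne
  -- Independence of characters applies to `∑ f(c p) (f ∘ ρ p)`. Only `p ∈ N` contribute to the
  -- coefficient of `f`; there `c p = 1`, so this coefficient is the order of `N`.
  obtain ⟨x, hx⟩ : ∃ x, f (∑ p, c p * ρ p x) ≠ 0 := by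
    by_contra! h0
    have := sum_single_eq_zero (fun p => (precomp ρ f p : A →* Ω)) (fun p => f (c p)) fun x => by
      rw [← h0 x]
      simp
    have h₁ := DFunLike.congr_fun this (f : A →* Ω)
    rw [Finsupp.finsetSum_apply] at h₁
    simp only [Finsupp.single_apply, Finsupp.coe_zero, Pi.zero_apply] at h₁
    have hiff : ∀ p, (precomp ρ f p : A →* Ω) = f ↔ p ∈ N := fun p => by
      refine ⟨fun h => mem_of_precomp_eq hf hN hrank f
        (AlgHom.ext fun x => DFunLike.congr_fun h x), fun h => ?_⟩
      ext x
      simp [hN p h]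
    simp only [hiff] at h₁
    rw [Finset.sum_ite, Finset.sum_const_zero, add_zero, Finset.sum_congr rfl (g := fun _ => 1)
      (fun p hp => by rw [hcN p (Finset.mem_filter.mp hp).2]; simp), Finset.sum_const,
      nsmul_eq_mul, mul_one, Nat.cast_eq_zero, Finset.card_eq_zero] at h₁
    have : (1 : P) ∈ (∅ : Finset P) := by
      rw [← h₁]
      simp [N.one_mem]
    simp at this
  have hy : ∀ q, (c q : A) * ρ q (∑ p, c p * ρ p x) = ∑ p, c p * ρ p x := fun q => by
    rw [map_sum, Finset.mul_sum, ← Equiv.sum_comp (Equiv.mulLeft q) (fun p => (c p : A) * ρ p x)]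
    refine Finset.sum_congr rfl fun p _ => ?_
    simp [hc q p, mul_assoc]
  -- Every `g` has the form `f ∘ ρ q`, so the relation `hy` turns a zero at `g` into a zero at `f`.
  obtain ⟨u, hu⟩ := hunit _ fun g hg => by
    obtain ⟨q, rfl⟩ := exists_precomp_eq ρ f g
    refine hx ?_
    rw [← hy q, map_mul]
    rw [precomp_apply] at hg
    rw [hg, mul_zero]
  exact ⟨u, fun p => by rw [hu, hy]⟩

end Hilbert90

/-! ## Invariants of twisted actions -/

section TwistInvariants

open Polynomial

variable {k : Type u} [Field k] {P : Type v} [Group P] {A : Type u} [CommRing A] [Algebra k A]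
  {ρ : P →* (A ≃ₐ[k] A)} {c : P → Aˣ} (hc : IsCocycle ρ c)

/-- The homomorphism of polynomial rings which maps the variable `Y` to `u X ^ m`. -/
def subst (R : Subalgebra k A) (u : A) (m : ℕ) : R[X] →ₐ[k] A[X] :=
  ((aeval (C u * X ^ m) : A[X] →ₐ[A] A[X]).restrictScalars k).comp (mapAlgHom R.val)

lemma subst_eq_expand (R : Subalgebra k A) (u : A) (m : ℕ) (f : R[X]) :
    subst R u m f = expand A m ((f.map (R.val : R →+* A)).comp (C u * X)) := by
  change aeval _ (f.map (R.val : R →+* A)) = _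
  induction (f.map (R.val : R →+* A)) using Polynomial.induction_on' with
  | add f g hf hg => simp [hf, hg]
  | monomial n a =>
    rw [aeval_monomial, monomial_comp, map_mul, expand_C, map_pow, map_mul, expand_C, expand_X]
    rfl

lemma coeff_subst_mul (R : Subalgebra k A) (u : A) {m : ℕ} (hm : 0 < m) (f : R[X]) (j : ℕ) :
    (subst R u m f).coeff (j * m) = f.coeff j * u ^ j := by
  rw [subst_eq_expand, coeff_expand_mul hm, comp_C_mul_X_coeff, coeff_map]
  rfl

lemma coeff_subst_of_not_dvd (R : Subalgebra k A) (u : A) {m : ℕ} (hm : 0 < m) (f : R[X]) {i : ℕ}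
    (hi : ¬ m ∣ i) : (subst R u m f).coeff i = 0 := by
  rw [subst_eq_expand, coeff_expand hm, if_neg hi]

/-- Although `A` may have zero divisors, the leading coefficient is a unit: it is a nonzero element
of the field `R` times a power of `u`. -/
lemma subst_mem_nonZeroDivisors (R : Subalgebra k A) (hR : IsField R) (u : Aˣ) {m : ℕ} (hm : 0 < m)
    {f : R[X]} (hf : f ≠ 0) : subst R (u : A) m f ∈ nonZeroDivisors A[X] := by
  have hlc : IsUnit (f.leadingCoeff : A) := by
    obtain ⟨b, hb⟩ := hR.mul_inv_cancel (leadingCoeff_ne_zero.mpr hf)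
    exact IsUnit.of_mul_eq_one (b : A) (congrArg Subtype.val hb)
  have hu : IsUnit ((subst R (u : A) m f).coeff (f.natDegree * m)) := by
    rw [coeff_subst_mul R _ hm]
    exact hlc.mul (u.isUnit.pow _)
  have hd : (subst R (u : A) m f).natDegree ≤ f.natDegree * m := by
    rw [subst_eq_expand, natDegree_expand]
    refine Nat.mul_le_mul_right _ (natDegree_comp_le.trans ?_)
    refine (Nat.mul_le_mul natDegree_map_le ((natDegree_C_mul_le _ _).trans natDegree_X_le)).trans_eq (mul_one _)
  rcases subsingleton_or_nontrivial A with h | h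
  · exact mem_nonZeroDivisors_iff_right.mpr fun x _ => Subsingleton.elim x 0
  refine mem_nonZeroDivisors_of_leadingCoeff ?_
  rw [leadingCoeff, le_antisymm hd (le_natDegree_of_ne_zero hu.ne_zero)]
  exact hu.mem_nonZeroDivisors

/-- The group `N` acts in degree `i` by the scalars `b^i`, so an invariant polynomial has terms only
in degrees divisible by `m`. In degree `j * m`, multiplication of the coefficient by `u⁻¹ ^ j`
compensates the cocycle and makes it invariant. -/
lemma mem_range_subst {N : Subgroup P} (hN : ∀ z ∈ N, ρ z = 1) {b : N →* kˣ}
    (hb : ∀ z : N, (c z : A) = algebraMap k A (b z)) {m : ℕ} (hm : 0 < m)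
    (hbm : ∀ i, b ^ i = 1 → m ∣ i) {u : Aˣ} (hu : ∀ p, (c p : A) ^ m * ρ p u = u)
    {F : A[X]} (hF : ∀ p, twist ρ c hc p F = F) :
    ∃ f, subst (invariants ρ) (u : A) m f = F := by
  have h₁ : ∀ i, ¬ m ∣ i → F.coeff i = 0 := fun i hi => by
    have : b ^ i ≠ 1 := fun h => hi (hbm i h)
    obtain ⟨z, hz⟩ : ∃ z, b z ^ i ≠ 1 := by
      by_contra! h
      exact this (MonoidHom.ext h)
    have h := congrArg (fun f => coeff f i) (hF z)
    simp only [coeff_twist, hN z z.2, AlgEquiv.one_apply, hb] at h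
    have h2 : algebraMap k A ((b z : k) ^ i - 1) * F.coeff i = 0 := by
      rw [map_sub, map_one, sub_mul, map_pow, mul_comm, h, one_mul, sub_self]
    rw [← Algebra.smul_def] at h2
    refine (smul_eq_zero.mp h2).resolve_left fun h3 => hz ?_
    ext
    simpa [sub_eq_zero] using h3
  have h₂ : ∀ j, ∀ p, ρ p (F.coeff (j * m) * ((u⁻¹ ^ j : Aˣ) : A)) =
      F.coeff (j * m) * ((u⁻¹ ^ j : Aˣ) : A) := fun j p => by
    have h := congrArg (fun f => coeff f (j * m)) (hF p)
    simp only [coeff_twist] at h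
    refine (u ^ j).isUnit.mul_left_injective ?_
    simp only
    rw [mul_assoc, ← Units.val_mul, ← mul_pow, inv_mul_cancel, one_pow, Units.val_one, mul_one]
    have h3 : ((u ^ j : Aˣ) : A) = ((c p : A) ^ m) ^ j * ρ p ((u ^ j : Aˣ) : A) := by
      rw [Units.val_pow_eq_pow_val, map_pow, ← mul_pow, hu]
    have h4 : ρ p ((u⁻¹ ^ j : Aˣ) : A) * ρ p ((u ^ j : Aˣ) : A) = 1 := by
      rw [← map_mul, ← Units.val_mul, ← mul_pow, inv_mul_cancel, one_pow, Units.val_one, map_one]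
    rw [map_mul]
    linear_combination (ρ p (F.coeff (j * m)) * ρ p ((u⁻¹ ^ j : Aˣ) : A)) * h3 +
      (ρ p (F.coeff (j * m)) * ((c p : A) ^ m) ^ j) * h4 + h
  let N' := F.natDegree + 1
  refine ⟨∑ j ∈ Finset.range N', monomial j ⟨_, h₂ j⟩, ?_⟩
  ext i
  by_cases hi : m ∣ i
  · obtain ⟨j, rfl⟩ := hi
    rw [mul_comm m j, coeff_subst_mul _ _ hm, finsetSum_coeff]
    simp only [coeff_monomial, Finset.sum_ite_eq', Finset.mem_range]
    split_ifs with hj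
    · rw [mul_assoc, ← Units.val_pow_eq_pow_val, ← Units.val_mul, ← mul_pow]
      simp
    · rw [coeff_eq_zero_of_natDegree_lt]
      · simp
      · have : j ≤ j * m := Nat.le_mul_of_pos_right j hm
        omega
  · rw [coeff_subst_of_not_dvd _ _ hm _ hi, h₁ i hi]

lemma twist_subst {m : ℕ} (hm : 0 < m) {u : Aˣ} (hu : ∀ p, (c p : A) ^ m * ρ p u = u) (p : P)
    (f : (invariants ρ)[X]) :
    twist ρ c hc p (subst (invariants ρ) (u : A) m f) = subst (invariants ρ) (u : A) m f := by
  ext i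
  rw [coeff_twist]
  by_cases hi : m ∣ i
  · obtain ⟨j, rfl⟩ := hi
    rw [mul_comm m j, coeff_subst_mul _ _ hm, map_mul, map_pow, (f.coeff j).2 p]
    conv_rhs => rw [← hu p]
    ring
  · rw [coeff_subst_of_not_dvd _ _ hm _ hi, map_zero, zero_mul]

-- The denominator is replaced by its norm, the product of its translates. The numerator is then
-- invariant, as the product of `y` with an invariant element.
open Classical in
lemma exists_invariant_mk' [Finite P] {B : Type u} [CommRing B] [Algebra k B] (σ : P →* (B ≃ₐ[k] B))
    {y : FractionRing B} (hy : ∀ p, fracAction σ p y = y) :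
    ∃ (N : B) (D : nonZeroDivisors B), (∀ p, σ p N = N) ∧ (∀ p, σ p D = D) ∧
      IsLocalization.mk' (FractionRing B) N D = y := by
  have := Fintype.ofFinite P
  obtain ⟨a, d, rfl⟩ := IsLocalization.exists_mk'_eq (nonZeroDivisors B) y
  let D : B := ∏ p, σ p d
  have hD : D ∈ nonZeroDivisors B := prod_mem fun p _ => by
    rw [mem_nonZeroDivisors_iff_right]
    intro x hx
    have h := congrArg (σ p).symm hx
    rw [map_mul, AlgEquiv.symm_apply_apply, map_zero] at h
    simpa using mem_nonZeroDivisors_iff_right.mp d.2 _ h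
  have hDi : ∀ p, σ p D = D := fun p => by
    rw [map_prod]
    refine Fintype.prod_bijective (p * ·) (Group.mulLeft_bijective p) _ _ fun q => ?_
    rw [map_mul]
    rfl
  have hDd : D = (∏ p ∈ Finset.univ.erase 1, σ p d) * d := by
    refine (Finset.prod_erase_mul _ (fun p => σ p (d : B)) (Finset.mem_univ 1)).symm.trans ?_
    rw [map_one]
    rfl
  have hmk : IsLocalization.mk' (FractionRing B) (a * ∏ p ∈ Finset.univ.erase 1, σ p d) ⟨D, hD⟩ =
      IsLocalization.mk' (FractionRing B) a d := by
    rw [IsLocalization.mk'_eq_iff_eq]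
    simp only [hDd]
    congr 1
    ring
  refine ⟨a * ∏ p ∈ Finset.univ.erase 1, σ p d, ⟨D, hD⟩, fun p => ?_, hDi, hmk⟩
  refine IsFractionRing.injective B (FractionRing B) ?_
  rw [← fracAction_algebraMap, ← IsLocalization.mk'_spec (FractionRing B) _ ⟨D, hD⟩, map_mul, hmk,
    hy, fracAction_algebraMap, hDi]

/-- This is `K(t)^Z = K₀(u t^m)`: numerator and denominator of an invariant fraction can be taken
invariant, and are then polynomials in `u t^m` over `K₀`. -/
lemma exists_invariants_equiv_fractionRing [Finite P] (hf : IsField (invariants ρ)) {N : Subgroup P}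
    (hN : ∀ z ∈ N, ρ z = 1) {b : N →* kˣ}
    (hb : ∀ z : N, (c z : A) = algebraMap k A (b z)) {m : ℕ} (hm : 0 < m)
    (hbm : ∀ i, b ^ i = 1 → m ∣ i) {u : Aˣ} (hu : ∀ p, (c p : A) ^ m * ρ p u = u) :
    Nonempty (invariants (fracAction (twist ρ c hc)) ≃ₐ[k]
      FractionRing (Polynomial (invariants ρ))) := by
  have := hf.isDomain
  have : Nontrivial A := (Subtype.val_injective (p := (· ∈ invariants ρ))).nontrivial
  let φ₀ : FractionRing (invariants ρ)[X] →ₐ[k] FractionRing A[X] :=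
    IsLocalization.liftAlgHom (M := nonZeroDivisors (invariants ρ)[X])
      (f := (IsScalarTower.toAlgHom k A[X] (FractionRing A[X])).comp
        (subst (invariants ρ) (u : A) m))
      fun y => IsLocalization.map_units (M := nonZeroDivisors A[X]) (FractionRing A[X])
        ⟨_, subst_mem_nonZeroDivisors _ hf u hm (nonZeroDivisors.ne_zero y.2)⟩
  have hφ₀ : ∀ f, φ₀ (algebraMap _ _ f) = algebraMap _ _ (subst (invariants ρ) (u : A) m f) :=
    fun f => IsLocalization.lift_eq _ _
  have hinv : ∀ x, φ₀ x ∈ invariants (fracAction (twist ρ c hc)) := fun x p => by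
    refine DFunLike.congr_fun (fractionRing_algHom_ext
      (f := (fracAction (twist ρ c hc) p).toAlgHom.comp φ₀) (g := φ₀) fun a => ?_) x
    change fracAction (twist ρ c hc) p (φ₀ _) = φ₀ _
    rw [hφ₀, fracAction_algebraMap, twist_subst hc hm hu]
  let φ := φ₀.codRestrict _ hinv
  refine ⟨(AlgEquiv.ofBijective φ ⟨?_, fun y => ?_⟩).symm⟩
  · refine (injective_iff_map_eq_zero φ).mpr fun z hz => ?_
    obtain ⟨f, s, rfl⟩ := IsLocalization.exists_mk'_eq (nonZeroDivisors (invariants ρ)[X]) z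
    have h0 : φ₀ (algebraMap _ _ f) = 0 := by
      rw [← IsLocalization.mk'_spec (FractionRing (invariants ρ)[X]) f s, map_mul,
        show φ₀ (IsLocalization.mk' _ f s) = 0 from congrArg Subtype.val hz, zero_mul]
    rw [hφ₀, map_eq_zero_iff _ (IsFractionRing.injective _ _)] at h0
    by_cases hf0 : f = 0
    · rw [hf0, IsLocalization.mk'_zero]
    · exact absurd h0 (nonZeroDivisors.ne_zero (subst_mem_nonZeroDivisors _ hf u hm hf0))
  · obtain ⟨F, D, hF, hD, hy⟩ := exists_invariant_mk' (twist ρ c hc) y.2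
    obtain ⟨f, rfl⟩ := mem_range_subst hc hN hb hm hbm hu hF
    obtain ⟨d, hd⟩ := mem_range_subst hc hN hb hm hbm hu hD
    have hd0 : d ≠ 0 := by
      rintro rfl
      exact nonZeroDivisors.ne_zero D.2 (by rw [← hd, map_zero])
    refine ⟨IsLocalization.mk' _ f ⟨d, mem_nonZeroDivisors_of_ne_zero hd0⟩, Subtype.ext ?_⟩
    change φ₀ _ = _
    rw [← hy, IsLocalization.eq_mk'_iff_mul_eq, ← hd, ← hφ₀, ← map_mul, ← hφ₀]
    congr 1
    exact IsLocalization.mk'_spec (FractionRing (invariants ρ)[X]) f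
      ⟨d, mem_nonZeroDivisors_of_ne_zero hd0⟩

end TwistInvariants

/-! ## The homomorphism to the Burnside group of orbifolds -/

section Characters

variable {k : Type u} [Field k] {G : Type v} [Group G] [Finite G]

/-- The image of `b`, a finite group of units of a field, is cyclic with a generator `b g`. As `χ g`
is a root of unity of order dividing that of `b g`, it equals some `b g ^ i`, and `χ = b ^ i`
because `χ` factors through `b`. -/
lemma mem_zpowers_of_ker_le {b χ : G →* kˣ} (h : b.ker ≤ χ.ker) : χ ∈ Subgroup.zpowers b := by
  have : Finite b.range := Finite.of_surjective _ b.rangeRestrict_surjective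
  obtain ⟨⟨_, g, rfl⟩, hg⟩ := (inferInstance : IsCyclic b.range).exists_generator
  have hg' : ∀ x, ∃ j : ℤ, b x = b g ^ j := fun x => by
    obtain ⟨j, hj⟩ := Subgroup.mem_zpowers_iff.mp (hg ⟨b x, x, rfl⟩)
    exact ⟨j, (congrArg Subtype.val hj).symm⟩
  have hfin : IsOfFinOrder (b g) := b.isOfFinOrder (isOfFinOrder_of_finite g)
  have hr : χ g ^ orderOf (b g) = 1 := by
    rw [← map_pow]
    exact h (by rw [MonoidHom.mem_ker, map_pow, pow_orderOf_eq_one])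
  have : NeZero (orderOf (b g)) := ⟨hfin.orderOf_pos.ne'⟩
  obtain ⟨i, -, hi⟩ := (IsPrimitiveRoot.coe_units_iff.mpr
    (IsPrimitiveRoot.orderOf (b g))).eq_pow_of_pow_eq_one (ξ := (χ g : k)) (by rw [← Units.val_pow_eq_pow_val, hr, Units.val_one])
  have hi' : b g ^ i = χ g := Units.ext (by exact_mod_cast hi)
  refine Subgroup.mem_zpowers_iff.mpr ⟨i, MonoidHom.ext fun x => ?_⟩
  obtain ⟨j, hj⟩ := hg' x
  have hx : x * (g ^ j)⁻¹ ∈ χ.ker := h <| by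
    rw [MonoidHom.mem_ker, map_mul, map_inv, map_zpow, hj, mul_inv_cancel]
  rw [MonoidHom.mem_ker, map_mul, map_inv, map_zpow, mul_inv_eq_one] at hx
  change b x ^ (i : ℤ) = χ x
  rw [hx, hj, ← hi', ← zpow_natCast, ← zpow_mul, ← zpow_mul, mul_comm]

/-- Restriction of characters to a smaller subgroup. -/
def resChar {L H : Subgroup G} (h : L ≤ H) : (H →* kˣ) →* (L →* kˣ) where
  toFun χ := χ.comp (Subgroup.inclusion h)
  map_one' := rfl
  map_mul' _ _ := rfl

/-- Characters extend from subgroups of a finite abelian group once `k` has the roots of unity of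
order its exponent. The exponent of `H` divides the order of `G`. -/
lemma resChar_surjective (hk : ∃ ζ : k, IsPrimitiveRoot ζ (Nat.card G)) {L H : Subgroup G}
    (h : L ≤ H) (hH : ∀ a ∈ H, ∀ b ∈ H, a * b = b * a) :
    Function.Surjective (resChar h : (H →* kˣ) →* (L →* kˣ)) := fun χ => by
  let : CommGroup H :=
    { (inferInstance : Group H) with mul_comm := fun a b => Subtype.ext (hH a a.2 b b.2) }
  have : NeZero (Nat.card G) := ⟨Nat.card_pos.ne'⟩
  have : HasEnoughRootsOfUnity k (Nat.card G) := ⟨hk, inferInstance⟩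
  have : NeZero (Monoid.exponent H) := ⟨Monoid.exponent_ne_zero_of_finite⟩
  have : HasEnoughRootsOfUnity k (Monoid.exponent H) := .of_dvd k
    (Group.exponent_dvd_nat_card.trans H.card_subgroup_dvd_card)
  obtain ⟨ψ, hψ⟩ := MonoidHom.domRestrict_surjective k (L.subgroupOf H)
    (χ.comp (Subgroup.subgroupOfEquivOfLe h).toMonoidHom)
  refine ⟨ψ, MonoidHom.ext fun x => ?_⟩
  exact DFunLike.congr_fun hψ ((Subgroup.subgroupOfEquivOfLe h).symm x)

lemma ker_resChar {L H : Subgroup G} (b : H →* kˣ) (hL : L = b.ker.map H.subtype) (h : L ≤ H) :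
    (resChar h : (H →* kˣ) →* (L →* kˣ)).ker = Subgroup.zpowers b := by
  ext χ
  refine ⟨fun hχ => mem_zpowers_of_ker_le fun x hx => ?_, fun hχ => ?_⟩
  · exact DFunLike.congr_fun (MonoidHom.mem_ker.mp hχ) ⟨x, by rw [hL]; exact ⟨x, hx, rfl⟩⟩
  · obtain ⟨i, rfl⟩ := Subgroup.mem_zpowers_iff.mp hχ
    refine MonoidHom.mem_ker.mpr (MonoidHom.ext fun x => ?_)
    obtain ⟨y, hy, hyx⟩ : (x : G) ∈ b.ker.map H.subtype := hL ▸ x.2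
    have : Subgroup.inclusion h x = y := Subtype.ext hyx.symm
    change b (Subgroup.inclusion h x) ^ i = 1
    rw [this, MonoidHom.mem_ker.mp hy, one_zpow]

instance (H : Subgroup G) : Finite (H →* kˣ) := by
  have : NeZero (Nat.card H) := ⟨Nat.card_pos.ne'⟩
  let f : (H →* kˣ) → (H → rootsOfUnity (Nat.card H) k) := fun χ h =>
    ⟨χ h, by rw [mem_rootsOfUnity, ← map_pow, pow_card_eq_one', map_one]⟩
  refine Finite.of_injective f fun χ ψ h => MonoidHom.ext fun x => ?_
  exact congrArg Subtype.val (congrFun h x)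

end Characters

/-! ### The map on symbols and its compatibility with the relations -/

section Kappa

variable {k : Type u} [Field k] {G : Type v} [Group G] [Finite G] {n : ℕ}

/-- The character group of the subgroup of a symbol, written additively, in the universe of
the field. -/
def dualEquiv (s : Symb k G n) :
    Additive (s.H →* kˣ) ≃+ Shrink.{u} (Additive (s.H →* kˣ)) :=
  Shrink.addEquiv.symm

/-- The generator `(K^Z, β)` of the Burnside group of orbifolds. -/
def orbSymb (s : Symb k G n) : OrbSymb k n :=
  letI := s.A.isField.toField
  { K := invariants s.A.ρ
    d := s.d
    fg := s.A.fg
    trdeg := s.A.trdeg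
    A := Shrink.{u} (Additive (s.H →* kˣ))
    finite := Finite.of_equiv (Additive (s.H →* kˣ)) (dualEquiv s).toEquiv
    a := s.β.map fun b => dualEquiv s (Additive.ofMul b)
    ne_zero := fun x hx => by
      obtain ⟨b, hb, rfl⟩ := List.mem_map.mp hx
      exact (map_ne_zero_iff (dualEquiv s) (dualEquiv s).injective).mpr (s.ne_one b hb)
    generate := by
      let S : Subgroup (s.H →* kˣ) := AddSubgroup.toSubgroup' ((AddSubgroup.closure
        {x | x ∈ s.β.map fun b => dualEquiv s (Additive.ofMul b)}).comap
          (dualEquiv s).toAddMonoidHom)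
      have hS : S = ⊤ := by
        rw [eq_top_iff, ← s.generate]
        refine (Subgroup.closure_le S).mpr fun b hb => ?_
        exact AddSubgroup.subset_closure (List.mem_map.mpr ⟨b, hb, rfl⟩)
      refine eq_top_iff.mpr fun x _ => ?_
      obtain ⟨b, rfl⟩ := (dualEquiv s).surjective x
      exact (show b.toMul ∈ S from hS ▸ Subgroup.mem_top _)
    length_add := by rw [List.length_map, s.length_add] }

/-- The character group is the finite abelian group of the associated generator. -/
def orbDual (s : Symb k G n) : Additive (s.H →* kˣ) ≃+ (orbSymb s).A :=
  dualEquiv s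

lemma orbDual_sub (s : Symb k G n) (b b' : s.H →* kˣ) :
    orbDual s (Additive.ofMul (b / b')) =
      orbDual s (Additive.ofMul b) - orbDual s (Additive.ofMul b') :=
  map_sub (orbDual s) (Additive.ofMul b) (Additive.ofMul b')

lemma orbSymb_a (s : Symb k G n) :
    (orbSymb s).a = s.β.map fun b => orbDual s (Additive.ofMul b) := rfl

/-- The invariants are the field of the associated generator. -/
def orbSymbK (s : Symb k G n) : (orbSymb s).K ≃ₐ[k] invariants s.A.ρ := 
  AlgEquiv.ofRingEquiv (f := RingEquiv.refl (invariants s.A.ρ)) fun _ => rfl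

lemma isOrbSymbOf_orbSymb (s : Symb k G n) : IsOrbSymbOf s (orbSymb s) :=
  ⟨⟨orbSymbK s⟩, orbDual s, rfl⟩

/-- An isomorphism of character groups, written additively. -/
def dualCongr {H : Subgroup G} {G₁ : Type v} [Group G₁] {H' : Subgroup G₁}
    (f : (H →* kˣ) ≃* (H' →* kˣ)) : Additive (H →* kˣ) ≃+ Additive (H' →* kˣ) where
  toFun x := .ofMul (f x.toMul)
  invFun x := Additive.ofMul (f.symm x.toMul)
  left_inv _ := congrArg Additive.ofMul (f.symm_apply_apply _)
  right_inv _ := congrArg Additive.ofMul (f.apply_symm_apply _)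
  map_add' x y := congrArg Additive.ofMul (f.map_mul x.toMul y.toMul)

-- The two groups may differ, so that this covers conjugation inside `G` as well as the comparison
-- of `G'` with `G`.
omit [Finite G] in
lemma IsOrbSymbOf.cls_eq {G₁ : Type v} [Group G₁] {s : Symb k G n} {s' : Symb k G₁ n}
    {t t' : OrbSymb k n}
    (e : invariants s.A.ρ ≃ₐ[k] invariants s'.A.ρ) (f : (s.H →* kˣ) ≃* (s'.H →* kˣ))
    (hβ : s'.β = s.β.map f) (h : IsOrbSymbOf s t) (h' : IsOrbSymbOf s' t') : t.cls = t'.cls := by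
  obtain ⟨⟨e₁⟩, f₁, h₁⟩ := h
  obtain ⟨⟨e₂⟩, f₂, h₂⟩ := h'
  refine sub_eq_zero.mp (IsOrbRelator.iso t t' ((e₁.trans e).trans e₂.symm)
    ((f₁.symm.trans (dualCongr f)).trans f₂) ?_).mk_eq_zero
  rw [h₁, h₂, hβ, List.map_map, List.map_map]
  refine List.map_congr_left fun b _ => ?_
  change _ = f₂ (dualCongr f (f₁.symm (f₁ _)))
  rw [f₁.symm_apply_apply]
  rfl

lemma IsConjugate.orbSymb_cls_eq {g : G} {s t : Symb k G n} (h : IsConjugate g s t) :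
    (orbSymb s).cls = (orbSymb t).cls := by
  obtain ⟨hH, ⟨e, he⟩, hβ⟩ := h
  let c := conjCentralizer g hH
  have hinv : ∀ a, a ∈ invariants s.A.ρ ↔ e a ∈ invariants t.A.ρ := fun a => by
    refine ⟨fun ha z => ?_, fun ha z => e.injective ?_⟩
    · obtain ⟨y, rfl⟩ := c.surjective z
      rw [← he y _ rfl, ha y]
    · rw [he z (c z) rfl, ha]
  have hmap : (invariants s.A.ρ).map e.toAlgHom = invariants t.A.ρ := by
    ext a
    obtain ⟨a, rfl⟩ := e.surjective a
    rw [← hinv]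
    exact ⟨fun ⟨b, hb, h⟩ => e.injective h ▸ hb, fun h => ⟨a, h, rfl⟩⟩
  let f₀ : s.H ≃* t.H :=
    (s.H.equivMapOfInjective _ (MulAut.conj g).injective).trans (MulEquiv.subgroupCongr hH.symm)
  refine IsOrbSymbOf.cls_eq ((e.subalgebraMap _).trans (Subalgebra.equivOfEq _ _ hmap))
    f₀.monoidHomCongrLeft ?_ (isOrbSymbOf_orbSymb s) (isOrbSymbOf_orbSymb t)
  have : List.Forall₂ (fun b b' => b' = f₀.monoidHomCongrLeft b) s.β t.β :=
    hβ.imp fun b b' hb => MonoidHom.ext fun x => by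
      obtain ⟨y, rfl⟩ := f₀.surjective x
      rw [hb y _ rfl]
      change _ = b (f₀.symm (f₀ y))
      rw [f₀.symm_apply_apply]
  exact ((congrFun (congrFun List.forall₂_eq_eq_eq _) _).mp
    (List.forall₂_map_left_iff.mpr (this.imp fun _ _ h => h.symm))).symm

variable [CharZero k]

/-- Coinduction does not affect invariants, so only the action of `Z_G(H)` on `K(t)` matters. -/
lemma IsThetaTwo.exists_invariants_equiv {s t : Symb k G n} {b₁ b₂ : s.H →* kˣ}
    {rest : List (s.H →* kˣ)} (h : IsThetaTwo s b₁ b₂ rest t) :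
    Nonempty (invariants t.A.ρ ≃ₐ[k] FractionRing (Polynomial (invariants s.A.ρ))) := by
  obtain ⟨hH, ⟨τ, hτ, hind⟩, -⟩ := h
  have hle : t.H ≤ s.H := hH ▸ Subgroup.map_subtype_le _
  obtain ⟨ev, hev⟩ := (isInducedAlg_iff (centralizer_le hle)).mp hind
  obtain ⟨c, hc, hcb, rfl⟩ := exists_fracAction hτ
  have hsub : s.H ≤ Subgroup.centralizer (s.H : Set G) := fun x hx y hy => s.comm y hy x hx
  let N := s.H.subgroupOf (Subgroup.centralizer (s.H : Set G))
  let b : N →* kˣ := (b₁ / b₂).comp (Subgroup.subgroupOfEquivOfLe hsub).toMonoidHom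
  have hb : ∀ z : N, (c z : s.A.K) = algebraMap k s.A.K (b z) := fun z => hcb z z.2
  have hN : ∀ z ∈ N, s.A.ρ z = 1 := fun z hz => s.A.trivial_on z hz
  have hb' : ∀ i, b ^ i = 1 → (b₁ / b₂) ^ i = 1 := fun i hi => MonoidHom.ext fun x => by
    have := DFunLike.congr_fun hi ((Subgroup.subgroupOfEquivOfLe hsub).symm x)
    simpa [b] using this
  have hbi : ∀ i, (b₁ / b₂) ^ i = 1 → b ^ i = 1 := fun i hi => MonoidHom.ext fun x =>
    DFunLike.congr_fun hi (Subgroup.subgroupOfEquivOfLe hsub x)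
  have hcm : IsCocycle s.A.ρ (fun p => c p ^ orderOf (b₁ / b₂)) := fun g h => by
    simp only [Units.val_pow_eq_pow_val, map_pow]
    rw [hc, mul_pow]
  -- With `m` the order of `b₁ / b₂`, the cocycle `c ^ m` is trivial on `H`, so it is a coboundary
  -- by Hilbert 90.
  obtain ⟨u, hu⟩ := @exists_unit_of_isCocycle k _ _ _ s.A.K _ _ s.A.ρ _ _ s.A.isField s.A.etale N hN
    (by rw [Nat.card_congr (Subgroup.subgroupOfEquivOfLe hsub).toEquiv]; exact s.A.rank) _ hcm
    fun z hz => Units.ext <| by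
      rw [Units.val_pow_eq_pow_val, hb ⟨z, hz⟩, ← map_pow, ← Units.val_pow_eq_pow_val]
      rw [show b ⟨z, hz⟩ ^ orderOf (b₁ / b₂) = 1 from
        DFunLike.congr_fun (hbi _ (pow_orderOf_eq_one _)) ⟨z, hz⟩]
      simp
  obtain ⟨e⟩ := exists_invariants_equiv_fractionRing hc s.A.isField hN hb
    (orderOf_pos (b₁ / b₂)) (fun i hi => orderOf_dvd_of_pow_eq_one (hb' i hi))
    (u := u) (by simpa using hu)
  exact ⟨hev.invariantsEquiv.trans e⟩

-- Restriction of characters to `ker (b₁ / b₂)` is surjective with kernel generated by `b₁ / b₂`, so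
-- the first isomorphism theorem applies.
omit [CharZero k] in
lemma IsThetaTwo.exists_dual_equiv (hk : ∃ ζ : k, IsPrimitiveRoot ζ (Nat.card G))
    {s t : Symb k G n} {b₁ b₂ : s.H →* kˣ}
    {rest : List (s.H →* kˣ)} (h : IsThetaTwo s b₁ b₂ rest t) :
    ∃ f : ((orbSymb s).A ⧸ AddSubgroup.zmultiples (orbDual s (Additive.ofMul b₁) -
        orbDual s (Additive.ofMul b₂))) ≃+ (orbSymb t).A,
      (orbSymb t).a = ((b₂ :: rest).map fun b => orbDual s (Additive.ofMul b)).map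
        fun x => f (QuotientAddGroup.mk x) := by
  obtain ⟨hH, -, hβ⟩ := h
  have hle : t.H ≤ s.H := hH ▸ Subgroup.map_subtype_le _
  let r : (orbSymb s).A →+ (orbSymb t).A := (orbDual t).toAddMonoidHom.comp
    ((MonoidHom.toAdditive (resChar hle)).comp (orbDual s).symm.toAddMonoidHom)
  have hr : ∀ b, r (orbDual s (Additive.ofMul b)) =
      orbDual t (Additive.ofMul (resChar hle b)) := fun b => by
    change orbDual t (MonoidHom.toAdditive (resChar hle) ((orbDual s).symm _)) = _
    rw [AddEquiv.symm_apply_apply]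
    rfl
  have hsurj : Function.Surjective r := fun x => by
    obtain ⟨x, rfl⟩ := (orbDual t).surjective x
    obtain ⟨b, hb⟩ := resChar_surjective hk hle s.comm x.toMul
    exact ⟨orbDual s (Additive.ofMul b), by rw [hr, hb]; rfl⟩
  have hker : r.ker = AddSubgroup.zmultiples (orbDual s (Additive.ofMul b₁) -
      orbDual s (Additive.ofMul b₂)) := by
    ext x
    obtain ⟨b, rfl⟩ := (orbDual s).surjective x
    have h₁ := SetLike.ext_iff.mp (ker_resChar (k := k) (b₁ / b₂) hH hle) b.toMul
    rw [AddMonoidHom.mem_ker, show b = Additive.ofMul b.toMul from rfl, hr,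
      EmbeddingLike.map_eq_zero_iff, AddSubgroup.mem_zmultiples_iff]
    refine (h₁.trans Subgroup.mem_zpowers_iff).trans (exists_congr fun i => ?_)
    rw [← orbDual_sub, ← map_zsmul, EmbeddingLike.apply_eq_iff_eq]
    rfl
  refine ⟨(QuotientAddGroup.quotientAddEquivOfEq hker.symm).trans
    (QuotientAddGroup.quotientKerEquivOfSurjective r hsurj), ?_⟩
  have : List.Forall₂ (fun b b' => b' = resChar hle b) (b₂ :: rest) t.β :=
    hβ.imp fun b b' hb => MonoidHom.ext fun x => hb _ _ rfl
  have h₂ : t.β = (b₂ :: rest).map (resChar hle) :=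
    ((congrFun (congrFun List.forall₂_eq_eq_eq _) _).mp
    (List.forall₂_map_left_iff.mpr (this.imp fun _ _ h => h.symm))).symm
  rw [orbSymb_a, h₂, List.map_map, List.map_map]
  exact List.map_congr_left fun b _ => (hr b).symm

open FreeAbelianGroup in
lemma lift_orbSymb_eq_zero (hk : ∃ ζ : k, IsPrimitiveRoot ζ (Nat.card G))
    {x : FreeAbelianGroup (Symb k G n)} (hx : IsRelator x) :
    FreeAbelianGroup.lift (fun s : Symb k G n => (orbSymb s).cls) x = 0 := by
  induction hx with
  | reorder s β h₁ h₂ h₃ hp =>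
    rw [map_sub, lift_apply_of, lift_apply_of]
    exact (IsOrbRelator.reorder (orbSymb s) (β.map _)
      (orbSymb (s.withChars β h₁ h₂ h₃)).ne_zero (orbSymb (s.withChars β h₁ h₂ h₃)).generate
      (orbSymb (s.withChars β h₁ h₂ h₃)).length_add (hp.map _)).mk_eq_zero
  | conj g s t h =>
    rw [map_sub, lift_apply_of, lift_apply_of, sub_eq_zero]
    exact h.orbSymb_cls_eq
  | vanish s b₁ b₂ rest hβ h =>
    rw [lift_apply_of]
    refine (IsOrbRelator.vanish (orbSymb s) _ _ _ (by rw [orbSymb_a, hβ]; rfl) ?_).mk_eq_zero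
    exact (map_add (orbDual s) _ _).symm.trans <|
      (congrArg (fun b => orbDual s (Additive.ofMul b)) h).trans (map_zero _)
  | blowup s b₁ b₂ rest hβ Θ₁ Θ₂ hΘ₁ hΘ₂ =>
    let D : (s.H →* kˣ) → (orbSymb s).A := fun b => orbDual s (Additive.ofMul b)
    have hDi : Function.Injective D := (orbDual s).injective
    have hD : ∀ b b', D (b / b') = D b - D b' := orbDual_sub s
    have hβ' : (orbSymb s).a = D b₁ :: D b₂ :: rest.map D := by
      rw [orbSymb_a, hβ]; rfl
    have h₁ : ∃ Θ₁' : FreeAbelianGroup (OrbSymb k n),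
        lift (fun s : Symb k G n => (orbSymb s).cls) Θ₁ = QuotientAddGroup.mk Θ₁' ∧
        ((D b₁ = D b₂ ∧ Θ₁' = 0) ∨
        (D b₁ ≠ D b₂ ∧ ∃ h₁ h₂ h₃ h₁' h₂' h₃',
          Θ₁' = of ((orbSymb s).withGens (D b₁ :: (D b₂ - D b₁) :: rest.map D) h₁ h₂ h₃) +
            of ((orbSymb s).withGens (D b₂ :: (D b₁ - D b₂) :: rest.map D) h₁' h₂' h₃'))) := by
      rcases hΘ₁ with ⟨h, rfl⟩ | ⟨h, g₁, g₂, g₃, g₁', g₂', g₃', rfl⟩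
      · exact ⟨0, by simp, .inl ⟨by rw [h], rfl⟩⟩
      · refine ⟨of (orbSymb (s.withChars _ g₁ g₂ g₃)) + of (orbSymb (s.withChars _ g₁' g₂' g₃')),
          by rw [map_add, lift_apply_of, lift_apply_of]; rfl,
          .inr ⟨fun h' => h (hDi h'), ?_⟩⟩
        rw [← hD, ← hD]
        exact ⟨(orbSymb (s.withChars _ g₁ g₂ g₃)).ne_zero,
          (orbSymb (s.withChars _ g₁ g₂ g₃)).generate,
          (orbSymb (s.withChars _ g₁ g₂ g₃)).length_add,
          (orbSymb (s.withChars _ g₁' g₂' g₃')).ne_zero,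
          (orbSymb (s.withChars _ g₁' g₂' g₃')).generate,
          (orbSymb (s.withChars _ g₁' g₂' g₃')).length_add, rfl⟩
    have h₂ : ∃ Θ₂' : FreeAbelianGroup (OrbSymb k n),
        lift (fun s : Symb k G n => (orbSymb s).cls) Θ₂ = QuotientAddGroup.mk Θ₂' ∧
        (((∃ x ∈ (orbSymb s).a, x ∈ AddSubgroup.zmultiples (D b₁ - D b₂)) ∧ Θ₂' = 0) ∨
        ((¬ ∃ x ∈ (orbSymb s).a, x ∈ AddSubgroup.zmultiples (D b₁ - D b₂)) ∧
          ∃ (t : OrbSymb k n) (_ : t.K ≃ₐ[k] FractionRing (Polynomial (orbSymb s).K))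
            (f : ((orbSymb s).A ⧸ AddSubgroup.zmultiples (D b₁ - D b₂)) ≃+ t.A),
            t.a = (D b₂ :: rest.map D).map (fun x => f (QuotientAddGroup.mk x)) ∧
              Θ₂' = of t)) := by
      have hiff : (∃ x ∈ (orbSymb s).a, x ∈ AddSubgroup.zmultiples (D b₁ - D b₂)) ↔
          ∃ b ∈ s.β, b ∈ Subgroup.zpowers (b₁ / b₂) := by
        rw [show (orbSymb s).a = s.β.map D from orbSymb_a s]
        simp only [List.mem_map, exists_exists_and_eq_and, ← hD]
        refine exists_congr fun b => and_congr_right fun _ => ?_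
        rw [AddSubgroup.mem_zmultiples_iff, Subgroup.mem_zpowers_iff]
        refine exists_congr fun i => ?_
        change i • orbDual s _ = orbDual s _ ↔ _
        rw [← map_zsmul, EmbeddingLike.apply_eq_iff_eq]
        rfl
      rw [hiff]
      rcases hΘ₂ with ⟨h, rfl⟩ | ⟨h, t, ht, rfl⟩
      · exact ⟨0, by simp, .inl ⟨h, rfl⟩⟩
      · obtain ⟨e⟩ := ht.exists_invariants_equiv
        obtain ⟨f, hf⟩ := ht.exists_dual_equiv hk
        refine ⟨of (orbSymb t), by rw [lift_apply_of]; rfl, .inr ⟨h, orbSymb t,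
          (orbSymbK t).trans e, f, hf, rfl⟩⟩
    obtain ⟨Θ₁', h₁, h₁'⟩ := h₁
    obtain ⟨Θ₂', h₂, h₂'⟩ := h₂
    rw [map_sub, map_add, h₁, h₂, lift_apply_of]
    exact (IsOrbRelator.blowup (orbSymb s) _ _ _ hβ' Θ₁' Θ₂' h₁' h₂').mk_eq_zero

/-- The homomorphism to the Burnside group of orbifolds. -/
def kappaHom (hk : ∃ ζ : k, IsPrimitiveRoot ζ (Nat.card G)) (n : ℕ) :
    Burn k G n →+ OrbBurn k n :=
  burnLift (fun s => (orbSymb s).cls) fun _ => lift_orbSymb_eq_zero hk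

lemma kappaHom_cls (hk : ∃ ζ : k, IsPrimitiveRoot ζ (Nat.card G)) (s : Symb k G n) :
    kappaHom hk n s.cls = (orbSymb s).cls :=
  burnLift_cls _ _ s

lemma isKappa_kappaHom (hk : ∃ ζ : k, IsPrimitiveRoot ζ (Nat.card G)) :
    IsKappa (kappaHom hk n : Burn k G n →+ OrbBurn k n) := fun s =>
  ⟨⟨_, isOrbSymbOf_orbSymb s⟩, fun _ ht => (kappaHom_cls hk s).trans <|
    IsOrbSymbOf.cls_eq AlgEquiv.refl (MulEquiv.refl _) (by simp) (isOrbSymbOf_orbSymb s) ht⟩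

lemma IsKappa.eq_kappaHom (hk : ∃ ζ : k, IsPrimitiveRoot ζ (Nat.card G))
    {f : Burn k G n →+ OrbBurn k n} (h : IsKappa f) : f = kappaHom hk n :=
  burn_hom_ext fun s => by rw [(h s).2 _ (isOrbSymbOf_orbSymb s), kappaHom_cls]

omit [CharZero k] in
lemma exists_isPrimitiveRoot_subgroup (hk : ∃ ζ : k, IsPrimitiveRoot ζ (Nat.card G))
    (G' : Subgroup G) : ∃ ζ : k, IsPrimitiveRoot ζ (Nat.card G') := by
  obtain ⟨ζ, hζ⟩ := hk
  obtain ⟨m, hm⟩ := G'.card_subgroup_dvd_card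
  exact ⟨ζ ^ m, hζ.pow Nat.card_pos (by rw [hm, mul_comm])⟩

/-- The value of `κ` depends only on the invariants and the characters, and induction changes
neither. -/
lemma kappaHom_comp_indHom {G' : Subgroup G} (hk : ∃ ζ : k, IsPrimitiveRoot ζ (Nat.card G)) :
    (kappaHom hk n).comp (indHom k G' n) =
      kappaHom (exists_isPrimitiveRoot_subgroup hk G') n := by
  refine burn_hom_ext fun s => ?_
  rw [AddMonoidHom.comp_apply, indHom_cls, kappaHom_cls, kappaHom_cls]
  obtain ⟨ev, hev⟩ := isCoind_indSymb s
  exact (IsOrbSymbOf.cls_eq hev.invariantsEquiv.symm (indChar s) (indSymb_β s)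
    (isOrbSymbOf_orbSymb s) (isOrbSymbOf_orbSymb (indSymb s))).symm

end Kappa

/-! ## The induced space -/

namespace GScheme

variable {k : Type u} [Field k] {G : Type v} [Group G]

lemma act_inv_act (X : GScheme k G) (g : G) : X.act g⁻¹ ≫ X.act g = 𝟙 X.X := by
  rw [← X.act_mul, inv_mul_cancel, X.act_one]

lemma act_act_inv (X : GScheme k G) (g : G) : X.act g ≫ X.act g⁻¹ = 𝟙 X.X := by
  rw [← X.act_mul, mul_inv_cancel, X.act_one]

instance (X : GScheme k G) (g : G) : IsIso (X.act g) :=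
  ⟨X.act g⁻¹, X.act_act_inv g, X.act_inv_act g⟩

lemma act_mul_apply (X : GScheme k G) (g h : G) (x : X.X) :
    X.act (g * h) x = X.act h (X.act g x) := by
  rw [X.act_mul, Scheme.Hom.comp_apply]

lemma act_one_apply (X : GScheme k G) (x : X.X) : X.act 1 x = x := by
  rw [X.act_one]; rfl

variable {G' : Subgroup G}

/-- The morphisms `j g` present `W` as the induced space `X ×^{G'} G`: these are open immersions
with images which cover `W`, and the images for different cosets of `G'` are disjoint. -/
structure IsInd (X : GScheme k G') (W : GScheme k G) (j : G → (X.X ⟶ W.X)) : Prop where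
  act_j : ∀ (h : G') (g : G), X.act h ≫ j g = j (h * g)
  j_act : ∀ g γ : G, j g ≫ W.act γ = j (g * γ)
  j_str : ∀ g, j g ≫ W.str = X.str
  isOpenImmersion : ∀ g, IsOpenImmersion (j g)
  exists_eq : ∀ y : W.X, ∃ g x, j g x = y
  mem_of_eq : ∀ g g' x x', j g x = j g' x' → g' * g⁻¹ ∈ G'
  desc : ∀ (T : Scheme.{u}) (t : G → (X.X ⟶ T)), (∀ (h : G') (g : G), X.act h ≫ t g = t (h * g)) →
      ∃! f : W.X ⟶ T, ∀ g, j g ≫ f = t g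

lemma IsInd.isInducedSpace {X : GScheme k G'} {W : GScheme k G} {j : G → (X.X ⟶ W.X)}
    (h : IsInd X W j) : IsInducedSpace X W :=
  ⟨j, h.act_j, h.j_act, h.j_str, h.desc⟩

/-! ### Construction as a disjoint union over cosets -/

section Existence

open Limits

variable (X : GScheme k G') {m : ℕ} (T : Transversal G'.subtype m)

/-- The morphisms to the disjoint union of copies of `X`, indexed by cosets of `G'`. -/
def indMap (g : G) : X.X ⟶ ∐ fun _ : Fin m => X.X :=
  X.act (T.h g) ≫ Sigma.ι (fun _ : Fin m => X.X) (T.c g)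

lemma act_indMap (h : G') (g : G) : X.act h ≫ indMap X T g = indMap X T (h * g) := by
  rw [indMap, indMap, ← Category.assoc, ← X.act_mul]
  have h₁ := T.h_mul h g
  have h₂ := T.c_mul h g
  simp only [Subgroup.subtype_apply] at h₁ h₂
  rw [h₁, h₂]

lemma indMap_r (i : Fin m) : indMap X T (T.r i) = Sigma.ι (fun _ : Fin m => X.X) i := by
  rw [indMap, T.h_r, T.c_r, X.act_one, Category.id_comp]

/-- Morphisms from the disjoint union. -/
def indDesc {Z : Scheme.{u}} (t : G → (X.X ⟶ Z)) : (∐ fun _ : Fin m => X.X) ⟶ Z :=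
  Sigma.desc fun i => t (T.r i)

lemma indMap_indDesc {Z : Scheme.{u}} {t : G → (X.X ⟶ Z)}
    (ht : ∀ (h : G') (g : G), X.act h ≫ t g = t (h * g)) (g : G) :
    indMap X T g ≫ indDesc X T t = t g := by
  rw [indMap, indDesc, Category.assoc, Sigma.ι_desc, ht]
  congr 1
  exact T.h_mul_r g

lemma ind_hom_ext {Z : Scheme.{u}} {f f' : (∐ fun _ : Fin m => X.X) ⟶ Z}
    (h : ∀ g, indMap X T g ≫ f = indMap X T g ≫ f') : f = f' :=
  Sigma.hom_ext _ _ fun i => by simpa [indMap_r] using h (T.r i)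

/-- The induced space, as a disjoint union of copies of `X`. -/
def indSpace : GScheme k G where
  X := ∐ fun _ : Fin m => X.X
  str := Sigma.desc fun _ => X.str
  act γ := indDesc X T fun g => indMap X T (g * γ)
  act_one := ind_hom_ext X T fun g => by
    rw [indMap_indDesc X T fun h g => by rw [act_indMap, mul_assoc], mul_one, Category.comp_id]
  act_mul γ γ' := ind_hom_ext X T fun g => by
    rw [indMap_indDesc X T fun h g => by rw [act_indMap, mul_assoc], ← Category.assoc,
      indMap_indDesc X T fun h g => by rw [act_indMap, mul_assoc],
      indMap_indDesc X T fun h g => by rw [act_indMap, mul_assoc], mul_assoc]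
  act_str γ := Sigma.hom_ext _ _ fun i => by
    rw [indDesc, Sigma.ι_desc_assoc, indMap, Category.assoc, Sigma.ι_desc, Sigma.ι_desc,
      X.act_str]

lemma isOpenImmersion_indMap (g : G) : IsOpenImmersion (indMap X T g) := by
  rw [indMap]
  infer_instance

lemma exists_indMap_eq (y : (∐ fun _ : Fin m => X.X :)) : ∃ g x, indMap X T g x = y := by
  obtain ⟨i, x, hx⟩ := (sigmaOpenCover fun _ : Fin m => X.X).exists_eq y
  exact ⟨T.r (show Fin m from i), x, (congrArg (fun f => f x) (indMap_r X T i)).trans hx⟩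

lemma mem_of_indMap_eq {g g' : G} {x x' : X.X} (h : indMap X T g x = indMap X T g' x') :
    g' * g⁻¹ ∈ G' := by
  rw [indMap, indMap, Scheme.Hom.comp_apply, Scheme.Hom.comp_apply, sigmaι_eq_iff] at h
  have hc : T.c g = T.c g' := congrArg Sigma.fst h
  have : g' * g⁻¹ = T.h g' * (T.h g)⁻¹ := by
    conv_lhs => rw [← T.h_mul_r g, ← T.h_mul_r g', hc]
    simp
  rw [this]
  exact G'.mul_mem (T.h g').2 (G'.inv_mem (T.h g).2)

lemma isInd_indSpace : IsInd X (indSpace X T) (indMap X T) where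
  act_j := act_indMap X T
  j_act g γ := indMap_indDesc X T (fun h g => (act_indMap X T h (g * γ)).trans (by rw [mul_assoc])) g
  j_str g := by
    change (X.act (T.h g) ≫ Sigma.ι (fun _ : Fin m => X.X) (T.c g)) ≫ Sigma.desc _ = _
    rw [Category.assoc, Sigma.ι_desc, X.act_str]
  isOpenImmersion := isOpenImmersion_indMap X T
  exists_eq := exists_indMap_eq X T
  mem_of_eq _ _ _ _ := mem_of_indMap_eq X T
  desc Z t ht := ⟨indDesc X T t, indMap_indDesc X T ht, fun f hf =>
    ind_hom_ext X T fun g => (hf g).trans (indMap_indDesc X T ht g).symm⟩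

lemma exists_isInd [Finite G] : ∃ (W : GScheme k G) (j : G → (X.X ⟶ W.X)), IsInd X W j := by
  obtain ⟨m, ⟨T⟩⟩ := exists_transversal (i := G'.subtype) G'.subtype_injective
  exact ⟨_, _, isInd_indSpace X T⟩

variable {X}

/-- The universal property gives an isomorphism with the disjoint union of copies of `X`, from which
the geometric properties of the maps `j g` are inherited. -/
lemma IsInducedSpace.exists_isInd [Finite G] {W : GScheme k G} (hW : IsInducedSpace X W) :
    ∃ j : G → (X.X ⟶ W.X), IsInd X W j := by
  obtain ⟨j, h₁, h₂, h₃, h₄⟩ := hW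
  obtain ⟨W₀, j₀, h₀⟩ := GScheme.exists_isInd X
  obtain ⟨φ, hφ, -⟩ := h₄ _ j₀ h₀.act_j
  obtain ⟨ψ, hψ, -⟩ := h₀.desc _ j h₁
  have hφψ : φ ≫ ψ = 𝟙 _ := (h₄ _ j h₁).unique
    (fun g => by rw [← Category.assoc, hφ, hψ]) (fun g => Category.comp_id _)
  have hψφ : ψ ≫ φ = 𝟙 _ := (h₀.desc _ j₀ h₀.act_j).unique
    (fun g => by rw [← Category.assoc, hψ, hφ]) (fun g => Category.comp_id _)
  have : IsIso ψ := ⟨φ, hψφ, hφψ⟩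
  refine ⟨j, h₁, h₂, h₃, fun g => ?_, fun y => ?_, fun g g' x x' h => ?_, h₄⟩
  · have := h₀.isOpenImmersion g
    rw [← hψ]
    infer_instance
  · obtain ⟨g, x, hx⟩ := h₀.exists_eq (φ y)
    refine ⟨g, x, ?_⟩
    rw [← hψ, Scheme.Hom.comp_apply, hx, ← Scheme.Hom.comp_apply, hφψ]
    rfl
  · refine h₀.mem_of_eq g g' x x' ?_
    rw [← hφ, Scheme.Hom.comp_apply, h, ← hφ, Scheme.Hom.comp_apply]

end Existence

end GScheme

namespace GScheme

/-! ## Points and stabilizers of the induced space -/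

section Points

variable {k : Type u} [Field k] {G : Type v} [Group G]

/-- An open immersion is a monomorphism and induces isomorphisms of residue fields. This compares
stabilizers along translations and along `j 1`. -/
lemma fromSpecResidueField_comp_iff {X Y : Scheme.{u}} (f : X ⟶ Y) [IsOpenImmersion f]
    {a : X ⟶ X} {b : Y ⟶ Y} (h : a ≫ f = f ≫ b) (x : X) :
    Y.fromSpecResidueField (f x) ≫ b = Y.fromSpecResidueField (f x) ↔
      X.fromSpecResidueField x ≫ a = X.fromSpecResidueField x := by
  rw [← cancel_mono f, Category.assoc, h,
    ← cancel_epi (Spec.map (f.residueFieldMap x)), ← Category.assoc, ← Category.assoc,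
    f.SpecMap_residueFieldMap_fromSpecResidueField]

variable {X : GScheme k G}

lemma mem_stab {x : X.X} {g : G} :
    g ∈ X.stab x ↔ X.X.fromSpecResidueField x ≫ X.act g = X.X.fromSpecResidueField x :=
  Iff.rfl

lemma act_eq_of_mem_stab {x : X.X} {g : G} (h : g ∈ X.stab x) : X.act g x = x := by
  have := congrArg (fun f => f default) (mem_stab.mp h)
  simpa using this

lemma mem_stab_act {x : X.X} {g γ : G} :
    γ ∈ X.stab (X.act g x) ↔ g * γ * g⁻¹ ∈ X.stab x :=
  fromSpecResidueField_comp_iff (X.act g) (a := X.act (g * γ * g⁻¹)) (b := X.act γ)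
    (by rw [← X.act_mul, ← X.act_mul, inv_mul_cancel_right]) x

lemma act_injective (g : G) : Function.Injective (X.act g) := fun x y h => by
  have := congrArg (X.act g⁻¹) h
  rwa [← X.act_mul_apply, ← X.act_mul_apply, mul_inv_cancel, X.act_one_apply,
    X.act_one_apply] at this

lemma stab_act_le_iff {x y : X.X} {g : G} :
    X.stab (X.act g x) ≤ X.stab (X.act g y) ↔ X.stab x ≤ X.stab y := by
  refine ⟨fun h γ hγ => ?_, fun h γ hγ => mem_stab_act.mpr (h (mem_stab_act.mp hγ))⟩
  have := @h (g⁻¹ * γ * g) (mem_stab_act.mpr (by simpa [mul_assoc] using hγ))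
  simpa [mem_stab_act, mul_assoc] using this

lemma IsStratum.act {x : X.X} (h : X.IsStratum x) (g : G) : X.IsStratum (X.act g x) := by
  intro y hy hyx
  obtain ⟨y, rfl⟩ : ∃ y', X.act g y' = y := ⟨X.act g⁻¹ y, by
    rw [← X.act_mul_apply, inv_mul_cancel, X.act_one_apply]⟩
  rw [h y (stab_act_le_iff.mp hy) ((X.act g).isOpenEmbedding.isInducing.specializes_iff.mp hyx)]

lemma isStratum_act_iff {x : X.X} {g : G} : X.IsStratum (X.act g x) ↔ X.IsStratum x := by
  refine ⟨fun h => ?_, fun h => h.act g⟩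
  have := h.act g⁻¹
  rwa [← X.act_mul_apply, mul_inv_cancel, X.act_one_apply] at this

/-- Schemes are sober, so components can be replaced by their generic points, the points without
proper generizations. -/
lemma mem_irreducibleComponents_iff {S : Scheme.{u}} {Z : Set S} :
    Z ∈ irreducibleComponents S ↔ ∃ x, closure {x} = Z ∧ ∀ y, y ⤳ x → y = x := by
  constructor
  · intro hZ
    obtain ⟨x, hx⟩ := QuasiSober.sober hZ.1 (isClosed_of_mem_irreducibleComponents Z hZ)
    refine ⟨x, hx, fun y hy => ?_⟩
    have h₁ : closure {x} ⊆ closure {y} := hy.closure_subset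
    have h₂ : closure {y} ⊆ closure {x} := by
      rw [hx.def] at h₁ ⊢
      exact hZ.2 isIrreducible_singleton.closure h₁
    exact (hy.antisymm (specializes_iff_closure_subset.mpr h₂)).eq
  · rintro ⟨x, rfl, hx⟩
    refine ⟨isIrreducible_singleton.closure, fun T hT hxT => ?_⟩
    obtain ⟨y, hy⟩ := QuasiSober.sober hT.closure isClosed_closure
    have h₁ : y ⤳ x := hy.specializes (subset_closure (hxT (subset_closure rfl)))
    rw [← hx y h₁]
    exact subset_closure.trans hy.def.ge

lemma transitive_irreducibleComponents_iff :
    (∀ Z ∈ irreducibleComponents X.X, ∀ Z' ∈ irreducibleComponents X.X,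
      ∃ g : G, (X.act g) '' Z = Z') ↔
    ∀ x : X.X, (∀ y, y ⤳ x → y = x) → ∀ x' : X.X, (∀ y, y ⤳ x' → y = x') →
      ∃ g, X.act g x = x' := by
  have him : ∀ g x, X.act g '' closure {x} = closure {X.act g x} := fun g x => by
    have := (X.act g).homeomorph.image_closure {x}
    rwa [Set.image_singleton] at this
  constructor
  · intro h x hx x' hx'
    obtain ⟨g, hg⟩ := h _ (mem_irreducibleComponents_iff.mpr ⟨x, rfl, hx⟩) _
      (mem_irreducibleComponents_iff.mpr ⟨x', rfl, hx'⟩)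
    rw [him] at hg
    exact ⟨g, (Inseparable.eq (inseparable_iff_closure_eq.mpr hg))⟩
  · intro h Z hZ Z' hZ'
    obtain ⟨x, rfl, hx⟩ := mem_irreducibleComponents_iff.mp hZ
    obtain ⟨x', rfl, hx'⟩ := mem_irreducibleComponents_iff.mp hZ'
    obtain ⟨g, rfl⟩ := h x hx x' hx'
    exact ⟨g, him g x⟩

end Points

namespace IsInd

variable {k : Type u} [Field k] {G : Type v} [Group G] {G' : Subgroup G} {X : GScheme k G'}
  {W : GScheme k G} {j : G → (X.X ⟶ W.X)} (h : IsInd X W j)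

include h

lemma j_act_apply (g γ : G) (x : X.X) : W.act γ (j g x) = j (g * γ) x := by
  rw [← h.j_act, Scheme.Hom.comp_apply]

lemma act_j_apply (p : G') (g : G) (x : X.X) : j g (X.act p x) = j (p * g) x := by
  rw [← h.act_j, Scheme.Hom.comp_apply]

lemma injective (g : G) : Function.Injective (j g) :=
  have := h.isOpenImmersion g
  (j g).isOpenEmbedding.injective

lemma eq_iff {g g' : G} {x x' : X.X} :
    j g x = j g' x' ↔ ∃ p : G', (p : G) * g = g' ∧ X.act p x' = x := by
  refine ⟨fun he => ⟨⟨_, h.mem_of_eq _ _ _ _ he⟩, by simp, h.injective g ?_⟩, ?_⟩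
  · rw [h.act_j_apply, he]
    simp
  · rintro ⟨p, rfl, rfl⟩
    rw [h.act_j_apply]

lemma eq_act (g : G) (x : X.X) : j g x = W.act g (j 1 x) := by
  rw [h.j_act_apply, one_mul]

lemma exists_eq_act (y : W.X) : ∃ g x, y = W.act g (j 1 x) := by
  obtain ⟨g, x, rfl⟩ := h.exists_eq y
  exact ⟨g, x, h.eq_act g x⟩

/-- An element `γ` takes the copy `j 1` to the copy `j γ`. If it fixes a point of `j 1`, these
copies meet, which forces `γ ∈ G'`. For such `γ` the open immersion `j 1` is equivariant. -/
lemma stab (x : X.X) : W.stab (j 1 x) = (X.stab x).map G'.subtype := by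
  have := h.isOpenImmersion 1
  have key : ∀ p : G', (p : G) ∈ W.stab (j 1 x) ↔ p ∈ X.stab x := fun p =>
    fromSpecResidueField_comp_iff (j 1) (by rw [h.act_j, h.j_act, mul_one, one_mul]) x
  ext γ
  refine ⟨fun hγ => ?_, ?_⟩
  · have := act_eq_of_mem_stab hγ
    rw [h.j_act_apply, one_mul] at this
    obtain ⟨p, hp, -⟩ := h.eq_iff.mp this.symm
    rw [mul_one] at hp
    subst hp
    exact ⟨p, (key p).mp hγ, rfl⟩
  · rintro ⟨p, hp, rfl⟩
    exact (key p).mpr hp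

lemma stab_le_iff {x x' : X.X} : W.stab (j 1 x) ≤ W.stab (j 1 x') ↔ X.stab x ≤ X.stab x' := by
  rw [h.stab, h.stab, Subgroup.map_le_map_iff_of_injective G'.subtype_injective]

/-- The image of `j 1` is open, so it contains all generizations of its points. -/
lemma isStratum_iff {x : X.X} : W.IsStratum (j 1 x) ↔ X.IsStratum x := by
  have := h.isOpenImmersion 1
  refine ⟨fun hs y hy hyx => h.injective 1 (hs _ (h.stab_le_iff.mpr hy)
    (hyx.map (j 1).continuous)), fun hs y hy hyx => ?_⟩
  obtain ⟨y, rfl⟩ := hyx.mem_open (j 1).isOpenEmbedding.isOpen_range ⟨x, rfl⟩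
  rw [hs y (h.stab_le_iff.mp hy) ((j 1).isOpenEmbedding.isInducing.specializes_iff.mp hyx)]

/-- The union of the translates of an open subset of `X`. -/
def opens (U : X.X.Opens) : W.X.Opens :=
  ⨆ g, have := h.isOpenImmersion g; j g ''ᵁ U

lemma mem_opens {U : X.X.Opens} {y : W.X} : y ∈ h.opens U ↔ ∃ g, ∃ x ∈ U, j g x = y := by
  simp [opens]

lemma isGenericallyFree (hX : X.IsGenericallyFree) : W.IsGenericallyFree := by
  obtain ⟨U, ⟨x, hx⟩, -, hU⟩ := hX
  refine ⟨h.opens U, ⟨j 1 x, h.mem_opens.mpr ⟨1, x, hx, rfl⟩⟩, fun γ => ?_, fun y hy => ?_⟩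
  · ext y
    change W.act γ y ∈ h.opens U ↔ y ∈ h.opens U
    rw [h.mem_opens, h.mem_opens]
    constructor
    · rintro ⟨g, x, hx, hg⟩
      refine ⟨g * γ⁻¹, x, hx, act_injective γ ?_⟩
      rw [h.j_act_apply, inv_mul_cancel_right, hg]
    · rintro ⟨g, x, hx, rfl⟩
      exact ⟨g * γ, x, hx, (h.j_act_apply g γ x).symm⟩
  · obtain ⟨g, x, hx, rfl⟩ := h.mem_opens.mp hy
    rw [h.eq_act, eq_bot_iff]
    intro γ hγ
    rw [mem_stab_act, h.stab, hU x hx, Subgroup.map_bot, Subgroup.mem_bot, mul_inv_eq_one,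
      mul_eq_left] at hγ
    exact hγ

lemma transitive_irreducibleComponents
    (hX : ∀ Z ∈ irreducibleComponents X.X, ∀ Z' ∈ irreducibleComponents X.X,
      ∃ g : G', (X.act g) '' Z = Z') :
    ∀ Z ∈ irreducibleComponents W.X, ∀ Z' ∈ irreducibleComponents W.X,
      ∃ g : G, (W.act g) '' Z = Z' := by
  rw [transitive_irreducibleComponents_iff] at hX ⊢
  have key : ∀ y : W.X, (∀ z, z ⤳ y → z = y) → ∃ g x, W.act g (j 1 x) = y ∧
      ∀ z, z ⤳ x → z = x := fun y hy => by
    obtain ⟨g, x, rfl⟩ := h.exists_eq_act y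
    exact ⟨g, x, rfl, fun z hz => h.injective 1 (act_injective g
      (hy _ ((hz.map (j 1).continuous).map (W.act g).continuous)))⟩
  intro y hy y' hy'
  obtain ⟨g, x, rfl, hx⟩ := key y hy
  obtain ⟨g', x', rfl, hx'⟩ := key y' hy'
  obtain ⟨p, rfl⟩ := hX x hx x' hx'
  refine ⟨g⁻¹ * (p * g'), ?_⟩
  rw [← W.act_mul_apply, mul_inv_cancel_left, h.j_act_apply, h.j_act_apply, h.act_j_apply]
  simp

end IsInd

end GScheme

/-! ## Local properties -/

section Local

variable {P : MorphismProperty Scheme.{u}}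

lemma of_isPullback_of_openCover [IsZariskiLocalAtTarget P] {X Y : Scheme.{u}} {f : X ⟶ Y}
    {ι : Type*} {Z V : ι → Scheme.{u}} (a : ∀ i, Z i ⟶ X) (b : ∀ i, Z i ⟶ V i) (v : ∀ i, V i ⟶ Y)
    [∀ i, IsOpenImmersion (v i)] (hv : ∀ y, ∃ i z, v i z = y)
    (h : ∀ i, IsPullback (a i) (b i) f (v i)) (hb : ∀ i, P (b i)) : P f := by
  refine IsZariskiLocalAtTarget.of_iSup_eq_top (fun i => (v i).opensRange) ?_ fun i => ?_
  · refine eq_top_iff.mpr fun y _ => ?_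
    obtain ⟨i, z, hz⟩ := hv y
    exact TopologicalSpace.Opens.mem_iSup.mpr ⟨i, z, hz⟩
  · refine (P.arrow_mk_iso_iff (morphismRestrictOpensRange f _)).mpr ?_
    rw [← MorphismProperty.cancel_left_of_respectsIso P (h i).isoPullback.hom]
    convert hb i
    exact (h i).isoPullback_hom_snd

lemma of_source_openCover [IsZariskiLocalAtSource P] {X Y : Scheme.{u}} {f : X ⟶ Y}
    {ι : Type*} {Z : ι → Scheme.{u}} (a : ∀ i, Z i ⟶ X) [∀ i, IsOpenImmersion (a i)]
    (ha : ∀ x, ∃ i z, a i z = x) (h : ∀ i, P (a i ≫ f)) : P f := by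
  refine IsZariskiLocalAtSource.of_iSup_eq_top (fun i => (a i).opensRange) ?_ fun i => ?_
  · refine eq_top_iff.mpr fun y _ => ?_
    obtain ⟨i, z, hz⟩ := ha y
    exact TopologicalSpace.Opens.mem_iSup.mpr ⟨i, z, hz⟩
  · rw [← MorphismProperty.cancel_left_of_respectsIso P
      (IsOpenImmersion.isoOfRangeEq (a i) (a i).opensRange.ι (by simp)).hom, ← Category.assoc,
      IsOpenImmersion.isoOfRangeEq_hom_fac]
    exact h i

/-- A morphism from a disjoint union has a given local property if this holds for its
restrictions, and these factor through disjoint closed subsets. -/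
lemma of_disjoint_closed [IsZariskiLocalAtTarget P] {X Y : Scheme.{u}} {f : X ⟶ Y} {m : ℕ}
    [NeZero m] {Z : Fin m → Scheme.{u}} (a : ∀ i, Z i ⟶ X) [∀ i, IsOpenImmersion (a i)]
    (ha : ∀ x, ∃ i z, a i z = x) (C : Fin m → Set Y) (hC : ∀ i, IsClosed (C i))
    (hdisj : ∀ i i', i ≠ i' → Disjoint (C i) (C i')) (hfC : ∀ i z, f (a i z) ∈ C i)
    (h : ∀ i, P (a i ≫ f)) : P f := by
  -- Over the complement of the other closed sets only the `i`-th piece of `X` is present.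
  let U : Fin m → Y.Opens := fun i =>
    ⟨(⋃ i' : {i' // i' ≠ i}, C i')ᶜ,
      (isClosed_iUnion_of_finite fun i' : {i' // i' ≠ i} => hC i').isOpen_compl⟩
  have hU : ∀ i y, y ∈ U i ↔ ∀ i' ≠ i, y ∉ C i' := fun i y => by
    change y ∈ (⋃ i' : {i' // i' ≠ i}, C i')ᶜ ↔ _
    simp
  refine IsZariskiLocalAtTarget.of_iSup_eq_top U ?_ fun i => ?_
  · refine eq_top_iff.mpr fun y _ => TopologicalSpace.Opens.mem_iSup.mpr ?_
    by_cases hy : ∃ i, y ∈ C i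
    · obtain ⟨i, hi⟩ := hy
      exact ⟨i, (hU i y).mpr fun i' hi' hy => Set.disjoint_left.mp (hdisj i' i hi') hy hi⟩
    · push Not at hy
      -- A point outside all the `C i` lies in every `U i`; an index exists since `m ≠ 0`.
      exact ⟨0, (hU 0 y).mpr fun i' _ => hy i'⟩
  · have hs : Function.Surjective (a i ∣_ (f ⁻¹ᵁ U i)) := fun x => by
      obtain ⟨i', z, hz⟩ := ha x.1
      have hi : i' = i := by
        by_contra hne
        refine (hU i _).mp x.2 i' hne ?_
        rw [← hz]
        exact hfC i' z
      subst hi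
      refine ⟨⟨z, ?_⟩, Subtype.ext ?_⟩
      · change a i' z ∈ f ⁻¹ᵁ U i'
        rw [hz]
        exact x.2
      · exact congr($(morphismRestrict_ι (a i') (f ⁻¹ᵁ U i')) _).trans hz
    have : IsIso (a i ∣_ (f ⁻¹ᵁ U i)) :=
      (isIso_iff_isOpenImmersion_and_surjective _).mpr ⟨inferInstance, ⟨hs⟩⟩
    rw [← MorphismProperty.cancel_left_of_respectsIso P (a i ∣_ (f ⁻¹ᵁ U i)),
      ← morphismRestrict_comp]
    exact IsZariskiLocalAtTarget.restrict (h i) _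

end Local

/-! ## Embeddings of projective spaces -/

section ProjectiveSpace

open MvPolynomial HomogeneousLocalization HomogeneousIdeal

variable (k : Type u) [Field k] {N M : ℕ} (e : Fin (N + 1) → Fin (M + 1))
  (he : Function.Injective e)

attribute [local instance] MvPolynomial.gradedAlgebra

variable {k} in
lemma isHomogeneous_killCompl {i : ℕ} {x : MvPolynomial (Fin (M + 1)) k} (hx : x.IsHomogeneous i) :
    (killCompl he x).IsHomogeneous i := by
  have h : ∀ t, (if h : t ∈ Set.range e then X ((Equiv.ofInjective e he).symm ⟨t, h⟩) else 0 :
      MvPolynomial (Fin (N + 1)) k).IsHomogeneous 1 := fun t => by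
    split_ifs
    · exact isHomogeneous_X k _
    · exact isHomogeneous_zero _ k _
  have := IsHomogeneous.aeval (S := k) hx _ h
  rw [one_mul] at this
  convert this
  exact algHom_ext fun t => by rw [killCompl, aeval_X, aeval_X]; congr

/-- The surjection of polynomial rings which maps the variables not in the image of `e` to `0`. -/
def killHom : homogeneousSubmodule (Fin (M + 1)) k →+*ᵍ homogeneousSubmodule (Fin (N + 1)) k where
  toRingHom := (killCompl he : MvPolynomial (Fin (M + 1)) k →ₐ[k] _).toRingHom
  map_mem {_} {_} hx := isHomogeneous_killCompl e he hx

lemma killHom_apply (x : MvPolynomial (Fin (M + 1)) k) : killHom k e he x = killCompl he x := rfl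

/-- Renaming variables is a degree-preserving section of `killHom`. The inclusion is what makes
`Proj.map` defined on all of projective space. -/
lemma irrelevant_le_map_killHom : irrelevant (homogeneousSubmodule (Fin (N + 1)) k) ≤
    (irrelevant (homogeneousSubmodule (Fin (M + 1)) k)).map (killHom k e he) := by
  rw [← toIdeal_le_toIdeal_iff, toIdeal_irrelevant_le]
  intro i hi x hx
  rw [← killCompl_rename_app (R := k) he x, ← killHom_apply]
  refine Ideal.mem_map_of_mem _ (mem_irrelevant_of_mem _ hi ?_)
  exact IsHomogeneous.rename_isHomogeneous hx

/-- The embedding of projective spaces. -/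
def projEmb : GScheme.projSpace k N ⟶ GScheme.projSpace k M :=
  Proj.map (killHom k e he) (irrelevant_le_map_killHom k e he)

lemma irrelevant_le_span_X : (irrelevant (homogeneousSubmodule (Fin (M + 1)) k)).toIdeal ≤
    Ideal.span (Set.range X) := by
  rw [toIdeal_irrelevant_le]
  intro i hi x hx
  rw [← Set.image_univ]
  refine mem_ideal_span_X_image.mpr fun m hm => ?_
  by_contra! h
  have : m = 0 := Finsupp.ext fun t => h t (Set.mem_univ t)
  have h₁ := (mem_homogeneousSubmodule i x).mp hx (mem_support_iff.mp hm)
  simp [this] at h₁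
  omega

lemma Away_map_killHom_surjective {i : ℕ} {s : MvPolynomial (Fin (M + 1)) k}
    (hs : s ∈ homogeneousSubmodule (Fin (M + 1)) k i) :
    Function.Surjective (Away.map (killHom k e he) s) := fun y => by
  obtain ⟨n, x, hx, rfl⟩ := y.mk_surjective _ ((killHom k e he).map_mem hs)
  have hx' : rename e x ∈ homogeneousSubmodule (Fin (M + 1)) k (n • i) :=
    IsHomogeneous.rename_isHomogeneous hx
  refine ⟨Away.mk _ hs n (rename e x) hx', ?_⟩
  rw [Away.map_mk]
  congr 1
  exact killCompl_rename_app he x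

/-- Over each standard chart the map is `Spec` of a surjection. Charts of variables outside the
range of `e` have empty preimage and need no separate treatment. -/
lemma isClosedImmersion_projMap : IsClosedImmersion
    (Proj.map (killHom k e he) (irrelevant_le_map_killHom k e he)) := by
  have hX : ∀ t : Fin (M + 1), (X t : MvPolynomial (Fin (M + 1)) k) ∈
    homogeneousSubmodule (Fin (M + 1)) k 1 := fun t => isHomogeneous_X k t
  refine of_isPullback_of_openCover (P := @IsClosedImmersion)
    (fun t : Fin (M + 1) => Proj.awayι (homogeneousSubmodule (Fin (N + 1)) k)
      (killHom k e he (X t)) ((killHom k e he).map_mem (hX t)) one_pos)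
    (fun t => Spec.map (CommRingCat.ofHom (Away.map (killHom k e he) (X t))))
    (fun t => Proj.awayι (homogeneousSubmodule (Fin (M + 1)) k) (X t) (hX t) one_pos)
    (fun y => ?_) (fun t => ?_) fun t => ?_
  · have := (Proj.iSup_basicOpen_eq_top _ X (irrelevant_le_span_X k)).ge (Set.mem_univ y)
    obtain ⟨t, ht⟩ := TopologicalSpace.Opens.mem_iSup.mp this
    rw [← Proj.opensRange_awayι _ _ (hX t) one_pos] at ht
    exact ⟨t, ht⟩
  · refine (IsOpenImmersion.isPullback _ _ _ _ (Proj.awayι_comp_map _ _ one_pos _ (hX t)) ?_).flip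
    rw [Proj.opensRange_awayι, Proj.opensRange_awayι, Proj.map_preimage_basicOpen]
  · exact IsClosedImmersion.spec_of_surjective _ (Away_map_killHom_surjective k e he (hX t))

instance : IsClosedImmersion (projEmb k e he) := isClosedImmersion_projMap k e he

lemma awayι_projMap_str {i : ℕ} (hi : 0 < i) {s : MvPolynomial (Fin (M + 1)) k}
    (hs : s ∈ homogeneousSubmodule (Fin (M + 1)) k i) :
    Proj.awayι (homogeneousSubmodule (Fin (N + 1)) k) (killHom k e he s)
        ((killHom k e he).map_mem hs) hi ≫
      Proj.map (killHom k e he) (irrelevant_le_map_killHom k e he) ≫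
      Proj.toSpecZero (homogeneousSubmodule (Fin (M + 1)) k) ≫ Spec.map (CommRingCat.ofHom
      (algebraMap k (homogeneousSubmodule (Fin (M + 1)) k 0))) =
    Proj.awayι (homogeneousSubmodule (Fin (N + 1)) k) (killHom k e he s)
        ((killHom k e he).map_mem hs) hi ≫
      Proj.toSpecZero (homogeneousSubmodule (Fin (N + 1)) k) ≫ Spec.map (CommRingCat.ofHom
      (algebraMap k (homogeneousSubmodule (Fin (N + 1)) k 0))) := by
  rw [Proj.awayι_comp_map_assoc _ _ hi _ hs, Proj.awayι_toSpecZero_assoc,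
    Proj.awayι_toSpecZero_assoc, ← Spec.map_comp, ← Spec.map_comp, ← Spec.map_comp]
  congr 1
  ext c
  refine congrArg HomogeneousLocalization.val ?_
  change Away.map (killHom k e he) s (HomogeneousLocalization.mk ⟨0, algebraMap k _ c, 1, _⟩) =
    HomogeneousLocalization.mk ⟨0, algebraMap k _ c, 1, _⟩
  rw [HomogeneousLocalization.Away.map, HomogeneousLocalization.map_mk]
  congr 1
  refine HomogeneousLocalization.NumDenSameDeg.ext _ rfl ?_ ?_
  · change killCompl he (algebraMap k (MvPolynomial (Fin (M + 1)) k) c) = algebraMap k _ c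
    exact AlgHom.commutes _ c
  · exact map_one (killCompl (R := k) he)

lemma projEmb_str : projEmb k e he ≫ GScheme.projSpaceStr k M = GScheme.projSpaceStr k N :=
  (Proj.mapAffineOpenCover _ (irrelevant_le_map_killHom k e he)).openCover.hom_ext _ _
    fun s => awayι_projMap_str k e he s.1.2 s.2.2

/-- Some coordinate `X t` is nonzero at the common point, while coordinates outside the range of `e`
vanish on the image of its embedding. So `t` lies in both ranges. -/
lemma exists_mem_range_of_projEmb_eq {e' : Fin (N + 1) → Fin (M + 1)}
    (he' : Function.Injective e') {x y : GScheme.projSpace k N}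
    (h : projEmb k e he x = projEmb k e' he' y) : ∃ i i', e i = e' i' := by
  have key : ∀ (e : Fin (N + 1) → Fin (M + 1)) (he : Function.Injective e) (t : Fin (M + 1))
      (x : GScheme.projSpace k N), projEmb k e he x ∈
        Proj.basicOpen (homogeneousSubmodule (Fin (M + 1)) k) (X t) → t ∈ Set.range e := by
    intro e he t x hx
    change x ∈ Proj.map (killHom k e he) (irrelevant_le_map_killHom k e he) ⁻¹ᵁ
      Proj.basicOpen (homogeneousSubmodule (Fin (M + 1)) k) (X t) at hx
    rw [Proj.map_preimage_basicOpen] at hx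
    by_contra ht
    rw [killHom_apply, killCompl, aeval_X, dif_neg ht, Proj.basicOpen_zero] at hx
    exact hx
  have := (Proj.iSup_basicOpen_eq_top _ X (irrelevant_le_span_X k)).ge
    (Set.mem_univ (projEmb k e he x))
  obtain ⟨t, ht⟩ := TopologicalSpace.Opens.mem_iSup.mp this
  obtain ⟨i, hi⟩ := key e he t x ht
  obtain ⟨i', hi'⟩ := key e' he' t y (h ▸ ht)
  exact ⟨i, i', hi.trans hi'.symm⟩

end ProjectiveSpace

/-! ### Projectivity and smoothness of the induced space -/

namespace GScheme

namespace IsInd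

variable {k : Type u} [Field k] {G : Type v} [Group G] {G' : Subgroup G} {X : GScheme k G'}
  {W : GScheme k G} {j : G → (X.X ⟶ W.X)} (h : IsInd X W j)

include h

lemma hom_ext {T : Scheme.{u}} {f f' : W.X ⟶ T} (hf : ∀ g, j g ≫ f = j g ≫ f') : f = f' :=
  (h.desc T (fun g => j g ≫ f) fun p g => by rw [← Category.assoc, h.act_j]).unique
    (fun _ => rfl) fun g => (hf g).symm

section Embedding

variable {m : ℕ} (T : Transversal G'.subtype m)

lemma act_transversal (g : G) : X.act (T.h g) ≫ j (T.r (T.c g)) = j g := by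
  rw [h.act_j]
  congr 1
  exact T.h_mul_r g

lemma exists_transversal_eq (y : W.X) : ∃ i x, j (T.r i) x = y := by
  obtain ⟨g, x, rfl⟩ := h.exists_eq y
  refine ⟨T.c g, X.act (T.h g) x, ?_⟩
  rw [← Scheme.Hom.comp_apply, h.act_transversal]

/-- An embedding of `X` in projective space induces an embedding of the induced space in a
projective space of larger dimension, whose components have images in disjoint linear
subspaces. -/
lemma exists_embedding [NeZero m] (T : Transversal G'.subtype m) (P : MorphismProperty Scheme.{u}) [IsZariskiLocalAtTarget P]
    (hP : ∀ {A B C : Scheme.{u}} (a : A ⟶ B) (b : B ⟶ C), P a → IsClosedImmersion b → P (a ≫ b))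
    {N : ℕ} (i : X.X ⟶ projSpace k N) (hi : P i) (hstr : i ≫ projSpaceStr k N = X.str) :
    ∃ (M : ℕ) (f : W.X ⟶ projSpace k M), P f ∧ f ≫ projSpaceStr k M = W.str := by
  -- The homogeneous coordinates of the larger space form `m` blocks of length `N + 1`, one for each
  -- coset; `e c` is the inclusion of block `c`.
  obtain ⟨M, hM⟩ : ∃ M, m * (N + 1) = M + 1 :=
    ⟨_, (Nat.sub_add_cancel (Nat.mul_pos (NeZero.pos m) N.succ_pos)).symm⟩
  let e : Fin m → Fin (N + 1) → Fin (M + 1) := fun c t => Fin.cast hM (finProdFinEquiv (c, t))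
  have he' : ∀ c c' t t', e c t = e c' t' → (c, t) = (c', t') := fun c c' t t' he =>
    finProdFinEquiv.injective (Fin.cast_injective hM he)
  have he : ∀ c, Function.Injective (e c) := fun c t t' ht => congrArg Prod.snd (he' _ _ _ _ ht)
  have ht : ∀ (p : G') (g : G), X.act p ≫ X.act (T.h g) ≫ i ≫ projEmb k (e (T.c g)) (he _) =
      X.act (T.h (p * g)) ≫ i ≫ projEmb k (e (T.c (p * g))) (he _) := fun p g => by
    have h₁ := T.h_mul p g
    have h₂ := T.c_mul p g
    simp only [Subgroup.subtype_apply] at h₁ h₂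
    rw [h₁, X.act_mul, Category.assoc]
    congr! 5
    exact h₂.symm
  obtain ⟨f, hf, -⟩ := h.desc _ (fun g => X.act (T.h g) ≫ i ≫ projEmb k (e (T.c g)) (he _)) ht
  have hfr : ∀ c, j (T.r c) ≫ f = i ≫ projEmb k (e c) (he c) := fun c => by
    rw [hf, T.h_r, X.act_one, Category.id_comp, T.c_r]
  have := h.isOpenImmersion
  refine ⟨M, f, ?_, h.hom_ext fun g => ?_⟩
  · refine of_disjoint_closed (fun c => j (T.r c)) (h.exists_transversal_eq T)
      (fun c => Set.range (projEmb k (e c) (he c)))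
      (fun c => (projEmb k (e c) (he c)).isClosedEmbedding.isClosed_range) ?_ ?_ ?_
    · intro c c' hc
      rw [Set.disjoint_left]
      rintro _ ⟨x, rfl⟩ ⟨y, hy⟩
      obtain ⟨t, t', ht⟩ := exists_mem_range_of_projEmb_eq k _ (he c) (he c') hy.symm
      exact hc (congrArg Prod.fst (he' _ _ _ _ ht))
    · intro c x
      rw [← Scheme.Hom.comp_apply, hfr, Scheme.Hom.comp_apply]
      exact ⟨_, rfl⟩
    · intro c
      rw [hfr]
      exact hP _ _ hi inferInstance
  · rw [← Category.assoc, hf, Category.assoc, Category.assoc, projEmb_str, hstr, X.act_str, h.j_str]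

variable [Finite G]

lemma exists_embedding' (P : MorphismProperty Scheme.{u}) [IsZariskiLocalAtTarget P]
    (hP : ∀ {A B C : Scheme.{u}} (a : A ⟶ B) (b : B ⟶ C), P a → IsClosedImmersion b → P (a ≫ b))
    (hX : ∃ (N : ℕ) (i : X.X ⟶ projSpace k N), P i ∧ i ≫ projSpaceStr k N = X.str) :
    ∃ (M : ℕ) (f : W.X ⟶ projSpace k M), P f ∧ f ≫ projSpaceStr k M = W.str := by
  obtain ⟨N, i, hi, hstr⟩ := hX
  obtain ⟨m, ⟨T⟩⟩ := exists_transversal (i := G'.subtype) G'.subtype_injective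
  have : NeZero m := ⟨fun hm => (hm ▸ T.c 1).elim0⟩
  exact h.exists_embedding T P hP i hi hstr

lemma isProjective (hX : X.IsProjective) : W.IsProjective :=
  h.exists_embedding' @IsClosedImmersion (fun _ _ _ _ => inferInstance) hX

lemma isQuasiProjective (hX : X.IsQuasiProjective) : W.IsQuasiProjective :=
  h.exists_embedding' @IsImmersion (fun _ _ _ _ => inferInstance) hX

lemma isVariety {n : ℕ} (hX : X.IsVariety n) : W.IsVariety n := by
  obtain ⟨h₁, h₂, h₃⟩ := hX
  have := h.isOpenImmersion
  have : IsZariskiLocalAtSource (@SmoothOfRelativeDimension.{u} n) :=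
    HasRingHomProperty.instIsZariskiLocalAtSource
      (Q := RingHom.Locally (RingHom.IsStandardSmoothOfRelativeDimension n))
  refine ⟨of_source_openCover (P := @SmoothOfRelativeDimension n) j h.exists_eq fun g => ?_,
    h.isQuasiProjective h₂, h.transitive_irreducibleComponents h₃⟩
  rw [h.j_str]
  exact h₁

end Embedding

end IsInd

end GScheme

/-! ## Cotangent spaces -/

section Cotangent

open IsLocalRing

variable {R S : Type u} [CommRing R] [IsLocalRing R] [CommRing S] [IsLocalRing S]
  {ι : Type*} [Fintype ι]

lemma sum_smul_toCotangent (r : ι → R) (t : ι → maximalIdeal R) :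
    ∑ i, residue R (r i) • ((maximalIdeal R).toCotangent (t i) : CotangentSpace R) =
      (maximalIdeal R).toCotangent (∑ i, r i • t i) := by
  rw [map_sum]
  refine Finset.sum_congr rfl fun i _ => ?_
  rw [map_smul]
  rfl

/-- A formulation with elements of `R`, as for spanning below. It carries over along a ring
isomorphism without semilinear maps between cotangent spaces over different residue fields. -/
lemma linearIndependent_toCotangent_iff (t : ι → maximalIdeal R) :
    LinearIndependent (ResidueField R)
      (fun i => ((maximalIdeal R).toCotangent (t i) : CotangentSpace R)) ↔
    ∀ r : ι → R, ∑ i, r i * (t i : R) ∈ maximalIdeal R ^ 2 → ∀ i, r i ∈ maximalIdeal R := by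
  rw [Fintype.linearIndependent_iff]
  have key : ∀ r : ι → R, ∑ i, residue R (r i) •
      ((maximalIdeal R).toCotangent (t i) : CotangentSpace R) = 0 ↔
      ∑ i, r i * (t i : R) ∈ maximalIdeal R ^ 2 := fun r => by
    rw [sum_smul_toCotangent]
    refine (Ideal.toCotangent_eq_zero _ _).trans ?_
    simp
  constructor
  · intro h r hr i
    exact (residue_eq_zero_iff _).mp (h (fun i => residue R (r i)) ((key r).mpr hr) i)
  · intro h r hr i
    choose r' hr' using fun i => residue_surjective (r i)
    obtain rfl : (fun i => residue R (r' i)) = r := funext hr'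
    exact (residue_eq_zero_iff _).mpr (h r' ((key r').mp hr) i)

lemma span_toCotangent_eq_top_iff (t : ι → maximalIdeal R) :
    Submodule.span (ResidueField R)
      (Set.range (fun i => ((maximalIdeal R).toCotangent (t i) : CotangentSpace R))) = ⊤ ↔
    ∀ s ∈ maximalIdeal R, ∃ r : ι → R, ∑ i, r i * (t i : R) - s ∈ maximalIdeal R ^ 2 := by
  have key : ∀ (r : ι → R) (s : maximalIdeal R), ∑ i, residue R (r i) •
      ((maximalIdeal R).toCotangent (t i) : CotangentSpace R) = (maximalIdeal R).toCotangent s ↔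
      ∑ i, r i * (t i : R) - s ∈ maximalIdeal R ^ 2 := fun r s => by
    rw [sum_smul_toCotangent, ← sub_eq_zero]
    refine (congrArg (· = 0) (map_sub ((maximalIdeal R).toCotangent) _ _)).to_iff.symm.trans ?_
    refine (Ideal.toCotangent_eq_zero _ _).trans ?_
    simp
  constructor
  · intro h s hs
    have := h.ge (Submodule.mem_top (x := ((maximalIdeal R).toCotangent ⟨s, hs⟩)))
    obtain ⟨r, hr⟩ := (Submodule.mem_span_range_iff_exists_fun _).mp this
    choose r' hr' using fun i => residue_surjective (r i)
    obtain rfl : (fun i => residue R (r' i)) = r := funext hr'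
    exact ⟨r', (key r' ⟨s, hs⟩).mp hr⟩
  · intro h
    refine eq_top_iff.mpr fun v _ => ?_
    obtain ⟨s, rfl⟩ := (maximalIdeal R).toCotangent_surjective v
    obtain ⟨r, hr⟩ := h s s.2
    exact (Submodule.mem_span_range_iff_exists_fun _).mpr ⟨_, (key r s).mpr hr⟩

lemma map_mem_maximalIdeal_iff (e : R ≃+* S) {r : R} :
    e r ∈ maximalIdeal S ↔ r ∈ maximalIdeal R := by
  rw [mem_maximalIdeal, mem_maximalIdeal, mem_nonunits_iff, mem_nonunits_iff, MulEquiv.isUnit_map]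

lemma map_mem_maximalIdeal_pow_iff (e : R ≃+* S) {n : ℕ} {r : R} :
    e r ∈ maximalIdeal S ^ n ↔ r ∈ maximalIdeal R ^ n := by
  have h : (maximalIdeal R).map e = maximalIdeal S := by
    ext s
    rw [Ideal.mem_map_of_equiv]
    obtain ⟨s, rfl⟩ := e.surjective s
    simp
  rw [← h, ← Ideal.map_pow, Ideal.mem_map_of_equiv]
  simp

lemma linearIndependent_toCotangent_of_ringEquiv (e : R ≃+* S) {t : ι → maximalIdeal R}
    {t' : ι → maximalIdeal S} (ht : ∀ i, e (t i) = t' i)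
    (h : LinearIndependent (ResidueField R)
      (fun i => ((maximalIdeal R).toCotangent (t i) : CotangentSpace R))) :
    LinearIndependent (ResidueField S)
      (fun i => ((maximalIdeal S).toCotangent (t' i) : CotangentSpace S)) := by
  rw [linearIndependent_toCotangent_iff] at h ⊢
  intro r hr i
  rw [← e.apply_symm_apply (r i), map_mem_maximalIdeal_iff]
  refine h (fun i => e.symm (r i)) ?_ i
  rw [← map_mem_maximalIdeal_pow_iff e]
  simpa [ht] using hr

lemma span_toCotangent_of_ringEquiv (e : R ≃+* S) {t : ι → maximalIdeal R}
    {t' : ι → maximalIdeal S} (ht : ∀ i, e (t i) = t' i)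
    (h : Submodule.span (ResidueField R)
      (Set.range (fun i => ((maximalIdeal R).toCotangent (t i) : CotangentSpace R))) = ⊤) :
    Submodule.span (ResidueField S)
      (Set.range (fun i => ((maximalIdeal S).toCotangent (t' i) : CotangentSpace S))) = ⊤ := by
  rw [span_toCotangent_eq_top_iff] at h ⊢
  intro s hs
  obtain ⟨s, rfl⟩ := e.surjective s
  obtain ⟨r, hr⟩ := h s ((map_mem_maximalIdeal_iff e).mp hs)
  refine ⟨fun i => e (r i), ?_⟩
  rw [← map_mem_maximalIdeal_pow_iff e] at hr
  simpa [ht] using hr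

end Cotangent

/-! ## Residue fields -/

/-- The homomorphism of residue fields induced by a morphism, at points `x` and `y = f x`. -/
def resMap {X Y : Scheme.{u}} (f : X ⟶ Y) {x : X} {y : Y} (h : f x = y) :
    Y.residueField y ⟶ X.residueField x :=
  (Y.residueFieldCongr h).inv ≫ f.residueFieldMap x

section ResMap

variable {X Y Z : Scheme.{u}} (f : X ⟶ Y)

lemma resMap_rfl (x : X) : resMap f (rfl : f x = f x) = f.residueFieldMap x := by
  simp [resMap]

/-- The inclusion of a residue point is a monomorphism. Identities between residue maps thus become
identities of morphisms of schemes, free of transport along equalities of points. -/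
lemma resMap_eq_iff {x : X} {y : Y} (h : f x = y) (φ : Y.residueField y ⟶ X.residueField x) :
    φ = resMap f h ↔ Spec.map φ ≫ Y.fromSpecResidueField y = X.fromSpecResidueField x ≫ f := by
  subst h
  rw [resMap_rfl, ← f.SpecMap_residueFieldMap_fromSpecResidueField, cancel_mono, Spec.map_inj]

lemma SpecMap_resMap {x : X} {y : Y} (h : f x = y) :
    Spec.map (resMap f h) ≫ Y.fromSpecResidueField y = X.fromSpecResidueField x ≫ f :=
  (resMap_eq_iff f h _).mp rfl

lemma resMap_resMap (g : Y ⟶ Z) {x : X} {y : Y} {z : Z} (h : f x = y) (h' : g y = z)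
    (fg : X ⟶ Z) (hfg : f ≫ g = fg) (h'' : fg x = z) (a : Z.residueField z) :
    resMap f h (resMap g h' a) = resMap fg h'' a := by
  subst hfg
  have := (resMap_eq_iff (f ≫ g) h'' (resMap g h' ≫ resMap f h)).mpr (by
    rw [Spec.map_comp, Category.assoc, SpecMap_resMap, ← Category.assoc, SpecMap_resMap,
      Category.assoc])
  rw [← this]
  rfl

lemma resMap_bijective [IsOpenImmersion f] {x : X} {y : Y} (h : f x = y) :
    Function.Bijective (resMap f h) := by
  subst h
  rw [resMap_rfl]
  exact ConcreteCategory.bijective_of_isIso (f.residueFieldMap x)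

end ResMap

namespace GScheme

variable {k : Type u} [Field k]

/-! ### Stalks and residue fields under morphisms over `k` -/

section Stalks

variable {G₁ : Type v} [Group G₁] {G : Type v} [Group G] {X : GScheme k G₁} {Y : GScheme k G}
  (f : X.X ⟶ Y.X)

lemma resMap_toResidueField (hf : f ≫ Y.str = X.str) {x : X.X} {y : Y.X} (h : f x = y) (c : k) :
    resMap f h (Y.toResidueField y c) = X.toResidueField x c := by
  have : Spec.preimage (Y.X.fromSpecResidueField y ≫ Y.str) ≫ resMap f h =
      Spec.preimage (X.X.fromSpecResidueField x ≫ X.str) := by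
    apply Spec.map_injective
    rw [Spec.map_comp, Spec.map_preimage, Spec.map_preimage, ← Category.assoc, SpecMap_resMap,
      Category.assoc, hf]
  rw [toResidueField, toResidueField, ← this]
  rfl

lemma stalkMap_toStalk (hf : f ≫ Y.str = X.str) (x : X.X) (c : k) :
    f.stalkMap x (Y.toStalk (f x) c) = X.toStalk x c := by
  have : Spec.preimage (Y.X.fromSpecStalk (f x) ≫ Y.str) ≫ f.stalkMap x =
      Spec.preimage (X.X.fromSpecStalk x ≫ X.str) := by
    apply Spec.map_injective
    rw [Spec.map_comp, Spec.map_preimage, Spec.map_preimage, ← Category.assoc,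
      Scheme.SpecMap_stalkMap_fromSpecStalk, Category.assoc, hf]
  rw [toStalk, toStalk, ← this]
  rfl

/-- The stalk map is an isomorphism: it carries the eigenbasis over, and conjugates the action on
one stalk to the action on the other. -/
lemma IsNormalChars.of_isOpenImmersion [IsOpenImmersion f] (hf : f ≫ Y.str = X.str)
    {H₁ : Subgroup G₁} {H : Subgroup G} (ι : G₁ → G) (hι : ∀ h ∈ H, ∃ h₁ ∈ H₁, ι h₁ = h)
    (hfι : ∀ h₁ ∈ H₁, X.act h₁ ≫ f = f ≫ Y.act (ι h₁))
    {β₁ : List (H₁ →* kˣ)} {β : List (H →* kˣ)} (hβ : CharsMatch ι β₁ β) {x : X.X}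
    (h : X.IsNormalChars H₁ x β₁) : Y.IsNormalChars H (f x) β := by
  obtain ⟨hl, hβ⟩ := List.forall₂_iff_get.mp hβ
  obtain ⟨t, h₁, h₂, h₃⟩ := h
  let e : Y.X.presheaf.stalk (f x) ≃+* X.X.presheaf.stalk x :=
    (asIso (f.stalkMap x)).commRingCatIsoToRingEquiv
  let c := finCongr hl.symm
  let t' : Fin β.length → IsLocalRing.maximalIdeal (Y.X.presheaf.stalk (f x)) := fun i =>
    ⟨e.symm (t (c i)), (map_mem_maximalIdeal_iff e.symm).mpr (t (c i)).2⟩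
  have ht : ∀ i, e.symm (t (c i)) = t' i := fun i => rfl
  refine ⟨t', linearIndependent_toCotangent_of_ringEquiv e.symm ht (h₁.comp _ c.injective),
    span_toCotangent_of_ringEquiv e.symm ht ?_, fun h => ?_⟩
  · rw [← h₂]
    congr 1
    exact c.surjective.range_comp fun i =>
      ((IsLocalRing.maximalIdeal (X.X.presheaf.stalk x)).toCotangent (t i) :
        IsLocalRing.CotangentSpace (X.X.presheaf.stalk x))
  · obtain ⟨p, hp, hph⟩ := hι h h.2
    obtain ⟨α, hα, hαt⟩ := h₃ ⟨p, hp⟩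
    refine ⟨f.stalkMap x ≫ α ≫ inv (f.stalkMap x), ?_, fun i => ?_⟩
    · rw [← cancel_epi (Spec.map (f.stalkMap x)), ← Category.assoc, ← Spec.map_comp,
        Category.assoc, Category.assoc, IsIso.inv_hom_id, Category.comp_id, Spec.map_comp,
        Category.assoc, Scheme.SpecMap_stalkMap_fromSpecStalk,
        Scheme.SpecMap_stalkMap_fromSpecStalk_assoc, ← Category.assoc, hα, Category.assoc,
        hfι p hp, hph]
    · rw [← map_mem_maximalIdeal_pow_iff e]
      have he : ∀ a, e a = f.stalkMap x a := fun a => rfl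
      have h₄ : β.get i h = β₁.get (c i) ⟨p, hp⟩ :=
        hβ i (c i).2 i.2 ⟨p, hp⟩ h hph.symm
      have h₅ : f.stalkMap x (t' i) = t (c i) := e.apply_symm_apply _
      have h₆ : ∀ a, f.stalkMap x (inv (f.stalkMap x) a) = a := fun a => by
        rw [← ConcreteCategory.comp_apply, IsIso.inv_hom_id]
        rfl
      have h₇ : f.stalkMap x ((f.stalkMap x ≫ α ≫ inv (f.stalkMap x)).hom (t' i)) =
          α.hom (t (c i)) := by
        change f.stalkMap x (inv (f.stalkMap x) (α (f.stalkMap x (t' i)))) = _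
        rw [h₆, h₅]
      rw [he, map_sub, map_mul, h₇, h₅, stalkMap_toStalk f hf, h₄]
      exact hαt (c i)

end Stalks

end GScheme

namespace GScheme

namespace IsInd

variable {k : Type u} [Field k] {G : Type v} [Group G] {G' : Subgroup G} {X : GScheme k G'}
  {W : GScheme k G} {j : G → (X.X ⟶ W.X)} (h : IsInd X W j) {n : ℕ}

include h

/-! ## Symbols of the induced space -/

/-- The points of the `Z_G(H)`-orbit of `j 1 x` are the `j z x'` with `z ∈ Z_G(H)` and `x'` in the
`Z_{G'}(H)`-orbit of `x`. Functions on this orbit with values in the residue fields amount to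
equivariant functions `Z_G(H) → k(F)`, that is, to elements of the coinduced algebra. -/
lemma isSymbolAt {x : X.X} {s : Symb k G' n} {t : Symb k G n} (hst : IsInducedSymb s t)
    (hs : X.IsSymbolAt x s) : W.IsSymbolAt (j 1 x) t := by
  obtain ⟨hH, ⟨EV, hEV, hEV'⟩, hβ⟩ := hst
  obtain ⟨hH', hN, ev, hev, hevk, hevρ⟩ := hs
  have := h.isOpenImmersion
  have hcent : ∀ p : G', (p : G) ∈ Subgroup.centralizer (t.H : Set G) ↔
      p ∈ Subgroup.centralizer (s.H : Set G') := fun p => by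
    rw [hH]
    simp only [Subgroup.mem_centralizer_iff]
    constructor
    · intro hp q hq
      exact Subtype.ext (hp q ⟨q, hq, rfl⟩)
    · rintro hp _ ⟨q, hq, rfl⟩
      exact congrArg Subtype.val (hp q hq)
  refine ⟨by rw [hH, hH', h.stab], ?_, ?_⟩
  · refine hN.of_isOpenImmersion (j 1) (h.j_str 1) (fun p => p) (fun q hq => ?_)
      (fun p _ => ?_) hβ
    · rw [hH] at hq
      exact hq
    · rw [h.act_j, h.j_act, mul_one, one_mul]
  -- The value of `b` at `y = j z x'` is prescribed to be the value at `x'` of `EV (z · b)`. Two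
  -- presentations of `y` differ by an element of `Z_{G'}(H)`, and equivariance of `EV` and `ev`
  -- shows that they agree.
  have key : ∀ y ∈ W.centralizerOrbit t.H (j 1 x),
      ∃ φ : t.A.K →+* W.X.residueField y,
        ∀ (z : Subgroup.centralizer (t.H : Set G)) (x' : X.X)
          (hx' : x' ∈ X.centralizerOrbit s.H x) (e : j z x' = y) (b : t.A.K),
          resMap (j z) e (φ b) = ev x' hx' (EV (t.A.ρ z b)) := by
    rintro _ ⟨z, hz, rfl⟩
    have hx : x ∈ X.centralizerOrbit s.H x := ⟨1, one_mem _, by rw [X.act_one_apply]⟩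
    have hj : j z x = W.act z (j 1 x) := h.eq_act z x
    let r := RingEquiv.ofBijective (resMap (j z) hj).hom (resMap_bijective (j z) hj)
    have hr : ∀ a, resMap (j z) hj (r.symm a) = a := r.apply_symm_apply
    refine ⟨(r.symm : _ →+* _).comp ((ev x hx).comp ((EV : t.A.K →+* s.A.K).comp
      (t.A.ρ ⟨z, hz⟩ : t.A.K →+* t.A.K))), fun z' x' hx' e b => ?_⟩
    change resMap (j z') e (r.symm (ev x hx (EV (t.A.ρ ⟨z, hz⟩ b)))) = _
    obtain ⟨p, hp, rfl⟩ := h.eq_iff.mp (e.trans hj.symm)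
    have hpc : p ∈ Subgroup.centralizer (s.H : Set G') := by
      rw [← hcent, eq_mul_inv_of_mul_eq hp]
      exact mul_mem hz (inv_mem z'.2)
    have hjp : X.act p ≫ j z' = j z := by rw [h.act_j, hp]
    apply (resMap_bijective (X.act p) (rfl : X.act p x = _)).1
    rw [resMap_resMap _ _ _ _ _ hjp hj, hr]
    have h₁ := hevρ ⟨p, hpc⟩ (EV (t.A.ρ z' b)) x hx hx'
    rw [resMap_rfl]
    refine Eq.trans ?_ h₁
    rw [← hEV ⟨p, hpc⟩ ⟨p, (hcent p).mpr hpc⟩ _ rfl, ← AlgEquiv.mul_apply, ← map_mul]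
    congr
    exact hp.symm
  choose φ hφ using key
  have horb : ∀ (z : Subgroup.centralizer (t.H : Set G)) (x' : X.X),
      x' ∈ X.centralizerOrbit s.H x → j z x' ∈ W.centralizerOrbit t.H (j 1 x) := by
    rintro z _ ⟨p, hp, rfl⟩
    exact ⟨p * z, mul_mem ((hcent p).mpr hp) z.2, by rw [h.act_j_apply, h.eq_act]⟩
  have horb' : ∀ y ∈ W.centralizerOrbit t.H (j 1 x), ∃ (z : Subgroup.centralizer (t.H : Set G))
      (x' : X.X) (_ : x' ∈ X.centralizerOrbit s.H x), j z x' = y := by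
    rintro _ ⟨z, hz, rfl⟩
    exact ⟨⟨z, hz⟩, x, ⟨1, one_mem _, by rw [X.act_one_apply]⟩, h.eq_act z x⟩
  refine ⟨φ, fun f => ?_, fun y hy c => ?_, fun q a y hy hy' => ?_⟩
  -- The element `F q` of `k(F)` is the pullback of `f` along `j q`.
  · choose F hF using fun q : Subgroup.centralizer (t.H : Set G) => hev fun x' hx' => resMap (j q) rfl (f (j q x') (horb q x' hx'))
    have hF' : ∀ (p : Subgroup.centralizer (s.H : Set G'))
        (q q' : Subgroup.centralizer (t.H : Set G)), (q' : G) = G'.subtype p * q →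
        F q' = s.A.ρ p (F q) := by
      intro p q q' hq
      refine ((hF q').2 _ fun x' hx' => ?_).symm
      have hx'' : X.act p x' ∈ X.centralizerOrbit s.H x := by
        obtain ⟨z, hz, rfl⟩ := hx'
        exact ⟨z * p, mul_mem hz p.2, by rw [X.act_mul_apply]⟩
      have hjp : X.act p ≫ j q = j q' := by rw [h.act_j, hq]; rfl
      have hjp' : j q (X.act p x') = j q' x' := by rw [← hjp, Scheme.Hom.comp_apply]
      rw [hevρ p (F q) x' hx' hx'', (hF q).1, ← resMap_rfl,
        resMap_resMap _ _ _ _ _ hjp hjp'.symm]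
      have hf : ∀ y hy (e : j q' x' = y), resMap (j q') e (f y hy) =
          resMap (j q') rfl (f (j q' x') (horb q' x' hx')) := by
        rintro _ _ rfl
        rfl
      exact hf _ _ _
    refine (existsUnique_congr fun b => ?_).mp (hEV' F hF')
    constructor
    · intro hb y hy
      obtain ⟨z, x', hx', rfl⟩ := horb' y hy
      apply (resMap_bijective (j z) rfl).1
      rw [hφ _ hy z x' hx', hb, (hF z).1]
    · intro hb q
      refine (hF q).2 _ fun x' hx' => ?_
      rw [← hφ _ (horb q x' hx') q x' hx' rfl, hb]
  · obtain ⟨z, x', hx', rfl⟩ := horb' y hy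
    apply (resMap_bijective (j z) rfl).1
    rw [hφ _ hy z x' hx', resMap_toResidueField _ (h.j_str z), AlgEquiv.commutes,
      AlgHom.commutes, hevk]
  · obtain ⟨z, x', hx', rfl⟩ := horb' y hy
    apply (resMap_bijective (j z) rfl).1
    have e : j (z * q : Subgroup.centralizer (t.H : Set G)) x' = W.act q (j z x') :=
      (h.j_act_apply z q x').symm
    rw [hφ _ hy z x' hx', ← resMap_rfl, resMap_resMap _ _ _ _ _ (h.j_act z q) e]
    refine Eq.trans ?_ (hφ _ hy' (z * q) x' hx' e a).symm
    rw [map_mul, AlgEquiv.mul_apply]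

/-- Every `G`-orbit of strata meets the copy `j 1`, and two points of this copy are `G`-conjugate
exactly when they are `G'`-conjugate in `X`. So the same index set serves for both sums. -/
lemma isStrataSum [Finite G] {c : Burn k G' n} (hc : X.IsStrataSum c) :
    W.IsStrataSum (indHom k G' n c) := by
  obtain ⟨m, x, s, h₁, h₂, h₃, rfl⟩ := hc
  refine ⟨m, fun i => j 1 (x i), fun i => indSymb (s i), fun i => h.isStratum_iff.mpr (h₁ i),
    fun y hy => ?_, fun i => h.isSymbolAt (isInducedSymb_indSymb _) (h₃ i), ?_⟩
  · obtain ⟨g, x', rfl⟩ := h.exists_eq_act y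
    refine (existsUnique_congr fun i => ?_).mp
      (h₂ x' (h.isStratum_iff.mp (isStratum_act_iff.mp hy)))
    constructor
    · rintro ⟨p, hp⟩
      refine ⟨g⁻¹ * p, ?_⟩
      change _ = j 1 (x i)
      rw [← W.act_mul_apply, mul_inv_cancel_left, h.j_act_apply, ← hp, h.act_j_apply, one_mul,
        mul_one]
    · rintro ⟨γ, hγ⟩
      change _ = j 1 (x i) at hγ
      rw [h.j_act_apply, h.j_act_apply] at hγ
      obtain ⟨p, -, hp⟩ := h.eq_iff.mp hγ.symm
      exact ⟨p, hp⟩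
  · rw [map_sum]
    exact Finset.sum_congr rfl fun i _ => indHom_cls (s i)

end IsInd

end GScheme

/-! ## Sections -/

section Sections

variable {X Y Z : Scheme.{u}}

lemma appLE_appLE_apply (f : X ⟶ Y) (g : Y ⟶ Z) {fg : X ⟶ Z} (hfg : f ≫ g = fg) {U : Z.Opens}
    {V : Y.Opens} {O : X.Opens} (e₁ : V ≤ g ⁻¹ᵁ U) (e₂ : O ≤ f ⁻¹ᵁ V) (e : O ≤ fg ⁻¹ᵁ U)
    (s : Γ(Z, U)) : f.appLE V O e₂ (g.appLE U V e₁ s) = fg.appLE U O e s := by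
  subst hfg
  rw [← f.appLE_comp_appLE g U V O e₁ e₂]
  rfl

lemma map_appLE_apply (f : X ⟶ Y) {U U' : Y.Opens} {V : X.Opens} (e : V ≤ f ⁻¹ᵁ U) (i : U ≤ U')
    (e' : V ≤ f ⁻¹ᵁ U') (s : Γ(Y, U')) :
    f.appLE U V e (Y.presheaf.map (homOfLE i).op s) = f.appLE U' V e' s := by
  rw [← f.map_appLE e (homOfLE i).op]
  rfl

lemma appLE_map_apply (f : X ⟶ Y) {U : Y.Opens} {V V' : X.Opens} (e : V ≤ f ⁻¹ᵁ U) (i : V' ≤ V)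
    (e' : V' ≤ f ⁻¹ᵁ U) (s : Γ(Y, U)) :
    X.presheaf.map (homOfLE i).op (f.appLE U V e s) = f.appLE U V' e' s := by
  rw [← f.appLE_map e (homOfLE i).op]
  rfl

lemma appLE_bijective (f : X ⟶ Y) [IsOpenImmersion f] {U : Y.Opens} {V : X.Opens}
    (hU : U ≤ f.opensRange) (hV : V = f ⁻¹ᵁ U) : Function.Bijective (f.appLE U V hV.le) := by
  subst hV
  have := f.isIso_app U hU
  rw [f.appLE_eq_app]
  exact ConcreteCategory.bijective_of_isIso (f.app U)

lemma evaluation_eq_of_le {U V : X.Opens} (i : V ≤ U) {x : X} (hx : x ∈ V) (s : Γ(X, U)) :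
    X.evaluation V x hx (X.presheaf.map (homOfLE i).op s) = X.evaluation U x (i hx) s := by
  rw [← X.germ_residue, ← X.germ_residue, ← X.presheaf.germ_res (homOfLE i) x hx]
  rfl

lemma resMap_evaluation (f : X ⟶ Y) {U : Y.Opens} {V : X.Opens} (e : V ≤ f ⁻¹ᵁ U) {x : X}
    (hx : x ∈ V) (hx' : f x ∈ U) (s : Γ(Y, U)) : resMap f rfl (Y.evaluation U (f x) hx' s) =
      X.evaluation V x hx (f.appLE U V e s) := by
  rw [resMap_rfl, Scheme.evaluation_naturality_apply, ← evaluation_eq_of_le e hx]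
  rfl

end Sections

namespace GScheme

/-- An enumeration of the elements of `G`. -/
def groupEquiv (G : Type v) [Finite G] : ULift.{u} (Fin (Nat.card G)) ≃ G :=
  Equiv.ulift.trans (Finite.equivFin G).symm

/-! ## Line bundles on the induced space -/

namespace IsInd

variable {k : Type u} [Field k] {G : Type v} [Group G] {G' : Subgroup G} {X : GScheme k G'}
  {W : GScheme k G} {j : G → (X.X ⟶ W.X)} (h : IsInd X W j)

include h

/-- The translate of an open subset of `X`. -/
def translate (U : X.X.Opens) (γ : G) : W.X.Opens :=
  have := h.isOpenImmersion γ
  j γ ''ᵁ U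

lemma mem_translate {U : X.X.Opens} {γ : G} {y : W.X} :
    y ∈ h.translate U γ ↔ ∃ x ∈ U, j γ x = y := Iff.rfl

lemma apply_mem_translate {U : X.X.Opens} {γ : G} {x : X.X} :
    j γ x ∈ h.translate U γ ↔ x ∈ U := by
  rw [mem_translate]
  exact ⟨fun ⟨x', hx', e⟩ => h.injective γ e ▸ hx', fun hx => ⟨x, hx, rfl⟩⟩

lemma translate_le (U : X.X.Opens) (γ : G) :
    h.translate U γ ≤ @Scheme.Hom.opensRange _ _ (j γ) (h.isOpenImmersion γ) := by
  rintro _ ⟨x, -, rfl⟩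
  exact ⟨x, rfl⟩

lemma exists_of_mem_translate {U U' : X.X.Opens} {γ γ' g : G} {y : W.X}
    (hy : y ∈ h.translate U γ ⊓ W.act g ⁻¹ᵁ h.translate U' γ') :
    ∃ p : G', (p : G) * γ' = γ * g := by
  obtain ⟨⟨x, -, rfl⟩, ⟨x', -, hx'⟩⟩ := hy
  obtain ⟨p, hp, -⟩ := h.eq_iff.mp (hx'.trans (h.j_act_apply γ g x))
  exact ⟨p, hp⟩

lemma preimage_translate {U U' : X.X.Opens} {γ γ' g : G} {p : G'} (hp : (p : G) * γ' = γ * g) :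
    U ⊓ X.act p ⁻¹ᵁ U' = j γ ⁻¹ᵁ (h.translate U γ ⊓ W.act g ⁻¹ᵁ h.translate U' γ') := by
  ext x
  change x ∈ U ∧ X.act p x ∈ U' ↔ j γ x ∈ h.translate U γ ∧ W.act g (j γ x) ∈ h.translate U' γ'
  rw [h.apply_mem_translate, h.j_act_apply, ← hp, ← h.act_j_apply, h.apply_mem_translate]

/-- The overlap of two translates is empty unless `γ g γ'⁻¹ ∈ G'`. In that case it is a copy of an
overlap in `X`, from which the transition function is carried over. Quantifying over `p` treats both
cases at once, as at most one `p` exists. -/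
lemma exists_section (L : X.LineBundle) (g γ γ' : G) (i i' : L.ι) :
    ∃ s : Γ(W.X, h.translate (L.U i) γ ⊓ W.act g ⁻¹ᵁ h.translate (L.U i') γ'),
      ∀ (p : G') (hp : (p : G) * γ' = γ * g),
        (j γ).appLE _ _ (h.preimage_translate hp).le s = L.a p i i' := by
  have := h.isOpenImmersion γ
  by_cases hp : ∃ p : G', (p : G) * γ' = γ * g
  · obtain ⟨p, hp⟩ := hp
    obtain ⟨s, hs⟩ := (appLE_bijective (j γ) (inf_le_left.trans (h.translate_le _ γ))
      (h.preimage_translate hp)).2 (L.a p i i')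
    refine ⟨s, fun p' hp' => ?_⟩
    obtain rfl : p' = p := Subtype.ext (mul_right_cancel (hp'.trans hp.symm))
    exact hs
  · exact ⟨0, fun p hp' => (hp ⟨p, hp'⟩).elim⟩

/-- The transition functions of the line bundle on the induced space. -/
def transition (L : X.LineBundle) (g γ γ' : G) (i i' : L.ι) :
    Γ(W.X, h.translate (L.U i) γ ⊓ W.act g ⁻¹ᵁ h.translate (L.U i') γ') :=
  (h.exists_section L g γ γ' i i').choose

lemma appLE_transition (L : X.LineBundle) {g γ γ' : G} (i i' : L.ι) {p : G'}
    (hp : (p : G) * γ' = γ * g) : (j γ).appLE _ _ (h.preimage_translate hp).le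
      (h.transition L g γ γ' i i') = L.a p i i' :=
  (h.exists_section L g γ γ' i i').choose_spec p hp

lemma transition_one (L : X.LineBundle) (γ : G) (i : L.ι) : h.transition L 1 γ γ i i = 1 := by
  have := h.isOpenImmersion γ
  have hp : ((1 : G') : G) * γ = γ * 1 := by simp
  refine (appLE_bijective (j γ)
    (inf_le_left.trans (h.translate_le _ _)) (h.preimage_translate hp)).1 ?_
  rw [h.appLE_transition L i i hp, map_one, L.a_one]

/-- A point of `O` shows that both transitions come from elements of `G'`, and pullback along `j γ`
then gives the identity for `L`. If `O` is empty there is nothing to check. -/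
lemma transition_mul (L : X.LineBundle) (g g' γ γ' γ'' : G) (i i' i'' : L.ι) (O : W.X.Opens)
    (h₁ : O ≤ h.translate (L.U i) γ ⊓ W.act (g * g') ⁻¹ᵁ h.translate (L.U i'') γ'')
    (h₂ : O ≤ h.translate (L.U i) γ ⊓ W.act g ⁻¹ᵁ h.translate (L.U i') γ')
    (h₃ : O ≤ W.act g ⁻¹ᵁ (h.translate (L.U i') γ' ⊓ W.act g' ⁻¹ᵁ h.translate (L.U i'') γ'')) :
    W.X.presheaf.map (homOfLE h₁).op (h.transition L (g * g') γ γ'' i i'') =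
      W.X.presheaf.map (homOfLE h₂).op (h.transition L g γ γ' i i') *
        (W.act g).appLE _ O h₃ (h.transition L g' γ' γ'' i' i'') := by
  have := h.isOpenImmersion γ
  by_cases hO : ∃ y, y ∈ O
  · obtain ⟨y, hy⟩ := hO
    obtain ⟨p, hp⟩ := h.exists_of_mem_translate (h₂ hy)
    obtain ⟨p', hp'⟩ := h.exists_of_mem_translate (h₃ hy)
    have hpp : ((p * p' : G') : G) * γ'' = γ * (g * g') := by
      rw [Subgroup.coe_mul, mul_assoc, hp', ← mul_assoc, hp, mul_assoc]
    have hjp : X.act p ≫ j γ' = j (γ * g) := by rw [h.act_j, hp]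
    refine (appLE_bijective (j γ) (V := j γ ⁻¹ᵁ O)
      (h₂.trans (inf_le_left.trans (h.translate_le _ γ))) rfl).1 ?_
    have e₁ : j γ ⁻¹ᵁ O ≤ L.U i ⊓ X.act (p * p') ⁻¹ᵁ L.U i'' :=
      ((j γ).preimage_mono h₁).trans (h.preimage_translate hpp).ge
    have e₂ : j γ ⁻¹ᵁ O ≤ L.U i ⊓ X.act p ⁻¹ᵁ L.U i' :=
      ((j γ).preimage_mono h₂).trans (h.preimage_translate hp).ge
    have e₃' : j γ ⁻¹ᵁ O ≤ j (γ * g) ⁻¹ᵁ (h.translate (L.U i') γ' ⊓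
        W.act g' ⁻¹ᵁ h.translate (L.U i'') γ'') := by
      rw [← h.j_act]
      exact (j γ).preimage_mono h₃
    have e₃ : j γ ⁻¹ᵁ O ≤ X.act p ⁻¹ᵁ (L.U i' ⊓ X.act p' ⁻¹ᵁ L.U i'') := by
      rw [h.preimage_translate hp', ← Scheme.Hom.comp_preimage, hjp]
      exact e₃'
    rw [map_mul, map_appLE_apply _ _ _ (e₁.trans (h.preimage_translate hpp).le),
      map_appLE_apply _ _ _ (e₂.trans (h.preimage_translate hp).le),
      ← appLE_map_apply (j γ) (h.preimage_translate hpp).le e₁,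
      ← appLE_map_apply (j γ) (h.preimage_translate hp).le e₂,
      h.appLE_transition L i i'' hpp, h.appLE_transition L i i' hp,
      appLE_appLE_apply _ _ (h.j_act γ g) _ _ e₃',
      ← appLE_appLE_apply _ _ hjp (h.preimage_translate hp').le e₃,
      h.appLE_transition L i' i'' hp', ← L.a_mul]
  · obtain rfl : O = ⊥ := le_bot_iff.mp fun y hy => hO ⟨y, hy⟩
    exact Subsingleton.elim _ _

/-- The line bundle on the induced space which restricts to a given line bundle on `X`. -/
def lineBundle [Finite G] (L : X.LineBundle) : W.LineBundle where
  ι := L.ι × ULift.{u} (Fin (Nat.card G))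
  U i := h.translate (L.U i.1) (groupEquiv G i.2)
  cover y := by
    obtain ⟨g, x, rfl⟩ := h.exists_eq y
    obtain ⟨i, hi⟩ := L.cover x
    refine ⟨(i, (groupEquiv G).symm g), ?_⟩
    rw [Equiv.apply_symm_apply, h.apply_mem_translate]
    exact hi
  a g i i' := h.transition L g (groupEquiv G i.2) (groupEquiv G i'.2) i.1 i'.1
  a_one _ := h.transition_one L _ _
  a_mul g g' _ _ _ := h.transition_mul L g g' _ _ _ _ _ _

lemma evaluation_transition (L : X.LineBundle) (i : L.ι) {γ g : G} {p : G'}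
    (hp : (p : G) * γ = γ * g) {x : X.X} {c : k} (hx : x ∈ L.U i ⊓ X.act p ⁻¹ᵁ L.U i)
    (hc : X.X.evaluation _ x hx (L.a p i i) = X.toResidueField x c) :
    ∃ hx' : j γ x ∈ h.translate (L.U i) γ ⊓ W.act g ⁻¹ᵁ h.translate (L.U i) γ,
      W.X.evaluation _ (j γ x) hx' (h.transition L g γ γ i i) =
        W.toResidueField (j γ x) c := by
  have := h.isOpenImmersion γ
  have hx' := (h.preimage_translate hp).le hx
  refine ⟨hx', (resMap_bijective (j γ) rfl).1 ?_⟩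
  rw [resMap_toResidueField _ (h.j_str γ)]
  refine (resMap_evaluation (j γ) (h.preimage_translate hp).le hx hx'
    (h.transition L g γ γ i i)).trans ?_
  rw [h.appLE_transition L i i hp]
  exact hc

lemma lineBundle_hasCharacter [Finite G] (L : X.LineBundle) (γ : G) {x : X.X}
    {χ : X.stab x →* kˣ} {χ' : W.stab (j γ x) →* kˣ}
    (hχ : ∀ (g : W.stab (j γ x)) (p : X.stab x), ((p : G') : G) * γ = γ * g → χ p = χ' g)
    (hL : L.HasCharacter x χ) : (h.lineBundle L).HasCharacter (j γ x) χ' := by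
  obtain ⟨i, hi⟩ := hL
  obtain ⟨a, rfl⟩ := (groupEquiv G).surjective γ
  refine ⟨(i, a), fun g => ?_⟩
  obtain ⟨p, hp, hpg⟩ : groupEquiv G a * g * (groupEquiv G a)⁻¹ ∈
      (X.stab x).map G'.subtype := by
    rw [← h.stab, ← mem_stab_act, ← h.eq_act]
    exact g.2
  replace hpg : (p : G) * groupEquiv G a = groupEquiv G a * g := by
    rw [← Subgroup.subtype_apply, hpg, inv_mul_cancel_right]
  obtain ⟨hx, hi⟩ := hi ⟨p, hp⟩
  rw [hχ g ⟨p, hp⟩ hpg] at hi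
  exact h.evaluation_transition L i hpg hx hi

lemma isDivisorial [Finite G] (hX : X.IsDivisorial) : W.IsDivisorial := by
  obtain ⟨h₁, h₂⟩ := hX
  refine ⟨fun y a ha b hb => ?_, fun y hy χ => ?_⟩
  · obtain ⟨g, x, rfl⟩ := h.exists_eq_act y
    rw [mem_stab_act, h.stab] at ha hb
    obtain ⟨p, hp, hpa⟩ := ha
    obtain ⟨q, hq, hqb⟩ := hb
    have := congrArg G'.subtype (h₁ x p hp q hq)
    rw [map_mul, map_mul, hpa, hqb] at this
    simp only [← mul_assoc, inv_mul_cancel_right, mul_left_inj] at this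
    simpa only [mul_assoc, mul_right_inj] using this
  · obtain ⟨g, x, rfl⟩ := h.exists_eq y
    have hstab : ∀ p : G', p ∈ X.stab x ↔ g⁻¹ * p * g ∈ W.stab (j g x) := fun p => by
      rw [h.eq_act, mem_stab_act, h.stab]
      simp [mul_assoc]
    -- The stabilizer at `j g x` is a conjugate of that at `x`. The given character is pulled back
    -- to `X.stab x`, where `X` provides a line bundle.
    let f : X.stab x →* W.stab (j g x) :=
      { toFun p := ⟨g⁻¹ * (p : G') * g, (hstab p).mp p.2⟩
        map_one' := Subtype.ext (by simp)
        map_mul' p q := Subtype.ext (by simp [mul_assoc]) }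
    rw [h.eq_act, isStratum_act_iff, h.isStratum_iff] at hy
    obtain ⟨L, hL⟩ := h₂ x hy (χ.comp f)
    refine ⟨h.lineBundle L, h.lineBundle_hasCharacter L g (fun γ p hp => ?_) hL⟩
    rw [MonoidHom.comp_apply]
    congr 1
    refine Subtype.ext ?_
    change g⁻¹ * (p : G') * g = γ
    rw [mul_assoc, hp, inv_mul_cancel_left]

end IsInd

end GScheme

namespace GScheme

/-! ## Morphisms of induced spaces -/

namespace IsInd

variable {k : Type u} [Field k] {G : Type v} [Group G] {G' : Subgroup G} {X : GScheme k G'}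
  {W : GScheme k G} {j : G → (X.X ⟶ W.X)} (h : IsInd X W j)
  {E : GScheme k G'} {WE : GScheme k G} {jE : G → (E.X ⟶ WE.X)} (hE : IsInd E WE jE)

lemma dense_opens {U : X.X.Opens} (hU : Dense (U : Set X.X)) : Dense (h.opens U : Set W.X) := by
  intro y
  obtain ⟨g, x, rfl⟩ := h.exists_eq y
  refine closure_mono ?_ (image_closure_subset_closure_image (j g).continuous ⟨x, hU x, rfl⟩)
  rintro _ ⟨z, hz, rfl⟩
  exact h.mem_opens.mpr ⟨g, z, hz, rfl⟩

section Map

variable {f : E.X ⟶ X.X} (hf : E.IsEquivariant X f)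

include hE h hf

lemma exists_map : ∃ F : WE.X ⟶ W.X, ∀ g, jE g ≫ F = f ≫ j g := by
  obtain ⟨F, hF, -⟩ := hE.desc W.X (fun g => f ≫ j g) fun p g => by
    rw [← Category.assoc, hf.2, Category.assoc, h.act_j]
  exact ⟨F, hF⟩

variable {F : WE.X ⟶ W.X} (hF : ∀ g, jE g ≫ F = f ≫ j g)

include hF

lemma isEquivariant_map : WE.IsEquivariant W F := by
  refine ⟨hE.hom_ext fun g => ?_, fun γ => hE.hom_ext fun g => ?_⟩
  · rw [← Category.assoc, hF, Category.assoc, h.j_str, hf.1, hE.j_str]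
  · rw [← Category.assoc, hE.j_act, hF, ← Category.assoc, hF, Category.assoc, h.j_act]

omit hf in
lemma mem_range_of_map_eq {g : G} {x : X.X} {y : WE.X} (hxy : j g x = F y) :
    y ∈ Set.range (jE g) := by
  obtain ⟨g', e, rfl⟩ := hE.exists_eq y
  have : F (jE g' e) = j g' (f e) := by
    rw [← Scheme.Hom.comp_apply, hF, Scheme.Hom.comp_apply]
  obtain ⟨p, rfl, -⟩ := h.eq_iff.mp (this.symm.trans hxy.symm)
  refine ⟨E.act p⁻¹ e, ?_⟩
  rw [hE.act_j_apply]
  simp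

omit hf in
-- The preimage of a copy of `X` is the corresponding copy of `E`. Locally on the target, `F` is
-- therefore `f`, and target-local properties pass from `f` to `F`.
lemma isPullback_map (g : G) : IsPullback (jE g) f F (j g) := by
  have := h.isOpenImmersion g
  have := hE.isOpenImmersion g
  refine (IsOpenImmersion.isPullback _ _ _ _ (hF g) ?_).flip
  ext y
  constructor
  · rintro ⟨x, hx⟩
    exact h.mem_range_of_map_eq hE hF hx
  · rintro ⟨e, rfl⟩
    refine ⟨f e, ?_⟩
    rw [← Scheme.Hom.comp_apply, ← Scheme.Hom.comp_apply, hF]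

omit hf in
lemma of_map {P : MorphismProperty Scheme.{u}} [IsZariskiLocalAtTarget P] (hP : P f) : P F :=
  have := h.isOpenImmersion
  of_isPullback_of_openCover jE (fun _ => f) j h.exists_eq (h.isPullback_map hE hF) fun _ => hP

lemma preimage_opens (V : X.X.Opens) : F ⁻¹ᵁ h.opens V = hE.opens (f ⁻¹ᵁ V) := by
  have hFj : ∀ g e, F (jE g e) = j g (f e) := fun g e => by
    rw [← Scheme.Hom.comp_apply, hF, Scheme.Hom.comp_apply]
  ext y
  change F y ∈ h.opens V ↔ y ∈ hE.opens _
  rw [h.mem_opens, hE.mem_opens]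
  constructor
  · rintro ⟨g, x, hx, hxy⟩
    obtain ⟨g', e, rfl⟩ := hE.exists_eq y
    rw [hFj] at hxy
    obtain ⟨p, rfl, rfl⟩ := h.eq_iff.mp hxy
    refine ⟨g, E.act p e, ?_, hE.act_j_apply p g e⟩
    change f (E.act p e) ∈ V
    rwa [← Scheme.Hom.comp_apply, hf.2, Scheme.Hom.comp_apply]
  · rintro ⟨g, e, he, rfl⟩
    exact ⟨g, f e, he, (hFj g e).symm⟩

omit hf in
lemma isIso_morphismRestrict_map (V : X.X.Opens) [IsIso (f ∣_ V)] :
    IsIso (F ∣_ h.opens V) := by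
  have := h.isOpenImmersion
  have hle : ∀ g, Set.range (V.ι ≫ j g) ⊆ Set.range (h.opens V).ι := by
    rintro g _ ⟨x, rfl⟩
    rw [Scheme.Opens.range_ι]
    exact h.mem_opens.mpr ⟨g, V.ι x, x.2, rfl⟩
  let v : ∀ g, V.toScheme ⟶ (h.opens V).toScheme := fun g =>
    IsOpenImmersion.lift (h.opens V).ι (V.ι ≫ j g) (hle g)
  have hv : ∀ g, v g ≫ (h.opens V).ι = V.ι ≫ j g := fun g =>
    IsOpenImmersion.lift_fac _ _ (hle g)
  have : ∀ g, IsOpenImmersion (v g) := fun g => by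
    have : IsOpenImmersion (v g ≫ (h.opens V).ι) := by rw [hv]; infer_instance
    exact IsOpenImmersion.of_comp (v g) (h.opens V).ι
  have hp : ∀ g, IsPullback ((f ⁻¹ᵁ V).ι ≫ jE g) (f ∣_ V) F (v g ≫ (h.opens V).ι) := fun g => by
    rw [hv]
    exact (isPullback_morphismRestrict f V).flip.paste_horiz (h.isPullback_map hE hF g)
  refine of_isPullback_of_openCover (P := MorphismProperty.isomorphisms Scheme.{u}) _
    (fun _ : G => f ∣_ V) v (fun y => ?_)
    (fun g => (hp g).of_right' (isPullback_morphismRestrict F (h.opens V)).flip)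
    fun g => (inferInstance : IsIso (f ∣_ V))
  obtain ⟨g, x, hx, hxy⟩ := h.mem_opens.mp y.2
  refine ⟨g, ⟨x, hx⟩, (h.opens V).ι.injective ?_⟩
  exact (congrArg (fun φ => φ (⟨x, hx⟩ : V)) (hv g)).trans hxy

lemma isModification_map (hm : E.IsModification X f) : WE.IsModification W F := by
  obtain ⟨-, h₁, V, h₂, h₃, h₄⟩ := hm
  refine ⟨h.isEquivariant_map hE hf hF, h.of_map hE hF (P := @IsProper) h₁, h.opens V,
    h.dense_opens h₂, ?_, h.isIso_morphismRestrict_map hE hF V⟩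
  rw [h.preimage_opens hE hf hF]
  exact hE.dense_opens h₃

end Map

end IsInd

end GScheme

namespace GScheme

namespace IsInd

variable {k : Type u} [Field k] {G : Type v} [Group G] {G' : Subgroup G} {X : GScheme k G'}
  {W : GScheme k G} {j : G → (X.X ⟶ W.X)} (h : IsInd X W j)

include h

/-! ## Invariant ideals on the induced space -/

/-- The complement is the union of the other copies, which are open. So `j g` is also a closed
immersion, hence affine: preimages of affine opens are affine, and ideals push forward. -/
lemma isClosed_range (g : G) : IsClosed (Set.range (j g)) := by
  have := h.isOpenImmersion
  have : (Set.range (j g))ᶜ = ⋃ g' : {g' : G // g' * g⁻¹ ∉ G'}, Set.range (j g') := by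
    ext y
    simp only [Set.mem_compl_iff, Set.mem_iUnion, Subtype.exists]
    constructor
    · intro hy
      obtain ⟨g', x, rfl⟩ := h.exists_eq y
      refine ⟨g', fun hg => hy ⟨X.act ⟨_, hg⟩ x, ?_⟩, x, rfl⟩
      rw [h.act_j_apply]
      simp
    · rintro ⟨g', hg', x', rfl⟩ ⟨x, hx⟩
      exact hg' (h.mem_of_eq _ _ _ _ hx)
  rw [← isOpen_compl_iff, this]
  exact isOpen_iUnion fun g' => (j g').isOpenEmbedding.isOpen_range

lemma isAffineHom (g : G) : IsAffineHom (j g) :=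
  have := h.isOpenImmersion g
  have := IsClosedImmersion.of_isPreimmersion (j g) (h.isClosed_range g)
  inferInstance

lemma translate_isAffineOpen {U : X.X.Opens} (hU : IsAffineOpen U) (g : G) :
    IsAffineOpen (h.translate U g) :=
  have := h.isOpenImmersion g
  hU.image_of_isOpenImmersion (j g)

lemma preimage_translate_self (U : X.X.Opens) (g : G) : U = j g ⁻¹ᵁ h.translate U g :=
  have := h.isOpenImmersion g
  ((j g).preimage_image_eq U).symm

lemma appLE_translate_bijective (U : X.X.Opens) (g : G) :
    Function.Bijective ((j g).appLE (h.translate U g) U (h.preimage_translate_self U g).le) :=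
  have := h.isOpenImmersion g
  appLE_bijective (j g) (h.translate_le U g) (h.preimage_translate_self U g)

section Ideal

variable {I : X.X.IdealSheafData} {J : W.X.IdealSheafData}

lemma mem_ideal_translate {g : G} (hJ : J.comap (j g) = I) (U : X.X.affineOpens)
    (f : Γ(W.X, h.translate U.1 g)) :
    f ∈ J.ideal ⟨_, h.translate_isAffineOpen U.2 g⟩ ↔
      (j g).appLE _ U.1 (h.preimage_translate_self U.1 g).le f ∈ I.ideal U := by
  have := h.isOpenImmersion g
  subst hJ
  rw [Scheme.IdealSheafData.ideal_comap_of_isOpenImmersion, Ideal.mem_comap]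
  have : ((j g).appIso U.1).inv ((j g).appLE (j g ''ᵁ U.1) U.1
      (h.preimage_translate_self U.1 g).le f) = f := by
    rw [← Scheme.Hom.appIso_hom']
    exact ConcreteCategory.congr_hom ((j g).appIso U.1).hom_inv_id f
  exact (congrArg (· ∈ J.ideal ⟨_, h.translate_isAffineOpen U.2 g⟩) this).to_iff.symm

lemma appLE_mem_ideal {g : G} (hJ : J.comap (j g) = I) {V : W.X.affineOpens}
    {U : X.X.affineOpens} (hUV : U.1 ≤ j g ⁻¹ᵁ V.1) {f : Γ(W.X, V.1)} (hf : f ∈ J.ideal V) :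
    (j g).appLE V.1 U.1 hUV f ∈ I.ideal U := by
  have hle : h.translate U.1 g ≤ V.1 := by
    rintro _ ⟨x, hx, rfl⟩
    exact hUV hx
  have := (h.mem_ideal_translate hJ U (W.X.presheaf.map (homOfLE hle).op f)).mp (by
    rw [← J.map_ideal (U := ⟨_, h.translate_isAffineOpen U.2 g⟩) (V := V) hle]
    exact Ideal.mem_map_of_mem _ hf)
  rwa [map_appLE_apply _ _ _ hUV] at this

omit h in
lemma mem_support_iff (hJ : ∀ g, J.comap (j g) = I) {g : G} {x : X.X} :
    j g x ∈ J.support ↔ x ∈ I.support := by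
  rw [← hJ g, Scheme.IdealSheafData.support_comap]
  rfl

omit h in
lemma comap_finset_sup {ℓ : ℕ} {I : Fin ℓ → X.X.IdealSheafData} {J : Fin ℓ → W.X.IdealSheafData}
    {g : G} (hJ : ∀ i, (J i).comap (j g) = I i) (S : Finset (Fin ℓ)) :
    (S.sup J).comap (j g) = S.sup I := by
  induction S using Finset.induction_on with
  | empty => simp
  | insert i S hi ih => rw [Finset.sup_insert, Finset.sup_insert, Scheme.IdealSheafData.comap_sup,
      hJ, ih]

/-- The ideal `J` is the intersection of the pushforwards of `I` along all `j g`; a section belongs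
to it when all its pullbacks lie in `I`. -/
lemma exists_ideal [Finite G] (hI : X.IsInvariantIdeal I) :
    ∃ J : W.X.IdealSheafData, W.IsInvariantIdeal J ∧ ∀ g, J.comap (j g) = I := by
  have := h.isOpenImmersion
  have := h.isAffineHom
  let J : W.X.IdealSheafData := ⨅ g, I.map (j g)
  have hJ : ∀ (U : W.X.affineOpens) (f : Γ(W.X, U.1)), f ∈ J.ideal U ↔
      ∀ g, (j g).appLE U.1 _ le_rfl f ∈ I.ideal ⟨j g ⁻¹ᵁ U.1, U.2.preimage (j g)⟩ := by
    intro U f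
    rw [Scheme.IdealSheafData.ideal_iInf, iInf_apply, Ideal.mem_iInf]
    refine forall_congr' fun g => ?_
    rw [Scheme.IdealSheafData.ideal_map_of_isAffineHom, Ideal.mem_comap, Scheme.Hom.appLE_eq_app]
  refine ⟨J, fun γ U V hUV f hf => ?_, fun g => ?_⟩
  · rw [hJ] at hf ⊢
    intro g
    have hle : j g ⁻¹ᵁ V.1 ≤ j (g * γ) ⁻¹ᵁ U.1 := by
      rw [← h.j_act]
      exact (j g).preimage_mono hUV
    rw [appLE_appLE_apply _ _ (h.j_act g γ) _ _ hle, ← appLE_map_apply _ le_rfl hle,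
      ← I.map_ideal (U := ⟨_, V.2.preimage (j g)⟩) (V := ⟨_, U.2.preimage (j (g * γ))⟩) hle]
    exact Ideal.mem_map_of_mem _ (hf _)
  · refine Scheme.IdealSheafData.ext_of_iSup_eq_top (fun U : X.X.affineOpens => U)
      (iSup_affineOpens_eq_top X.X) fun U => ?_
    ext f
    obtain ⟨f, rfl⟩ := (h.appLE_translate_bijective U.1 g).2 f
    rw [← h.mem_ideal_translate rfl U, hJ]
    constructor
    · intro hf
      rw [← appLE_map_apply (j g) le_rfl (h.preimage_translate_self U.1 g).le,
        ← I.map_ideal (U := U)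
          (V := ⟨_, (h.translate_isAffineOpen U.2 g).preimage (j g)⟩)
          (h.preimage_translate_self U.1 g).le]
      exact Ideal.mem_map_of_mem _ (hf g)
    · intro hf g'
      -- In the same coset, invariance of `I` gives the condition at `g'` from that at `g`. Copies
      -- for other cosets do not meet the translate.
      by_cases hg : g' * g⁻¹ ∈ G'
      · have hjp : X.act ⟨_, hg⟩ ≫ j g = j g' := by
          rw [h.act_j]
          simp
        have hle : j g' ⁻¹ᵁ h.translate U.1 g ≤ X.act ⟨_, hg⟩ ⁻¹ᵁ U.1 := by
          conv_rhs => rw [h.preimage_translate_self U.1 g]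
          rw [← Scheme.Hom.comp_preimage, hjp]
        have := hI ⟨_, hg⟩ U ⟨_, (h.translate_isAffineOpen U.2 g).preimage (j g')⟩ hle _ hf
        rwa [appLE_appLE_apply _ _ hjp _ _ le_rfl] at this
      · have hbot : j g' ⁻¹ᵁ h.translate U.1 g = ⊥ := by
          refine le_bot_iff.mp fun x hx => hg ?_
          obtain ⟨x', -, hx'⟩ := hx
          exact h.mem_of_eq _ _ _ _ hx'
        have : Subsingleton Γ(X.X, j g' ⁻¹ᵁ h.translate U.1 g) := by
          rw [hbot]
          infer_instance
        rw [Subsingleton.elim ((j g').appLE _ _ le_rfl f) 0]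
        exact zero_mem _

lemma isSNC {ℓ : ℕ} {I : Fin ℓ → X.X.IdealSheafData} {J : Fin ℓ → W.X.IdealSheafData}
    (hJ : ∀ i g, (J i).comap (j g) = I i) (hI : X.IsSNC I) : W.IsSNC J := by
  intro y
  obtain ⟨g, x, rfl⟩ := h.exists_eq y
  obtain ⟨U, hx, f, h₁, h₂⟩ := hI x
  choose f' hf' using fun i => (h.appLE_translate_bijective U.1 g).2 (f i)
  have hx' : j g x ∈ h.translate U.1 g := h.apply_mem_translate.mpr hx
  refine ⟨⟨_, h.translate_isAffineOpen U.2 g⟩, hx', f', fun i => ?_, ?_⟩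
  · ext a
    rw [h.mem_ideal_translate (hJ i g) U, h₁, Ideal.mem_span_singleton,
      Ideal.mem_span_singleton, ← hf']
    exact map_dvd_iff (RingEquiv.ofBijective _ (h.appLE_translate_bijective U.1 g))
  · have := h.isOpenImmersion g
    let e : W.X.presheaf.stalk (j g x) ≃+* X.X.presheaf.stalk x :=
      (asIso ((j g).stalkMap x)).commRingCatIsoToRingEquiv
    have he : ∀ i, e (W.X.presheaf.germ _ _ hx' (f' i)) = X.X.presheaf.germ U.1 x hx (f i) := by
      intro i
      refine (Scheme.Hom.germ_stalkMap_apply (j g) _ x hx' (f' i)).trans ?_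
      rw [← hf', ← X.X.presheaf.germ_res_apply
        (homOfLE (h.preimage_translate_self U.1 g).le) x hx]
      rfl
    have hmem : ∀ i, W.X.presheaf.germ _ _ hx' (f' i) ∈
        IsLocalRing.maximalIdeal (W.X.presheaf.stalk (j g x)) → X.X.presheaf.germ U.1 x hx (f i) ∈
        IsLocalRing.maximalIdeal (X.X.presheaf.stalk x) := fun i hi => by
      rw [← he]
      exact (map_mem_maximalIdeal_iff e).mpr hi
    have := Fintype.ofFinite {i // W.X.presheaf.germ _ _ hx' (f' i) ∈
        IsLocalRing.maximalIdeal (W.X.presheaf.stalk (j g x))}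
    exact linearIndependent_toCotangent_of_ringEquiv e.symm
      (t := fun i : {i // W.X.presheaf.germ _ _ hx' (f' i) ∈
        IsLocalRing.maximalIdeal (W.X.presheaf.stalk (j g x))} => ⟨_, hmem i i.2⟩)
      (t' := fun i => ⟨_, i.2⟩)
      (fun i => e.symm_apply_eq.mpr (he i).symm)
      (h₂.comp (fun i : {i // W.X.presheaf.germ _ _ hx' (f' i) ∈
        IsLocalRing.maximalIdeal (W.X.presheaf.stalk (j g x))} => ⟨i.1, hmem i.1 i.2⟩)
        fun i i' hi => Subtype.ext (congrArg (fun a => a.1) hi))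

end Ideal

end IsInd

end GScheme

namespace GScheme

namespace IsInd

variable {k : Type u} [Field k] {G : Type v} [Group G] {G' : Subgroup G} {X : GScheme k G'}
  {W : GScheme k G} {j : G → (X.X ⟶ W.X)} (h : IsInd X W j)

include h

/-! ## Glueing of sections -/

/-- The open sets `N g` are only required to equal the preimages, so that for a bundle `π` they can
be given as preimages under `π` of open sets of the base. -/
lemma section_ext {O : W.X.Opens} {N : G → X.X.Opens} (hN : ∀ g, N g = j g ⁻¹ᵁ O)
    {s t : Γ(W.X, O)} (hst : ∀ g, (j g).appLE O (N g) (hN g).le s =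
      (j g).appLE O (N g) (hN g).le t) : s = t := by
  have := h.isOpenImmersion
  refine W.X.sheaf.eq_of_locally_eq' (fun g => O ⊓ (j g).opensRange) O
    (fun g => homOfLE inf_le_left) (fun y hy => ?_) s t fun g => ?_
  · obtain ⟨g, x, rfl⟩ := h.exists_eq y
    exact TopologicalSpace.Opens.mem_iSup.mpr ⟨g, hy, x, rfl⟩
  · have hNg : N g = j g ⁻¹ᵁ (O ⊓ (j g).opensRange) := by
      rw [hN]
      ext x
      exact ⟨fun hx => ⟨hx, x, rfl⟩, fun hx => hx.1⟩
    refine (appLE_bijective (j g) inf_le_right hNg).1 ?_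
    refine (map_appLE_apply (j g) hNg.le inf_le_left (hN g).le s).trans ?_
    rw [hst]
    exact (map_appLE_apply (j g) hNg.le inf_le_left (hN g).le t).symm

/-- Sections on the copies are glued by the sheaf property. Copies overlap only within one coset of
`G'`, where `hs` is the required compatibility. -/
lemma exists_section_eq (O : W.X.Opens) (N : G → X.X.Opens) (hN : ∀ g, N g = j g ⁻¹ᵁ O)
    (s : ∀ g, Γ(X.X, N g)) (hs : ∀ (p : G') (g : G) (e : N (p * g) ≤ X.act p ⁻¹ᵁ N g),
      (X.act p).appLE (N g) (N (p * g)) e (s g) = s (p * g)) :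
    ∃ t : Γ(W.X, O), ∀ g, (j g).appLE O (N g) (hN g).le t = s g := by
  have := h.isOpenImmersion
  have hNg : ∀ g, N g = j g ⁻¹ᵁ (O ⊓ (j g).opensRange) := fun g => by
    rw [hN]
    ext x
    exact ⟨fun hx => ⟨hx, x, rfl⟩, fun hx => hx.1⟩
  have hNp : ∀ (p : G') g, N (p * g) ≤ X.act p ⁻¹ᵁ N g := fun p g => by
    rw [hN, hN, ← Scheme.Hom.comp_preimage, h.act_j]
  choose t ht using fun g => (appLE_bijective (j g) inf_le_right (hNg g)).2 (s g)
  have hc : TopCat.Presheaf.IsCompatible W.X.sheaf.obj (fun g => O ⊓ (j g).opensRange) t := by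
    intro g g'
    change W.X.presheaf.map (homOfLE _).op (t g) = W.X.presheaf.map (homOfLE _).op (t g')
    by_cases hg : g' * g⁻¹ ∈ G'
    · obtain ⟨p, rfl⟩ : ∃ p : G', p * g = g' := ⟨⟨_, hg⟩, by simp⟩
      have hNi : N (p * g) = j (p * g) ⁻¹ᵁ ((O ⊓ (j g).opensRange) ⊓
          (O ⊓ (j (p * g)).opensRange)) := by
        rw [hN]
        ext x
        refine ⟨fun hx => ⟨⟨hx, X.act p x, ?_⟩, hx, x, rfl⟩, fun hx => hx.2.1⟩
        rw [h.act_j_apply]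
      have hNi' : N (p * g) ≤ j (p * g) ⁻¹ᵁ (O ⊓ (j g).opensRange) :=
        hNi.le.trans ((j (p * g)).preimage_mono inf_le_left)
      refine (appLE_bijective (j (p * g)) (inf_le_right.trans inf_le_right) hNi).1 ?_
      rw [map_appLE_apply (j (p * g)) hNi.le inf_le_left hNi' (t g),
        map_appLE_apply (j (p * g)) hNi.le inf_le_right (hNg (p * g)).le (t (p * g)), ht,
        ← hs p g (hNp p g), ← ht g]
      exact (appLE_appLE_apply _ _ (h.act_j p g) _ _ hNi' (t g)).symm
    · have : Subsingleton Γ(W.X, (O ⊓ (j g).opensRange) ⊓ (O ⊓ (j g').opensRange)) := by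
        have : (O ⊓ (j g).opensRange) ⊓ (O ⊓ (j g').opensRange) = ⊥ := by
          refine le_bot_iff.mp ?_
          rintro y ⟨⟨-, x, rfl⟩, -, x', hx'⟩
          exact hg (h.mem_of_eq _ _ _ _ hx'.symm)
        rw [this]
        infer_instance
      exact Subsingleton.elim _ _
  obtain ⟨t₀, ht₀, -⟩ := W.X.sheaf.existsUnique_gluing' (fun g => O ⊓ (j g).opensRange) O
    (fun g => homOfLE inf_le_left) (fun y hy => by
      obtain ⟨g, x, rfl⟩ := h.exists_eq y
      exact TopologicalSpace.Opens.mem_iSup.mpr ⟨g, hy, x, rfl⟩) t hc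
  refine ⟨t₀, fun g => ?_⟩
  rw [← ht g, ← ht₀ g]
  exact (map_appLE_apply (j g) (hNg g).le inf_le_left (hN g).le t₀).symm
end IsInd

end GScheme

namespace GScheme

namespace IsInd

variable {k : Type u} [Field k] {G : Type v} [Group G] {G' : Subgroup G} {X : GScheme k G'}
  {W : GScheme k G} {j : G → (X.X ⟶ W.X)} (h : IsInd X W j)
  {E : GScheme k G'} {WE : GScheme k G} {jE : G → (E.X ⟶ WE.X)} (hE : IsInd E WE jE)

/-! ## Normal bundles on induced spaces -/

section NormalBundle

variable {I : X.X.IdealSheafData} {J : W.X.IdealSheafData} (hJ : ∀ g, J.comap (j g) = I)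
  {π : E.X ⟶ X.X} {F : WE.X ⟶ W.X} (hF : ∀ g, jE g ≫ F = π ≫ j g)

/-- The preimage in `X` of an affine open subset of the induced space. -/
def preimageAffine (V : W.X.affineOpens) (g : G) : X.X.affineOpens :=
  ⟨j g ⁻¹ᵁ V.1, have := h.isAffineHom g; V.2.preimage (j g)⟩

lemma preimageAffine_coe (V : W.X.affineOpens) (g : G) :
    (h.preimageAffine V g).1 = j g ⁻¹ᵁ V.1 := rfl

lemma preimageAffine_le (V : W.X.affineOpens) (g : G) :
    (h.preimageAffine V g).1 ≤ j g ⁻¹ᵁ V.1 := le_rfl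

/-- Restriction of sections of an ideal on the induced space. -/
def resIdeal (g : G) (V : W.X.affineOpens) (U : X.X.affineOpens) (hUV : U.1 ≤ j g ⁻¹ᵁ V.1)
    (f : J.ideal V) : I.ideal U :=
  ⟨(j g).appLE V.1 U.1 hUV f.1, h.appLE_mem_ideal (hJ g) hUV f.2⟩

include hF in
lemma preimage_le {g : G} {V : W.X.Opens} {U : X.X.Opens} (hUV : U ≤ j g ⁻¹ᵁ V) :
    π ⁻¹ᵁ U ≤ jE g ⁻¹ᵁ F ⁻¹ᵁ V := by
  rw [← Scheme.Hom.comp_preimage, hF]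
  exact π.preimage_mono hUV

include hF in
lemma preimage_eq {g : G} {V : W.X.Opens} {U : X.X.Opens} (hUV : U = j g ⁻¹ᵁ V) :
    π ⁻¹ᵁ U = jE g ⁻¹ᵁ F ⁻¹ᵁ V := by
  rw [← Scheme.Hom.comp_preimage, hF, hUV]
  rfl

include hE in
/-- The conormal map of the induced space restricts to the conormal map of `X`. -/
lemma exists_conormal (l : ∀ U : X.X.affineOpens, I.ideal U →+ Γ(E.X, π ⁻¹ᵁ U.1))
    (hl : ∀ (p : G') (U V : X.X.affineOpens) (e : V.1 ≤ X.act p ⁻¹ᵁ U.1)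
      (e' : π ⁻¹ᵁ V.1 ≤ E.act p ⁻¹ᵁ (π ⁻¹ᵁ U.1)) (f : I.ideal U) (f' : I.ideal V),
      f'.1 = (X.act p).appLE U.1 V.1 e f.1 →
        l V f' = (E.act p).appLE (π ⁻¹ᵁ U.1) (π ⁻¹ᵁ V.1) e' (l U f)) (V : W.X.affineOpens) :
    ∃ lV : J.ideal V →+ Γ(WE.X, F ⁻¹ᵁ V.1), ∀ (g : G) (U : X.X.affineOpens)
      (hUV : U.1 ≤ j g ⁻¹ᵁ V.1) (f : J.ideal V),
      (jE g).appLE (F ⁻¹ᵁ V.1) (π ⁻¹ᵁ U.1) (preimage_le hF hUV) (lV f) =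
        l U (h.resIdeal hJ g V U hUV f) := by
  have hN : ∀ g, π ⁻¹ᵁ (h.preimageAffine V g).1 = jE g ⁻¹ᵁ F ⁻¹ᵁ V.1 := fun g =>
    preimage_eq hF (h.preimageAffine_coe V g)
  have key : ∀ f : J.ideal V, ∃ s : Γ(WE.X, F ⁻¹ᵁ V.1), ∀ g,
      (jE g).appLE _ _ (hN g).le s = l (h.preimageAffine V g) (h.resIdeal hJ g V _ (h.preimageAffine_le V g) f) := by
    intro f
    refine hE.exists_section_eq (F ⁻¹ᵁ V.1) _ hN _ fun p g e => ?_
    have e' : (h.preimageAffine V (p * g)).1 ≤ X.act p ⁻¹ᵁ (h.preimageAffine V g).1 := by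
      rw [h.preimageAffine_coe, h.preimageAffine_coe, ← Scheme.Hom.comp_preimage, h.act_j]
    exact (hl p _ _ e' e _ _ (appLE_appLE_apply (X.act p) (j g) (h.act_j p g)
      (h.preimageAffine_le V g) e' (h.preimageAffine_le V (p * g)) f.1).symm).symm
  choose s hs using key
  refine ⟨AddMonoidHom.mk' s fun f f' => hE.section_ext hN fun g => ?_, fun g U hUV f => ?_⟩
  · rw [hs, map_add, hs, hs, ← map_add]
    congr 1
    exact Subtype.ext (map_add _ _ _)
  -- For a smaller `U`, the identity follows from that for the full preimage of `V`, restriction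
  -- being the case `p = 1` of the equivariance of `l`.
  · have e₁ : (1 : G') * g = g := one_mul g
    have hjE : E.act 1 ≫ jE g = jE g := by rw [E.act_one, Category.id_comp]
    have hj : X.act 1 ≫ j g = j g := by rw [X.act_one, Category.id_comp]
    have e : U.1 ≤ X.act 1 ⁻¹ᵁ j g ⁻¹ᵁ V.1 := by
      rw [← Scheme.Hom.comp_preimage, hj]
      exact hUV
    have e' : π ⁻¹ᵁ U.1 ≤ E.act 1 ⁻¹ᵁ π ⁻¹ᵁ j g ⁻¹ᵁ V.1 := by
      rw [E.act_one]
      exact π.preimage_mono hUV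
    have hres : (h.resIdeal hJ g V U hUV f).1 = (X.act 1).appLE (h.preimageAffine V g).1 U.1 e
        (h.resIdeal hJ g V _ (h.preimageAffine_le V g) f).1 :=
      (appLE_appLE_apply (X.act 1) (j g) hj (h.preimageAffine_le V g) e hUV f.1).symm
    refine Eq.trans ?_ (hl 1 (h.preimageAffine V g) U e e'
      (h.resIdeal hJ g V _ (h.preimageAffine_le V g) f) (h.resIdeal hJ g V U hUV f) hres).symm
    rw [← hs]
    exact (appLE_appLE_apply (E.act 1) (jE g) hjE (hN g).le e' (preimage_le hF hUV) (s f)).symm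

include h hE hJ hF

/-- Identities between sections are checked on each copy. The universal property is needed only on
an affine cover, for which translates of affine opens of `X` suffice. -/
lemma isNormalBundle (hE' : X.IsNormalBundle I E π) : W.IsNormalBundle J WE F := by
  obtain ⟨hπ, hπa, l, hl₁, hl₂, hl₃, hl₄⟩ := hE'
  choose L hL using h.exists_conormal hE hJ hF l hl₃
  have hFπ : ∀ (g : G) (V : W.X.Opens) (U : X.X.Opens) (hUV : U ≤ j g ⁻¹ᵁ V) (r : Γ(W.X, V)),
      (jE g).appLE (F ⁻¹ᵁ V) (π ⁻¹ᵁ U) (preimage_le hF hUV) (F.app V r) =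
        π.app U ((j g).appLE V U hUV r) := fun g V U hUV r => by
    have e : π ⁻¹ᵁ U ≤ (π ≫ j g) ⁻¹ᵁ V := π.preimage_mono hUV
    rw [Scheme.Hom.app_eq_appLE, Scheme.Hom.app_eq_appLE,
      appLE_appLE_apply _ _ (hF g) _ _ e, appLE_appLE_apply _ _ rfl _ _ e]
  have hN : ∀ (V : W.X.affineOpens) g, π ⁻¹ᵁ (h.preimageAffine V g).1 = jE g ⁻¹ᵁ F ⁻¹ᵁ V.1 :=
    fun V g => preimage_eq hF (h.preimageAffine_coe V g)
  have : IsZariskiLocalAtTarget @IsAffineHom.{u} := 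
    (HasAffineProperty.iff.mp AlgebraicGeometry.instHasAffinePropertyIsAffineHomIsAffine).1
  refine ⟨h.isEquivariant_map hE hπ hF, h.of_map hE hF (P := @IsAffineHom) hπa, L,
    fun V r f => hE.section_ext (hN V) fun g => ?_, fun V f => hE.section_ext (hN V) fun g => ?_,
    fun γ U V e e' f f' hff' => hE.section_ext (hN V) fun g => ?_, fun y => ?_⟩
  · rw [hL V g _ (h.preimageAffine_le V g), map_mul, hL V g _ (h.preimageAffine_le V g), hFπ g V.1 _ (h.preimageAffine_le V g), ← hl₁]
    congr 1
    exact Subtype.ext (map_mul _ _ _)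
  · rw [hFπ g V.1 _ (h.preimageAffine_le V g), map_zero]
    exact hl₂ _ (h.resIdeal hJ g V _ (h.preimageAffine_le V g) f)
  · have e₁ : (h.preimageAffine V g).1 ≤ j (g * γ) ⁻¹ᵁ U.1 := by
      rw [← h.j_act]
      exact (j g).preimage_mono e
    rw [hL V g _ (h.preimageAffine_le V g), appLE_appLE_apply _ _ (hE.j_act g γ) _ _ (preimage_le hF e₁),
      hL U (g * γ) _ e₁]
    congr 1
    refine Subtype.ext ?_
    change (j g).appLE V.1 _ _ f'.1 = (j (g * γ)).appLE U.1 _ _ f.1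
    rw [hff']
    exact appLE_appLE_apply (j g) (W.act γ) (h.j_act g γ) e (h.preimageAffine_le V g) e₁ f.1
  · obtain ⟨g, x, rfl⟩ := h.exists_eq y
    obtain ⟨U, hx, hU⟩ := hl₄ x
    have := hE.isOpenImmersion g
    let V : W.X.affineOpens := ⟨_, h.translate_isAffineOpen U.2 g⟩
    have hUV : U.1 = j g ⁻¹ᵁ V.1 := h.preimage_translate_self U.1 g
    refine ⟨V, h.apply_mem_translate.mpr hx, fun R _ p m hp hm => ?_⟩
    -- On the translate of `U`, the maps `j g` and `jE g` induce isomorphisms `a` and `b` on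
    -- sections, and the universal property is transported along these.
    let a : Γ(W.X, V.1) ≃+* Γ(X.X, U.1) :=
      RingEquiv.ofBijective ((j g).appLE V.1 U.1 hUV.le).hom (h.appLE_translate_bijective U.1 g)
    have hb : Function.Bijective
        ((jE g).appLE (F ⁻¹ᵁ V.1) (π ⁻¹ᵁ U.1) (preimage_eq hF hUV).le) := by
      refine appLE_bijective (jE g) (fun y hy => ?_) (preimage_eq hF hUV)
      obtain ⟨x', -, hx'⟩ := hy
      exact h.mem_range_of_map_eq hE hF hx'
    let b : Γ(WE.X, F ⁻¹ᵁ V.1) ≃+* Γ(E.X, π ⁻¹ᵁ U.1) :=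
      RingEquiv.ofBijective ((jE g).appLE (F ⁻¹ᵁ V.1) (π ⁻¹ᵁ U.1) (preimage_eq hF hUV).le).hom hb
    have hav : ∀ f, a.symm f ∈ J.ideal V ↔ f ∈ I.ideal U := fun f => by
      refine (h.mem_ideal_translate (hJ g) U (a.symm f)).trans ?_
      exact (congrArg (· ∈ I.ideal U) (a.apply_symm_apply f)).to_iff
    let m₀ : I.ideal U →+ R :=
      { toFun f := m ⟨a.symm f.1, (hav f.1).mpr f.2⟩
        map_zero' := by
          rw [← map_zero m]
          exact congrArg m (Subtype.ext (map_zero a.symm))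
        map_add' f f' := by
          rw [← map_add m]
          exact congrArg m (Subtype.ext (map_add a.symm _ _)) }
    have hm₀ : ∀ f : J.ideal V, m₀ (h.resIdeal hJ g V U hUV.le f) = m f := fun f =>
      congrArg m (Subtype.ext (a.symm_apply_apply f.1))
    have hba : ∀ r, b (F.app V.1 r) = π.app U.1 (a r) := hFπ g V.1 U.1 hUV.le
    have hbL : ∀ f, b (L V f) = l U (h.resIdeal hJ g V U hUV.le f) := hL V g U hUV.le
    obtain ⟨q, ⟨hq₁, hq₂⟩, hq⟩ := hU R (p.comp a.symm) m₀
      (fun f => hp ⟨a.symm f.1, (hav f.1).mpr f.2⟩) (fun r f => by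
        rw [RingHom.comp_apply]
        refine Eq.trans ?_ (hm _ _)
        exact congrArg m (Subtype.ext (map_mul a.symm _ _)))
    refine ⟨q.comp b, ⟨fun r => ?_, fun f => ?_⟩, fun q' ⟨h₁, h₂⟩ => ?_⟩
    · change q (b (F.app V.1 r)) = _
      rw [hba, hq₁]
      exact congrArg p (a.symm_apply_apply r)
    · change q (b (L V f)) = _
      rw [hbL, hq₂, hm₀]
    · have := hq (q'.comp b.symm) ⟨fun r => ?_, fun f => ?_⟩
      · rw [← this]
        ext s
        exact congrArg q' (b.symm_apply_apply s).symm
      · obtain ⟨r, rfl⟩ := a.surjective r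
        change q' (b.symm _) = p (a.symm (a r))
        rw [← hba, b.symm_apply_apply, a.symm_apply_apply, h₁]
      · have hf : h.resIdeal hJ g V U hUV.le ⟨a.symm f.1, (hav f.1).mpr f.2⟩ = f :=
          Subtype.ext (a.apply_symm_apply f.1)
        rw [← hf, hm₀, ← h₂]
        change q' (b.symm _) = _
        rw [← hbL, b.symm_apply_apply]

end NormalBundle

end IsInd

end GScheme

namespace GScheme

/-! ## The class of an induced space -/

variable {k : Type u} [Field k] {G : Type v} [Group G] [Finite G] {G' : Subgroup G}

/-- The compactification, the divisors and the normal bundles of their intersections are all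
induced. The formula is then preserved because `indHom` is additive. -/
lemma IsInd.isClassOfComplement {U : GScheme k G'} {WU : GScheme k G} {jU : G → (U.X ⟶ WU.X)}
    (hU : IsInd U WU jU) {n : ℕ} {c : Burn k G' n} (hc : U.IsClassOfComplement c) :
    WU.IsClassOfComplement (indHom k G' n c) := by
  obtain ⟨Y, q, ℓ, I, E, π, c₀, cN, hY₁, hY₂, hY₃, hY₄, hI, hsnc, hq, hqo, hqr, hc₀, hE, rfl⟩ := hc
  obtain ⟨WY, jY, hY⟩ := exists_isInd Y
  obtain ⟨Q, hQ⟩ := hY.exists_map hU hq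
  choose J hJ hJc using fun i => hY.exists_ideal (hI i)
  -- The data `E S` and `π S` are constrained only for nonempty `S`; for empty `S` the space `WY`
  -- with its identity is a filler.
  have hP : ∀ S : Finset (Fin ℓ), ∃ (WE : GScheme k G) (R : WE.X ⟶ WY.X), S.Nonempty →
      ∃ jE : G → ((E S).X ⟶ WE.X), IsInd (E S) WE jE ∧ ∀ g, jE g ≫ R = π S ≫ jY g := fun S => by
    by_cases hS : S.Nonempty
    · obtain ⟨WE, jE, hWE⟩ := exists_isInd (E S)
      obtain ⟨R, hR⟩ := hY.exists_map hWE (hE S hS).1.1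
      exact ⟨WE, R, fun _ => ⟨jE, hWE, hR⟩⟩
    · exact ⟨WY, 𝟙 _, fun h => absurd h hS⟩
  choose WE R hR using hP
  refine ⟨WY, Q, ℓ, J, WE, R, indHom k G' n c₀, fun S => indHom k G' n (cN S),
    hY.isVariety hY₁, hY.isProjective hY₂, hY.isGenericallyFree hY₃, hY.isDivisorial hY₄, hJ,
    hY.isSNC hJc hsnc, hY.isEquivariant_map hU hq hQ,
    hY.of_map hU hQ (P := @IsOpenImmersion) hqo, ?_, hY.isStrataSum hc₀,
    fun S hS => ?_, ?_⟩
  · ext y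
    obtain ⟨g, x, rfl⟩ := hY.exists_eq y
    have h₁ : jY g x ∈ Set.range Q ↔ x ∈ Set.range q := by
      constructor
      · rintro ⟨z, hz⟩
        obtain ⟨w, rfl⟩ := hY.mem_range_of_map_eq hU hQ hz.symm
        refine ⟨w, hY.injective g ?_⟩
        rw [← hz, ← Scheme.Hom.comp_apply, ← Scheme.Hom.comp_apply, hQ]
      · rintro ⟨w, rfl⟩
        exact ⟨jU g w, by rw [← Scheme.Hom.comp_apply, ← Scheme.Hom.comp_apply, hQ]⟩
    rw [h₁, hqr]
    exact forall_congr' fun i => not_congr (IsInd.mem_support_iff (hJc i)).symm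
  · obtain ⟨jE, hWE, hR⟩ := hR S hS
    exact ⟨hY.isNormalBundle hWE (fun g => comap_finset_sup (fun i => hJc i g) S) hR (hE S hS).1,
      hWE.isStrataSum (hE S hS).2⟩
  · simp only [map_add, map_sum, map_zsmul]

lemma IsInd.isClass {X : GScheme k G'} {W : GScheme k G} {j : G → (X.X ⟶ W.X)}
    (h : IsInd X W j) {n : ℕ} {c : Burn k G' n} (hc : X.IsClass c) :
    W.IsClass (indHom k G' n c) := by
  obtain ⟨U, p, hp, hU⟩ := hc
  obtain ⟨WU, jU, hWU⟩ := exists_isInd U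
  obtain ⟨P, hP⟩ := h.exists_map hWU hp.1
  exact ⟨WU, P, h.isModification_map hWU hp.1 hP hp, hWU.isClassOfComplement hU⟩

end GScheme

end EqBurnside

end

theorem mainTheorem12 (k : Type u) [Field k] [CharZero k] (G : Type v) [Group G] [Finite G]
    (hk : ∃ ζ : k, IsPrimitiveRoot ζ (Nat.card G)) (G' : Subgroup G) (n : ℕ) :
    ∃ (ind : Burn k G' n →+ Burn k G n) (κ' : Burn k G' n →+ OrbBurn k n)
      (κ : Burn k G n →+ OrbBurn k n),
      (IsInductionHom ind ∧ ∀ ind₁ : Burn k G' n →+ Burn k G n, IsInductionHom ind₁ → ind₁ = ind) ∧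
      (IsKappa κ' ∧ ∀ κ₁ : Burn k G' n →+ OrbBurn k n, IsKappa κ₁ → κ₁ = κ') ∧
      (IsKappa κ ∧ ∀ κ₁ : Burn k G n →+ OrbBurn k n, IsKappa κ₁ → κ₁ = κ) ∧
      (∀ X : GScheme k G', X.IsVariety n → X.IsGenericallyFree →
        (∃ W : GScheme k G, GScheme.IsInducedSpace X W) ∧
        ∀ W : GScheme k G, GScheme.IsInducedSpace X W →
          W.IsVariety n ∧ W.IsGenericallyFree ∧
          (X.IsProjective → X.IsDivisorial →
            W.IsProjective ∧ W.IsDivisorial ∧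
            ∀ c : Burn k G' n, X.IsStrataSum c → W.IsStrataSum (ind c)) ∧
          ∀ c : Burn k G' n, X.IsClass c → W.IsClass (ind c)) ∧
      κ.comp ind = κ' := by
  have hk' := exists_isPrimitiveRoot_subgroup hk G'
  refine ⟨indHom k G' n, kappaHom hk' n, kappaHom hk n,
    ⟨isInductionHom_indHom, fun _ h => h.eq_indHom⟩,
    ⟨isKappa_kappaHom hk', fun _ h => h.eq_kappaHom hk'⟩,
    ⟨isKappa_kappaHom hk, fun _ h => h.eq_kappaHom hk⟩, fun X hX hf => ⟨?_, fun W hW => ?_⟩,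
    kappaHom_comp_indHom hk⟩
  · obtain ⟨W, j, h⟩ := GScheme.exists_isInd X
    exact ⟨W, h.isInducedSpace⟩
  · obtain ⟨j, h⟩ := hW.exists_isInd
    exact ⟨h.isVariety hX, h.isGenericallyFree hf,
      fun hp hd => ⟨h.isProjective hp, h.isDivisorial hd, fun _ hc => h.isStrataSum hc⟩,
      fun _ hc => h.isClass hc⟩
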